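/- **Setting.** Let $d\ge 3$. A configuration is $C=(x_1,\dots,x_4)$ with $x_k=(\tau_k,\mathbf x_k)$, $\tau_k=\epsilon_k+it_k\in\mathbb C$, $\mathbf x_k\in\mathbb R^{d-1}$; put $x_{ij}^2=(\tau_i-\tau_j)^2+|\mathbf x_i-\mathbf x_j|^2$, $$u=\frac{x_{12}^2x_{34}^2}{x_{13}^2x_{24}^2}=z\bar z,\qquad v=\frac{x_{14}^2x_{23}^2}{x_{13}^2x_{24}^2}=(1-z)(1-\bar z),$$ the pair $(z,\bar z)$ being defined up to interchange. Let $\mathcal D=\{\mathrm{Re}\,\tau_1>\mathrm{Re}\,\tau_2>\mathrm{Re}\,\tau_3>\mathrm{Re}\,\tau_4\}$, $\mathcal D_E\subset\mathcal D$ the part with real $\tau_k$, $\Gamma$ the locus $4u=(1+u-v)^2$ (i.e. $z=\bar z$), and $\mathcal D_L\subset\partial\mathcal D$ the Lorentzian configurations ($\epsilon_k=0$ for all $k$) with $x_{ij}^2\neq0$ for $i\ne j$. Write $i\to j$ if $t_j-t_i>|\mathbf x_i-\mathbf x_j|$. A causal ordering $\alpha$ is a directed graph on $\{1,2,3,4\}$,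 and $\mathcal D_L^\alpha$ is the set of $C\in\mathcal D_L$ whose arrows $i\to j$ are exactly those of $\alpha$. Classes in $\mathcal D_L$ (up to $z\leftrightarrow\bar z$): S: $0<z<1,\ \bar z<0$; T: $z>1,\ 0<\bar z<1$; U: $z>1,\ \bar z<0$; $\mathrm E_{su}$: $z,\bar z<0$; $\mathrm E_{st}$: $0<z,\bar z<1$; $\mathrm E_{tu}$: $z,\bar z>1$; $\mathrm E_{stu}$: $\bar z=z^*$ not real; $\mathrm E=\mathrm E_{su}\cup\mathrm E_{st}\cup\mathrm E_{tu}\cup\mathrm E_{stu}$. *Crossing numbers.* An admissible path to $C$ is a continuous $\gamma:[0,1]\to\overline{\mathcal D}$ with $\gamma(0)\in\mathcal D_E\setminus\Gamma$, $\gamma(s)\in\mathcal D\setminus\Gamma$ for $s<1$, $\gamma(1)=C$; along it $z,\bar z$ are followed continuously from $\mathrm{Im}\,z\ge0\ge\mathrm{Im}\,\bar z$ at $s=0$. For $C$ with $z,\bar z\notin(-\infty,0)$, $N_t$ is the number of times $z$ crosses $(-\infty,0)$ from above minus the number of times from below, plus the same number for $\bar z$; for $C$ with $z,\bar z\notin(0,1)$,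 $N_u$ is defined in the same way with $(0,1)$. "$N_t(C)=N$" means that admissible paths to $C$ exist and that every one of them gives the value $N$; likewise for $N_u$. *Criteria at $C\in\mathcal D_L$.* s-channel: $z,\bar z\notin(1,\infty)$; t-channel: $z,\bar z\notin(-\infty,0)$ and $N_t(C)=0$; u-channel: $z,\bar z\notin(0,1)$ and $N_u(C)=0$. *Four-point function.* Let $G_4^E=g(u,v)/[x_{12}^2x_{34}^2]^{\Delta}$ be the Euclidean four-point function of identical scalar primaries of dimension $\Delta$ in a unitary CFT on $\mathbb R^d$: it is permutation symmetric, and for $0<|\rho|<1$, $\bar\rho=\rho^*$, $z=4\rho/(1+\rho)^2$, $\bar z=z^*$, one has $g=\sum b_{h,\bar h}\,\rho^h\bar\rho^{\bar h}$, a convergent sum with $b_{h,\bar h}=b_{\bar h,h}\ge0$, $h,\bar h\ge0$, $h-\bar h\in\mathbb Z$. A continuation $G_4$ is a continuous function on $\mathcal D$, analytic in the $\tau_k$, equal to $G_4^E$ on $\mathcal D_E$. Put $$G_4^L(C)=\lim_{\epsilon_k\to0,\ \epsilon_1>\epsilon_2>\epsilon_3>\epsilon_4}G_4(\epsilon_k+it_k,\mathbf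 x_k)$$ when this limit exists. $G_4^L$ *has a convergent s-channel expansion at $C$* if admissible paths to $C$ exist and, for each of them, following continuously $\rho=e^{i\chi},\bar\rho=e^{i\bar\chi}$ with $z=4\rho/(1+\rho)^2$, $\bar z=4\bar\rho/(1+\bar\rho)^2$, $|\rho|,|\bar\rho|\le1$, $0\le\mathrm{Re}\,\chi(0)\le\pi$, $-\pi\le\mathrm{Re}\,\bar\chi(0)\le0$, and a logarithm of $x_{12}^2x_{34}^2$ that is real at the start, the series $\sum b_{h,\bar h}e^{i(h\chi+\bar h\bar\chi)}$ converges absolutely at the end of the path, the limit $G_4^L(C)$ exists, and $G_4^L(C)=[x_{12}^2x_{34}^2]^{-\Delta}\sum b_{h,\bar h}e^{i(h\chi+\bar h\bar\chi)}$. **Theorem 4.3.** A continuation $G_4$ of $G_4^E$ exists. For every continuation $G_4$ and every causal ordering $\alpha$, $\mathcal D_L^\alpha$ is contained in one of S, T, U, E, and: 1. If $\mathcal D_L^\alpha\subseteq\mathrm S$, then at every $C\in\mathcal D_L^\alpha$ the function $G_4^L$ has a convergent s-channel expansion and, of the three criteria, only the s-channel one holds. 2. If $\mathcal D_L^\alpha\subseteq\mathrm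 T$, then $N_t$ has the same value at all $C\in\mathcal D_L^\alpha$. 3. If $\mathcal D_L^\alpha\subseteq\mathrm U$, then $N_u$ has the same value at all $C\in\mathcal D_L^\alpha$. 4. If $\mathcal D_L^\alpha\subseteq\mathrm E$, then - on $\mathcal D_L^\alpha\cap\mathrm E_{st}$, $G_4^L$ has a convergent s-channel expansion, the s-channel criterion holds, and $N_t$ is constant; - on $\mathcal D_L^\alpha\cap\mathrm E_{su}$, $G_4^L$ has a convergent s-channel expansion, the s-channel criterion holds, and $N_u$ is constant; - on $\mathcal D_L^\alpha\cap\mathrm E_{tu}$, the s-channel criterion fails, and $N_t$ and $N_u$ are constant; - on $\mathcal D_L^\alpha\cap\mathrm E_{stu}$, $G_4^L$ has a convergent s-channel expansion, the s-channel criterion holds, and $N_t$ and $N_u$ are constant. Consequently, for $\mathcal C$ any of S, T, U, $\mathrm E_{st}$, $\mathrm E_{su}$, $\mathrm E_{tu}$, $\mathrm E_{stu}$, each of the three criteria holds at all points of $\mathcal D_L^\alpha\cap\mathcal C$ or at none. -/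

import Mathlib

open Set Filter Topology

namespace LorentzOPE

/-- Spatial vectors of a `d`-dimensional space(time), with the Euclidean norm. -/
abbrev Space (d : ℕ) : Type := EuclideanSpace ℝ (Fin (d - 1))

/-- Four points `x_k = (τ_k, 𝐱_k)` with complex temporal variables `τ_k = ε_k + i t_k` and real
spatial vectors `𝐱_k`. The points `1, 2, 3, 4` carry the indices `0, 1, 2, 3`. -/
abbrev Config (d : ℕ) : Type := (Fin 4 → ℂ) × (Fin 4 → Space d)

variable {d : ℕ}

/-- `x_{ij}² = (τ_i - τ_j)² + |𝐱_i - 𝐱_j|²`. -/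
noncomputable def sqDist (C : Config d) (i j : Fin 4) : ℂ :=
  (C.1 i - C.1 j) ^ 2 + ((‖C.2 i - C.2 j‖ ^ 2 : ℝ) : ℂ)

/-- The cross-ratio `u = x_{12}² x_{34}² / (x_{13}² x_{24}²)`. -/
noncomputable def crossU (C : Config d) : ℂ :=
  sqDist C 0 1 * sqDist C 2 3 / (sqDist C 0 2 * sqDist C 1 3)

/-- The cross-ratio `v = x_{14}² x_{23}² / (x_{13}² x_{24}²)`. -/
noncomputable def crossV (C : Config d) : ℂ :=
  sqDist C 0 3 * sqDist C 1 2 / (sqDist C 0 2 * sqDist C 1 3)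

/-- `(z, w)` (with `w` in the role of `z̄`) is a pair of cross-ratio variables of `C`:
`u = z w` and `v = (1 - z)(1 - w)`. The pair is determined by `C` up to interchange. -/
def IsZPair (C : Config d) (z w : ℂ) : Prop :=
  crossU C = z * w ∧ crossV C = (1 - z) * (1 - w)

/-- The temporal variables with `Re τ_1 > Re τ_2 > Re τ_3 > Re τ_4`. -/
def orderedTimes : Set (Fin 4 → ℂ) := {τ | StrictAnti fun k => (τ k).re}

/-- The domain `𝒟` of the analytic continuation. -/
def domainD (d : ℕ) : Set (Config d) := {C | C.1 ∈ orderedTimes}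

/-- The Euclidean subset `𝒟_E` of `𝒟`. -/
def domainE (d : ℕ) : Set (Config d) := {C | C ∈ domainD d ∧ ∀ k, (C.1 k).im = 0}

/-- The branch locus `Γ`, where `z = z̄`. -/
def branchLocus (d : ℕ) : Set (Config d) :=
  {C | 4 * crossU C - (1 + crossU C - crossV C) ^ 2 = 0}

/-- The Lorentzian configurations `𝒟_L` (light-cone singularities excluded). -/
def lorentz (d : ℕ) : Set (Config d) :=
  {C | C ∈ frontier (domainD d) ∧ (∀ k, (C.1 k).re = 0) ∧ ∀ i j, i ≠ j → sqDist C i j ≠ 0}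

/-! ### Causal orderings and classes -/

/-- `x_i → x_j`: the point `x_j` is in the open forward light-cone of `x_i`. -/
def Precedes (C : Config d) (i j : Fin 4) : Prop :=
  ‖C.2 i - C.2 j‖ < (C.1 j).im - (C.1 i).im

/-- `𝒟_L^α`: the Lorentzian configurations with causal ordering `α`, a directed graph on the
indices. -/
def lorentzOrd (d : ℕ) (α : Fin 4 → Fin 4 → Prop) : Set (Config d) :=
  {C | C ∈ lorentz d ∧ ∀ i j, Precedes C i j ↔ α i j}

def classS (d : ℕ) : Set (Config d) :=
  {C | C ∈ lorentz d ∧ ∃ z w : ℝ, IsZPair C z w ∧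
    ((0 < z ∧ z < 1 ∧ w < 0) ∨ (z < 0 ∧ 0 < w ∧ w < 1))}

def classT (d : ℕ) : Set (Config d) :=
  {C | C ∈ lorentz d ∧ ∃ z w : ℝ, IsZPair C z w ∧
    ((1 < z ∧ 0 < w ∧ w < 1) ∨ (0 < z ∧ z < 1 ∧ 1 < w))}

def classU (d : ℕ) : Set (Config d) :=
  {C | C ∈ lorentz d ∧ ∃ z w : ℝ, IsZPair C z w ∧ ((1 < z ∧ w < 0) ∨ (z < 0 ∧ 1 < w))}

def classEsu (d : ℕ) : Set (Config d) :=
  {C | C ∈ lorentz d ∧ ∃ z w : ℝ, IsZPair C z w ∧ z < 0 ∧ w < 0}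

def classEst (d : ℕ) : Set (Config d) :=
  {C | C ∈ lorentz d ∧ ∃ z w : ℝ, IsZPair C z w ∧ 0 < z ∧ z < 1 ∧ 0 < w ∧ w < 1}

def classEtu (d : ℕ) : Set (Config d) :=
  {C | C ∈ lorentz d ∧ ∃ z w : ℝ, IsZPair C z w ∧ 1 < z ∧ 1 < w}

def classEstu (d : ℕ) : Set (Config d) :=
  {C | C ∈ lorentz d ∧ ∃ z w : ℂ, IsZPair C z w ∧ w = star z ∧ z.im ≠ 0}

def classE (d : ℕ) : Set (Config d) :=
  classEsu d ∪ classEst d ∪ classEtu d ∪ classEstu d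

/-! ### Paths to a configuration and the numbers `N_t`, `N_u` -/

/-- A path from `𝒟_E \ Γ` to `C` in the closure of `𝒟`, inside `𝒟 \ Γ` before its final point. -/
structure IsPathTo (C : Config d) (γ : unitInterval → Config d) : Prop where
  continuous : Continuous γ
  mem_closure : ∀ s, γ s ∈ closure (domainD d)
  start : γ 0 ∈ domainE d \ branchLocus d
  inner : ∀ s, s < 1 → γ s ∈ domainD d \ branchLocus d
  finish : γ 1 = C

/-- The curves of `z` and `z̄` along a path, with `Im z ≥ 0` and `Im z̄ ≤ 0` at its start. -/
structure IsZCurve (γ : unitInterval → Config d) (z w : unitInterval → ℂ) : Prop where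
  continuous_z : Continuous z
  continuous_w : Continuous w
  pair : ∀ s, IsZPair (γ s) (z s) (w s)
  start_z : 0 ≤ (z 0).im
  start_w : (w 0).im ≤ 0

/-- A set of real numbers, as a subset of the complex plane. -/
def onReal (I : Set ℝ) : Set ℂ := {z | z.im = 0 ∧ z.re ∈ I}

/-- `1` for a step from above to below the real axis, `-1` for a step from below to above,
`0` for no change of side. -/
noncomputable def sideChange (a b : ℂ) : ℤ :=
  if 0 < a.im ∧ b.im < 0 then 1 else if a.im < 0 ∧ 0 < b.im then -1 else 0

/-- The curve `f` crosses the real interval `I` from above `n` times more often than from below.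
The curve is cut, at finitely many points off `I`, into pieces that either avoid `I`, and
contribute nothing, or stay in the vertical strip over `I`, where the only way from one side of the
real axis to the other leads through `I`. For a curve that meets `I` in finitely many points this is
the difference of the two numbers of crossings. -/
def HasSignedCrossings (I : Set ℝ) (f : unitInterval → ℂ) (n : ℤ) : Prop :=
  ∃ (m : ℕ) (s : Fin (m + 1) → unitInterval) (c : Fin m → ℤ),
    Monotone s ∧ s 0 = 0 ∧ s (Fin.last m) = 1 ∧ (∀ k, f (s k) ∉ onReal I) ∧
    (∀ k : Fin m,
      ((∀ r ∈ Icc (s k.castSucc) (s k.succ), f r ∉ onReal I) ∧ c k = 0) ∨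
      ((∀ r ∈ Icc (s k.castSucc) (s k.succ), (f r).re ∈ I) ∧
        c k = sideChange (f (s k.castSucc)) (f (s k.succ)))) ∧
    n = ∑ k, c k

/-- `N(γ) = n(γ) + n̄(γ)`: signed crossings of `I` by `z` plus those by `z̄`, along `γ`. -/
def PathNumber (I : Set ℝ) (γ : unitInterval → Config d) (N : ℤ) : Prop :=
  ∃ (z w : unitInterval → ℂ) (n n' : ℤ), IsZCurve γ z w ∧
    HasSignedCrossings I z n ∧ HasSignedCrossings I w n' ∧ N = n + n'

/-- There are paths to `C`, and along each of them the number of crossings is well defined and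
equal to `N`. -/
def HasNumber (I : Set ℝ) (C : Config d) (N : ℤ) : Prop :=
  (∃ γ, IsPathTo C γ) ∧ ∀ γ, IsPathTo C γ → ∀ M, PathNumber I γ M ↔ M = N

/-- `N_t(C) = N`, counting crossings of `(-∞, 0)`. -/
def HasNt (C : Config d) (N : ℤ) : Prop := HasNumber (Iio 0) C N

/-- `N_u(C) = N`, counting crossings of `(0, 1)`. -/
def HasNu (C : Config d) (N : ℤ) : Prop := HasNumber (Ioo 0 1) C N

/-- Neither `z` nor `z̄` of `C` is in `I`. -/
def ZAvoids (I : Set ℝ) (C : Config d) : Prop :=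
  ∀ z w, IsZPair C z w → z ∉ onReal I ∧ w ∉ onReal I

/-- The criterion of s-channel convergence: `z, z̄ ∉ (1, ∞)`. -/
def SCriterion (C : Config d) : Prop := ZAvoids (Ioi 1) C

/-- The criterion of t-channel convergence: `z, z̄ ∉ (-∞, 0)` and `N_t = 0`. -/
def TCriterion (C : Config d) : Prop := ZAvoids (Iio 0) C ∧ HasNt C 0

/-- The criterion of u-channel convergence: `z, z̄ ∉ (0, 1)` and `N_u = 0`. -/
def UCriterion (C : Config d) : Prop := ZAvoids (Ioo 0 1) C ∧ HasNu C 0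

/-! ### Four-point functions -/

/-- A Euclidean configuration as a configuration with complex temporal variables. -/
def euclid (τ : Fin 4 → ℝ) (x : Fin 4 → Space d) : Config d := (fun k => (τ k : ℂ), x)

/-- The four points are pairwise distinct. -/
def Distinct (τ : Fin 4 → ℝ) (x : Fin 4 → Space d) : Prop :=
  ∀ i j, i ≠ j → τ i ≠ τ j ∨ x i ≠ x j

/-- The term of weights `h = (E + m) / 2`, `h̄ = (E - m) / 2` of a radial series
`∑ b_{h,h̄} ρ^h ρ̄^h̄` at `ρ = exp (i χ)`, `ρ̄ = exp (i χ')`; here `p = (E, m)`. -/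
noncomputable def radialTerm (b : ℝ → ℤ → ℝ) (χ χ' : ℂ) (p : ℝ × ℤ) : ℂ :=
  (b p.1 p.2 : ℂ) *
    Complex.exp (Complex.I * (((p.1 + p.2) / 2 : ℂ) * χ + ((p.1 - p.2) / 2 : ℂ) * χ'))

/-- The four-point function of identical scalar primaries of dimension `Δ` in a Euclidean unitary
CFT on `ℝ^d`: it is conformally covariant, symmetric under permutations of the four points
(crossing), and has the s-channel (radial quantization) expansion over states of weights
`h, h̄ ≥ 0` and integer planar spin `m = h - h̄`, with coefficients that are non-negative (unitarity)
and symmetric in `h, h̄` (reflection), convergent for `|ρ| < 1`. The decomposition of the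
coefficients into representations of the rotation group is not recorded. -/
structure UnitaryCFT (d : ℕ) where
  /-- the scaling dimension -/
  Δ : ℝ
  /-- the Euclidean four-point function -/
  GE : (Fin 4 → ℝ) → (Fin 4 → Space d) → ℝ
  /-- its conformally invariant part, a function of `u` and `v` -/
  g : ℝ → ℝ → ℝ
  /-- the total coefficient of the states of energy `E = h + h̄` and planar spin `m = h - h̄` -/
  b : ℝ → ℤ → ℝ
  covariant : ∀ τ x, Distinct τ x →
    GE τ x = g (crossU (euclid τ x)).re (crossV (euclid τ x)).re /
      ((sqDist (euclid τ x) 0 1).re ^ Δ * (sqDist (euclid τ x) 2 3).re ^ Δ)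
  symmetric : ∀ (σ : Equiv.Perm (Fin 4)) (τ : Fin 4 → ℝ) (x : Fin 4 → Space d),
    Distinct τ x → GE (τ ∘ σ) (x ∘ σ) = GE τ x
  b_nonneg : ∀ E m, 0 ≤ b E m
  b_symm : ∀ E m, b E (-m) = b E m
  b_weights : ∀ (E : ℝ) (m : ℤ), b E m ≠ 0 → |(m : ℝ)| ≤ E
  /-- the expansion at `ρ = exp (i χ)`, `ρ̄ = ρ^*`, where `z = 4 ρ / (1 + ρ)²`, `z̄ = z^*` -/
  expansion : ∀ χ z : ℂ, 0 < χ.im →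
    z = 4 * Complex.exp (Complex.I * χ) / (1 + Complex.exp (Complex.I * χ)) ^ 2 →
    HasSum (radialTerm b χ (-star χ)) ((g (‖z‖ ^ 2) (‖1 - z‖ ^ 2) : ℝ) : ℂ)

/-- `G` is the analytic continuation to `𝒟` of the Euclidean four-point function: continuous,
analytic in the temporal variables, and equal to the Euclidean function on `𝒟_E`. -/
structure IsContinuation (F : UnitaryCFT d) (G : Config d → ℂ) : Prop where
  continuousOn : ContinuousOn G (domainD d)
  analytic : ∀ x : Fin 4 → Space d, DifferentiableOn ℂ (fun τ => G (τ, x)) orderedTimes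
  agrees : ∀ C ∈ domainE d, G C = (F.GE (fun k => (C.1 k).re) C.2 : ℂ)

/-- The Lorentzian four-point function exists at `C` and has the value `a`: `a` is the limit of
`G (ε_k + i t_k, 𝐱_k)` as `ε_k → 0` with `ε_1 > ε_2 > ε_3 > ε_4`. -/
def IsWickLimit (G : Config d → ℂ) (C : Config d) (a : ℂ) : Prop :=
  Tendsto (fun ε : Fin 4 → ℝ => G (fun k => (ε k : ℂ) + C.1 k, C.2))
    (𝓝[{ε | StrictAnti ε}] 0) (𝓝 a)

/-- A curve `χ` with `ρ = exp (i χ)` the radial coordinate of `z`: `z = 4 ρ / (1 + ρ)²`,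
`|ρ| ≤ 1`. -/
structure IsChiCurve (z χ : unitInterval → ℂ) : Prop where
  continuous : Continuous χ
  im_nonneg : ∀ s, 0 ≤ (χ s).im
  radial : ∀ s,
    z s * (1 + Complex.exp (Complex.I * χ s)) ^ 2 = 4 * Complex.exp (Complex.I * χ s)

/-- The Lorentzian four-point function has a convergent s-channel expansion at `C`. There are paths
to `C`, and for each of them, with `z, z̄, χ, χ̄` and a logarithm `ℓ` of `x_{12}² x_{34}²` followed
along it from their standard values at the Euclidean start, the radial series converges absolutely
at the final values of `χ, χ̄`, and the Lorentzian four-point function exists at `C` and equals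
`(x_{12}² x_{34}²)^{-Δ} ∑ b_{h,h̄} ρ^h ρ̄^h̄`. -/
def SChannelConverges (F : UnitaryCFT d) (G : Config d → ℂ) (C : Config d) : Prop :=
  (∃ γ, IsPathTo C γ) ∧ ∀ γ, IsPathTo C γ →
    ∃ z w χ χ' ℓ : unitInterval → ℂ, IsZCurve γ z w ∧
      IsChiCurve z χ ∧ 0 ≤ (χ 0).re ∧ (χ 0).re ≤ Real.pi ∧
      IsChiCurve w χ' ∧ -Real.pi ≤ (χ' 0).re ∧ (χ' 0).re ≤ 0 ∧
      Continuous ℓ ∧ (∀ s, Complex.exp (ℓ s) = sqDist (γ s) 0 1 * sqDist (γ s) 2 3) ∧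
      (ℓ 0).im = 0 ∧
      Summable (fun p => ‖radialTerm F.b (χ 1) (χ' 1) p‖) ∧
      IsWickLimit G C
        (Complex.exp (-(F.Δ : ℂ) * ℓ 1) * ∑' p, radialTerm F.b (χ 1) (χ' 1) p)

end LorentzOPE

open LorentzOPE

/-!
Everything followed along a path is, in a suitable symmetric combination, a single-valued continuous
function of the configuration; the criteria can then be read off at the end of the path.

*Logarithms.* `x_{ij}² = (τ_ij + i r)(τ_ij - i r)` with `r = |𝐱_i - 𝐱_j|`, and for `i < j` both
factors stay in the closed right half-plane. The sum `logSq` of their principal logarithms is thus a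
single-valued continuous logarithm of `x_{ij}²` on `𝒟` and at the Lorentzian configurations, real at
the Euclidean ones. It gives single-valued logarithms `logU`, `logV` of the cross-ratios. At a
Lorentzian configuration the phase of `x_{ij}²` is `π`, `-π` or `0` according to the causal relation
of the two points, so the phases of `u` and `v`, and with them the signs of `u` and `v`, depend on
the causal ordering only; the signs decide between the classes S, T, U and E.

*The radial series.* On `𝒟` neither `z` nor `z̄` is in `[1, ∞)` (`re_lt_one_of_isZPair` and
`domainD_subset_radialDomain`). Hence `√(1 - z)` can be taken in the open right half-plane, and
`ρ = (1 - √(1 - z)) / (1 + √(1 - z))` satisfies `|ρ| < 1`; the same holds for `z̄` and at the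
Lorentzian configurations with `z, z̄ ∉ (1, ∞)`. The terms of the series, symmetric under the exchange
of `ρ` and `ρ̄`, are continuous functions of the configuration, analytic in the times, because they
are functions of `√(1 - z) √(1 - z̄)` (the square root of `v` given by `logV`),
`√(1 - z) + √(1 - z̄)` and `log u`; the series converges locally
uniformly. Its sum `radialG` is a continuation, it is the only one since `𝒟_E` is a set of
uniqueness, and it extends continuously to these Lorentzian configurations
(`isContinuation_radialG`, `sChannelConverges`).

*Crossing numbers.* With the chart `g z = -z` for `(-∞, 0)` and `g z = z / (1 - z)` for `(0, 1)`, the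
curve `z` meets the interval exactly when a continuous logarithm of `g z` is a multiple of `2 π i`,
and a signed crossing is a unit change of the integer part of its number of turns. The product
`g z * g z̄` is `u`, respectively `u / v`, with the single-valued logarithm `logU`, respectively
`logU - logV`; so the sum of the two crossing numbers is the number of turns of this logarithm at
the end of the path, up to a sign (`IsCrossingChart.hasNumber`). It does not depend on the path, and
among the configurations with a given causal ordering it does not vary.

*Paths.* They exist (`exists_isPathTo`): on a complex line of times through a Euclidean configuration
and a Lorentzian one with the same spatial vectors, the discriminant of `z, z̄` is a polynomial, not
zero if the Euclidean times are well chosen; a generic small deformation of the segment avoids its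
zeros. If the spatial vectors coincide, other ones are contracted to a point along the path.
-/

namespace LorentzOPE

variable {d : ℕ}

/-! ### Squared distances and their logarithms -/

lemma sqDist_comm (C : Config d) (i j : Fin 4) : sqDist C i j = sqDist C j i := by
  unfold sqDist
  rw [norm_sub_rev (C.2 i)]
  ring

lemma sqDist_eq_mul (C : Config d) (i j : Fin 4) :
    sqDist C i j = (C.1 i - C.1 j + Complex.I * ‖C.2 i - C.2 j‖) *
      (C.1 i - C.1 j - Complex.I * ‖C.2 i - C.2 j‖) := by
  unfold sqDist
  push_cast
  linear_combination (‖C.2 i - C.2 j‖ : ℂ) ^ 2 * Complex.I_sq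

/-- A logarithm of `x_{ij}²`. It is the sum of the principal logarithms of the two light-cone
factors `τ_{ij} ± i |𝐱_{ij}|`, which have non-negative real part when `Re τ_i ≥ Re τ_j`; so, unlike
`Complex.log (sqDist C i j)`, it is continuous up to the Lorentzian configurations. -/
noncomputable def logSq (C : Config d) (i j : Fin 4) : ℂ :=
  Complex.log (C.1 i - C.1 j + Complex.I * ‖C.2 i - C.2 j‖) +
    Complex.log (C.1 i - C.1 j - Complex.I * ‖C.2 i - C.2 j‖)

lemma exp_logSq {C : Config d} {i j : Fin 4} (h : sqDist C i j ≠ 0) :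
    Complex.exp (logSq C i j) = sqDist C i j := by
  rw [sqDist_eq_mul] at h ⊢
  rw [logSq, Complex.exp_add, Complex.exp_log (left_ne_zero_of_mul h),
    Complex.exp_log (right_ne_zero_of_mul h)]

/-- The configurations with weakly ordered `Re τ_k` and without light-cone singularities. -/
def regular (d : ℕ) : Set (Config d) :=
  {C | (∀ i j, i < j → 0 ≤ (C.1 i - C.1 j).re) ∧ ∀ i j, i ≠ j → sqDist C i j ≠ 0}

lemma mem_slitPlane_of_re_nonneg {z : ℂ} (h : 0 ≤ z.re) (h0 : z ≠ 0) : z ∈ Complex.slitPlane := by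
  rw [Complex.mem_slitPlane_iff]
  by_contra! hc
  exact h0 (Complex.ext (le_antisymm hc.1 h) hc.2)

lemma lightCone_mem_slitPlane {C : Config d} (hC : C ∈ regular d) {i j : Fin 4} (hij : i < j) :
    C.1 i - C.1 j + Complex.I * ‖C.2 i - C.2 j‖ ∈ Complex.slitPlane ∧
      C.1 i - C.1 j - Complex.I * ‖C.2 i - C.2 j‖ ∈ Complex.slitPlane := by
  have h0 := hC.2 i j hij.ne
  have h1 := hC.1 i j hij
  rw [sqDist_eq_mul] at h0
  constructor
  · apply mem_slitPlane_of_re_nonneg _ (left_ne_zero_of_mul h0)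
    simpa using h1
  · apply mem_slitPlane_of_re_nonneg _ (right_ne_zero_of_mul h0)
    simpa using h1

lemma continuousOn_logSq {i j : Fin 4} (hij : i < j) :
    ContinuousOn (fun C : Config d => logSq C i j) (regular d) := by
  unfold logSq
  apply ContinuousOn.add
  · exact ContinuousOn.clog (by fun_prop) fun C hC => (lightCone_mem_slitPlane hC hij).1
  · exact ContinuousOn.clog (by fun_prop) fun C hC => (lightCone_mem_slitPlane hC hij).2

lemma sqDist_ne_zero_of_re_pos {C : Config d} {i j : Fin 4} (h : 0 < (C.1 i - C.1 j).re) :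
    sqDist C i j ≠ 0 := by
  rw [sqDist_eq_mul]
  refine mul_ne_zero (fun h0 => ?_) fun h0 => ?_ <;>
  · have := congrArg Complex.re h0
    simp at this
    simp at h
    linarith

lemma re_sub_pos {C : Config d} (hC : C ∈ domainD d) {i j : Fin 4} (hij : i < j) :
    0 < (C.1 i - C.1 j).re := by
  have : (C.1 j).re < (C.1 i).re := hC hij
  simpa using this

lemma sqDist_ne_zero {C : Config d} (hC : C ∈ domainD d) {i j : Fin 4} (hij : i ≠ j) :
    sqDist C i j ≠ 0 := by
  rcases lt_or_gt_of_ne hij with h | h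
  · exact sqDist_ne_zero_of_re_pos (re_sub_pos hC h)
  · rw [sqDist_comm]
    exact sqDist_ne_zero_of_re_pos (re_sub_pos hC h)

lemma domainD_subset_regular : domainD d ⊆ regular d := fun _ hC =>
  ⟨fun _ _ hij => (re_sub_pos hC hij).le, fun _ _ hij => sqDist_ne_zero hC hij⟩

lemma lorentz_subset_regular : lorentz d ⊆ regular d := fun C hC =>
  ⟨fun i j _ => by simp [hC.2.1 i, hC.2.1 j], hC.2.2⟩

/-- The logarithm of `u` that is real at the Euclidean configurations. -/
noncomputable def logU (C : Config d) : ℂ :=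
  logSq C 0 1 + logSq C 2 3 - logSq C 0 2 - logSq C 1 3

/-- The logarithm of `v` that is real at the Euclidean configurations. -/
noncomputable def logV (C : Config d) : ℂ :=
  logSq C 0 3 + logSq C 1 2 - logSq C 0 2 - logSq C 1 3

lemma exp_logU {C : Config d} (hC : C ∈ regular d) : Complex.exp (logU C) = crossU C := by
  unfold logU crossU
  rw [Complex.exp_sub, Complex.exp_sub, Complex.exp_add, exp_logSq (hC.2 _ _ (by decide)),
    exp_logSq (hC.2 _ _ (by decide)), exp_logSq (hC.2 _ _ (by decide)),
    exp_logSq (hC.2 _ _ (by decide)), div_div]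

lemma exp_logV {C : Config d} (hC : C ∈ regular d) : Complex.exp (logV C) = crossV C := by
  unfold logV crossV
  rw [Complex.exp_sub, Complex.exp_sub, Complex.exp_add, exp_logSq (hC.2 _ _ (by decide)),
    exp_logSq (hC.2 _ _ (by decide)), exp_logSq (hC.2 _ _ (by decide)),
    exp_logSq (hC.2 _ _ (by decide)), div_div]

lemma continuousOn_logU : ContinuousOn (logU (d := d)) (regular d) :=
  (((continuousOn_logSq (by decide)).add (continuousOn_logSq (by decide))).sub
    (continuousOn_logSq (by decide))).sub (continuousOn_logSq (by decide))

lemma continuousOn_logV : ContinuousOn (logV (d := d)) (regular d) :=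
  (((continuousOn_logSq (by decide)).add (continuousOn_logSq (by decide))).sub
    (continuousOn_logSq (by decide))).sub (continuousOn_logSq (by decide))

lemma crossU_ne_zero {C : Config d} (hC : C ∈ regular d) : crossU C ≠ 0 := by
  rw [← exp_logU hC]; exact Complex.exp_ne_zero _

lemma crossV_ne_zero {C : Config d} (hC : C ∈ regular d) : crossV C ≠ 0 := by
  rw [← exp_logV hC]; exact Complex.exp_ne_zero _

lemma continuousOn_crossU : ContinuousOn (crossU (d := d)) (regular d) :=
  (continuousOn_logU.cexp).congr fun _ hC => (exp_logU hC).symm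

lemma continuousOn_crossV : ContinuousOn (crossV (d := d)) (regular d) :=
  (continuousOn_logV.cexp).congr fun _ hC => (exp_logV hC).symm

/-! ### The pair `z, z̄` -/

lemma IsZPair.swap {C : Config d} {z w : ℂ} (h : IsZPair C z w) : IsZPair C w z :=
  ⟨h.1.trans (mul_comm _ _), h.2.trans (mul_comm _ _)⟩

lemma IsZPair.eq_or_eq {C : Config d} {z w z' w' : ℂ} (h : IsZPair C z w) (h' : IsZPair C z' w') :
    z' = z ∧ w' = w ∨ z' = w ∧ w' = z := by
  have h1 : z * w = z' * w' := h.1.symm.trans h'.1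
  have h2 : (1 - z) * (1 - w) = (1 - z') * (1 - w') := h.2.symm.trans h'.2
  have h3 : (z' - z) * (z' - w) = 0 := by linear_combination (1 - z') * h1 + z' * h2
  have h4 : z' + w' = z + w := by linear_combination h2 - h1
  rcases mul_eq_zero.1 h3 with h | h
  · exact Or.inl ⟨by linear_combination h, by linear_combination h4 - h⟩
  · exact Or.inr ⟨by linear_combination h, by linear_combination h4 - h⟩

lemma exists_isZPair (C : Config d) : ∃ z w, IsZPair C z w := by
  obtain ⟨q, hq⟩ := IsAlgClosed.exists_pow_nat_eq
    ((1 + crossU C - crossV C) ^ 2 - 4 * crossU C) (n := 2) two_pos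
  refine ⟨(1 + crossU C - crossV C + q) / 2, (1 + crossU C - crossV C - q) / 2, ?_, ?_⟩
  · linear_combination hq / 4
  · linear_combination hq / 4

lemma IsZPair.ne_zero {C : Config d} (hC : C ∈ regular d) {z w : ℂ} (h : IsZPair C z w) :
    z ≠ 0 := by
  have := crossU_ne_zero hC
  rw [h.1] at this
  exact left_ne_zero_of_mul this

lemma IsZPair.ne_one {C : Config d} (hC : C ∈ regular d) {z w : ℂ} (h : IsZPair C z w) :
    z ≠ 1 := by
  have := crossV_ne_zero hC
  rw [h.2] at this
  intro h1
  exact left_ne_zero_of_mul this (by rw [h1, sub_self])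

lemma IsZPair.sq_sub {C : Config d} {z w : ℂ} (h : IsZPair C z w) :
    4 * crossU C - (1 + crossU C - crossV C) ^ 2 = -(z - w) ^ 2 := by
  rw [h.1, h.2]; ring

lemma IsZPair.mem_branchLocus {C : Config d} {z w : ℂ} (h : IsZPair C z w) :
    C ∈ branchLocus d ↔ z = w := by
  change 4 * crossU C - (1 + crossU C - crossV C) ^ 2 = 0 ↔ _
  rw [h.sq_sub, neg_eq_zero, sq_eq_zero_iff, sub_eq_zero]

/-! ### Real `z` on the domain `𝒟` -/

section Cone
variable {V : Type*} [NormedAddCommGroup V] [InnerProductSpace ℝ V]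

/-- On the tube `Re T > |Im y|`, `y = a + i b`, the quadratic form `T² + y · y` has no zero. -/
lemma quadratic_ne_zero_of_mem_tube {T : ℂ} {a b : V} (h : ‖b‖ < T.re) :
    T ^ 2 + ((‖a‖ ^ 2 - ‖b‖ ^ 2 : ℝ) + 2 * Complex.I * (inner ℝ a b : ℝ)) ≠ 0 := by
  intro h0
  have hre := congrArg Complex.re h0
  have him := congrArg Complex.im h0
  simp [pow_two] at hre him
  have hcs := abs_real_inner_le_norm a b
  have hb := norm_nonneg b
  have ha := norm_nonneg a
  have h1 : T.re * T.im = - inner ℝ a b := by linarith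
  have h2 : (T.re * T.im) ^ 2 ≤ (‖a‖ * ‖b‖) ^ 2 := by
    rw [h1, neg_sq, ← sq_abs]; gcongr
  have h3 : T.re * T.re * (T.re * T.re - ‖b‖ * ‖b‖ + ‖a‖ * ‖a‖) ≤ ‖a‖ * ‖a‖ * (‖b‖ * ‖b‖) := by
    nlinarith
  have h4 : ‖b‖ * ‖b‖ < T.re * T.re := by nlinarith
  nlinarith [mul_pos (by linarith [mul_self_nonneg ‖b‖] : 0 < T.re * T.re) (sub_pos.2 h4),
    mul_nonneg (mul_self_nonneg ‖a‖) (sub_pos.2 h4).le]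

/-- The inversion `(τ, y) ↦ (τ, y) / (τ² + y²)` maps the right half-space to the tube. -/
lemma inversion_mem_tube {τ : ℂ} (hτ : 0 < τ.re) (r : ℝ) {q : ℂ} (hq : q = τ ^ 2 + (r ^ 2 : ℝ)) :
    |(q⁻¹).im| * |r| < (q⁻¹ * τ).re := by
  have hq0 : q ≠ 0 := by
    have hf : q = (τ + Complex.I * r) * (τ - Complex.I * r) := by
      rw [hq]; push_cast; linear_combination (r : ℂ) ^ 2 * Complex.I_sq
    rw [hf]
    refine mul_ne_zero (fun h0 => ?_) fun h0 => ?_ <;>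
    · have := congrArg Complex.re h0
      simp at this
      linarith
  have hn : 0 < Complex.normSq q := Complex.normSq_pos.2 hq0
  have hqre : q.re = τ.re * τ.re - τ.im * τ.im + r ^ 2 := by
    rw [hq]; simp [pow_two]
  have hqim : q.im = 2 * τ.re * τ.im := by
    rw [hq]; simp [pow_two]; ring
  rw [Complex.mul_re, Complex.inv_re, Complex.inv_im, ← abs_mul]
  have e1 : q.re / Complex.normSq q * τ.re - -q.im / Complex.normSq q * τ.im =
      (τ.re * (τ.re ^ 2 + τ.im ^ 2 + r ^ 2)) / Complex.normSq q := by
    rw [hqre, hqim]; ring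
  have e2 : -q.im / Complex.normSq q * r = (-q.im * r) / Complex.normSq q := by ring
  rw [e1, e2, abs_div, abs_of_pos hn, div_lt_div_iff_of_pos_right hn, hqim, abs_lt]
  constructor <;> nlinarith [mul_nonneg hτ.le (sq_nonneg (τ.im - r)),
    mul_nonneg hτ.le (sq_nonneg (τ.im + r)), pow_pos hτ 3]

lemma quadratic_sum_three (α β γ : ℂ) (x y z : V) :
    ((‖α.re • x + β.re • y + γ.re • z‖ ^ 2 - ‖α.im • x + β.im • y + γ.im • z‖ ^ 2 : ℝ) : ℂ) +
      2 * Complex.I * (inner ℝ (α.re • x + β.re • y + γ.re • z)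
        (α.im • x + β.im • y + γ.im • z) : ℝ) =
    α ^ 2 * (‖x‖ ^ 2 : ℝ) + β ^ 2 * (‖y‖ ^ 2 : ℝ) + γ ^ 2 * (‖z‖ ^ 2 : ℝ) +
      2 * α * β * (inner ℝ x y : ℝ) + 2 * α * γ * (inner ℝ x z : ℝ) +
      2 * β * γ * (inner ℝ y z : ℝ) := by
  simp only [← real_inner_self_eq_norm_sq, inner_add_left, inner_add_right, real_inner_smul_left,
    real_inner_smul_right]
  rw [real_inner_comm x y, real_inner_comm x z, real_inner_comm y z]
  apply Complex.ext <;> simp [pow_two] <;> ring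

end Cone

/-- A real root `z ≥ 1` would be a relation saying that the vectors `x_{12}, x_{23}, x_{24}`, each
divided by its square and taken with the coefficients `z, z - 1, 1`, add up to a null vector. But
each of the three lies in the convex tube, on which the quadratic form has no zero. -/
lemma re_lt_one_of_isZPair {C : Config d} (hC : C ∈ domainD d) {z w : ℂ} (h : IsZPair C z w)
    (hz : z.im = 0) : z.re < 1 := by
  by_contra! ht
  set t : ℝ := z.re with htdef
  have hzt : z = (t : ℂ) := Complex.ext (by simp [htdef]) (by simp [hz])
  have p01 := re_sub_pos hC (show (0 : Fin 4) < 1 by decide)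
  have p12 := re_sub_pos hC (show (1 : Fin 4) < 2 by decide)
  have p13 := re_sub_pos hC (show (1 : Fin 4) < 3 by decide)
  have n01 := sqDist_ne_zero hC (show (0 : Fin 4) ≠ 1 by decide)
  have n12 := sqDist_ne_zero hC (show (1 : Fin 4) ≠ 2 by decide)
  have n13 := sqDist_ne_zero hC (show (1 : Fin 4) ≠ 3 by decide)
  have n02 := sqDist_ne_zero hC (show (0 : Fin 4) ≠ 2 by decide)
  have hrel : (t : ℂ) * (sqDist C 0 3 * sqDist C 1 2) +
      t * (t - 1) * (sqDist C 0 2 * sqDist C 1 3) -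
      (t - 1) * (sqDist C 0 1 * sqDist C 2 3) = 0 := by
    have h1 := h.1
    have h2 := h.2
    rw [hzt] at h1 h2
    unfold crossU at h1
    unfold crossV at h2
    rw [div_eq_iff (mul_ne_zero n02 n13)] at h1 h2
    rw [h1, h2]; ring
  set q1 := sqDist C 0 1 with hq1
  set q2 := sqDist C 1 2 with hq2
  set q3 := sqDist C 1 3 with hq3
  have c1 := inversion_mem_tube p01 ‖C.2 0 - C.2 1‖ (q := q1) (by rw [hq1]; rfl)
  have c2 := inversion_mem_tube p12 ‖C.2 1 - C.2 2‖ (q := q2) (by rw [hq2]; rfl)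
  have c3 := inversion_mem_tube p13 ‖C.2 1 - C.2 3‖ (q := q3) (by rw [hq3]; rfl)
  rw [abs_norm] at c1 c2 c3
  set α : ℂ := (t : ℂ) * q1⁻¹ with hα
  set β : ℂ := ((t - 1 : ℝ) : ℂ) * q2⁻¹ with hβ
  set γ : ℂ := q3⁻¹ with hγ
  have key := quadratic_ne_zero_of_mem_tube
    (T := α * (C.1 0 - C.1 1) + β * (C.1 1 - C.1 2) + γ * (C.1 1 - C.1 3))
    (a := α.re • (C.2 0 - C.2 1) + β.re • (C.2 1 - C.2 2) + γ.re • (C.2 1 - C.2 3))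
    (b := α.im • (C.2 0 - C.2 1) + β.im • (C.2 1 - C.2 2) + γ.im • (C.2 1 - C.2 3)) (by
      refine (norm_add₃_le).trans_lt ?_
      rw [norm_smul, norm_smul, norm_smul, hα, hβ, mul_assoc, mul_assoc, Complex.add_re,
        Complex.add_re, Complex.re_ofReal_mul, Complex.re_ofReal_mul, Complex.im_ofReal_mul,
        Complex.im_ofReal_mul, Real.norm_eq_abs, Real.norm_eq_abs, Real.norm_eq_abs, abs_mul,
        abs_mul, abs_of_nonneg (by linarith : 0 ≤ t), abs_of_nonneg (by linarith : 0 ≤ t - 1),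
        mul_assoc, mul_assoc]
      nlinarith [mul_le_mul_of_nonneg_left c1.le (by linarith : 0 ≤ t),
        mul_le_mul_of_nonneg_left c2.le (by linarith : 0 ≤ t - 1)])
  apply key
  rw [quadratic_sum_three]
  have i1 : (inner ℝ (C.2 0 - C.2 1) (C.2 1 - C.2 2) : ℝ) =
      (‖C.2 0 - C.2 2‖ ^ 2 - ‖C.2 0 - C.2 1‖ ^ 2 - ‖C.2 1 - C.2 2‖ ^ 2) / 2 := by
    rw [show C.2 0 - C.2 2 = (C.2 0 - C.2 1) + (C.2 1 - C.2 2) by abel, norm_add_sq_real]; ring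
  have i2 : (inner ℝ (C.2 0 - C.2 1) (C.2 1 - C.2 3) : ℝ) =
      (‖C.2 0 - C.2 3‖ ^ 2 - ‖C.2 0 - C.2 1‖ ^ 2 - ‖C.2 1 - C.2 3‖ ^ 2) / 2 := by
    rw [show C.2 0 - C.2 3 = (C.2 0 - C.2 1) + (C.2 1 - C.2 3) by abel, norm_add_sq_real]; ring
  have i3 : (inner ℝ (C.2 1 - C.2 2) (C.2 1 - C.2 3) : ℝ) =
      (‖C.2 1 - C.2 2‖ ^ 2 + ‖C.2 1 - C.2 3‖ ^ 2 - ‖C.2 2 - C.2 3‖ ^ 2) / 2 := by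
    have h1 := norm_sub_sq_real (C.2 1 - C.2 3) (C.2 1 - C.2 2)
    rw [sub_sub_sub_cancel_left, real_inner_comm] at h1
    rw [h1]; ring
  rw [i1, i2, i3]
  have f : ∀ i j, (((‖C.2 i - C.2 j‖ : ℝ) : ℂ)) ^ 2 = sqDist C i j - (C.1 i - C.1 j) ^ 2 := by
    intro i j; unfold sqDist; push_cast; ring
  push_cast
  simp only [f]
  rw [← hq1, ← hq2, ← hq3, hα, hβ, hγ]
  push_cast
  field_simp
  linear_combination q1 * q2 * q3 * hrel

lemma not_mem_onReal_Ici_of_mem_domainD {C : Config d} (hC : C ∈ domainD d) {z w : ℂ}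
    (h : IsZPair C z w) : z ∉ onReal (Ici 1) := fun hz =>
  absurd (re_lt_one_of_isZPair hC h hz.1) (not_lt.2 hz.2)

/-! ### Euclidean configurations -/

/-- The points of a configuration, with the real parts of the times, in Euclidean `ℝ × ℝ^{d-1}`. -/
noncomputable def euclidPoint (C : Config d) (k : Fin 4) : WithLp 2 (ℝ × Space d) :=
  WithLp.toLp 2 ((C.1 k).re, C.2 k)

lemma sqDist_eq_dist_sq {C : Config d} (hC : ∀ k, (C.1 k).im = 0) (i j : Fin 4) :
    sqDist C i j = ((dist (euclidPoint C i) (euclidPoint C j) ^ 2 : ℝ) : ℂ) := by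
  have h1 : C.1 i = ((C.1 i).re : ℂ) := Complex.ext rfl (by simp [hC])
  have h2 : C.1 j = ((C.1 j).re : ℂ) := Complex.ext rfl (by simp [hC])
  rw [dist_eq_norm, WithLp.prod_norm_sq_eq_of_L2]
  unfold sqDist
  rw [h1, h2]
  simp [euclidPoint, ← Complex.ofReal_sub, ← Complex.ofReal_pow]

/-- At a Euclidean configuration `z` and `z̄` are complex conjugates, by Ptolemy's inequality. -/
lemma IsZPair.eq_star {C : Config d} (hC : C ∈ domainE d) {z w : ℂ} (h : IsZPair C z w) :
    w = star z := by
  set p := euclidPoint C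
  have hq := sqDist_eq_dist_sq hC.2
  have n02 : 0 < dist (p 0) (p 2) := by
    refine dist_nonneg.lt_of_ne fun h0 => sqDist_ne_zero hC.1 (show (0 : Fin 4) ≠ 2 by decide) ?_
    rw [hq, ← h0]; simp
  have n13 : 0 < dist (p 1) (p 3) := by
    refine dist_nonneg.lt_of_ne fun h0 => sqDist_ne_zero hC.1 (show (1 : Fin 4) ≠ 3 by decide) ?_
    rw [hq, ← h0]; simp
  set a := dist (p 0) (p 1) * dist (p 2) (p 3) / (dist (p 0) (p 2) * dist (p 1) (p 3)) with ha
  set b := dist (p 0) (p 3) * dist (p 1) (p 2) / (dist (p 0) (p 2) * dist (p 1) (p 3)) with hb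
  have hu : crossU C = ((a ^ 2 : ℝ) : ℂ) := by
    unfold crossU; simp only [hq]; rw [ha]; push_cast; ring
  have hv : crossV C = ((b ^ 2 : ℝ) : ℂ) := by
    unfold crossV; simp only [hq]; rw [hb]; push_cast; ring
  have hn := mul_pos n02 n13
  have t1 : 1 ≤ a + b := by
    rw [ha, hb, ← add_div, le_div_iff₀ hn, one_mul]
    have := EuclideanGeometry.mul_dist_le_mul_dist_add_mul_dist (p 0) (p 1) (p 2) (p 3)
    linarith
  have t2 : a ≤ 1 + b := by
    rw [ha, hb, ← sub_le_iff_le_add, ← sub_div, div_le_iff₀ hn, one_mul]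
    have := EuclideanGeometry.mul_dist_le_mul_dist_add_mul_dist (p 0) (p 2) (p 1) (p 3)
    rw [dist_comm (p 2) (p 1)] at this
    linarith
  have t3 : b ≤ 1 + a := by
    rw [ha, hb, ← sub_le_iff_le_add, ← sub_div, div_le_iff₀ hn, one_mul]
    have := EuclideanGeometry.mul_dist_le_mul_dist_add_mul_dist (p 0) (p 1) (p 3) (p 2)
    rw [dist_comm (p 3) (p 2)] at this
    linarith
  have ha0 : 0 ≤ a := by positivity
  have hb0 : 0 ≤ b := by positivity
  have hdisc : (1 + a ^ 2 - b ^ 2) ^ 2 ≤ 4 * a ^ 2 := by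
    nlinarith [mul_nonneg (mul_nonneg (sub_nonneg.2 t1) (sub_nonneg.2 t2))
      (mul_nonneg (sub_nonneg.2 t3) (by positivity : 0 ≤ 1 + a + b))]
  have hs := h.sq_sub
  have hsum : z + w = ((1 + a ^ 2 - b ^ 2 : ℝ) : ℂ) := by
    have h1 := h.1
    have h2 := h.2
    rw [hu] at h1; rw [hv] at h2
    push_cast at h1 h2 ⊢
    linear_combination h2 - h1
  rw [hu, hv] at hs
  have him : w.im = - z.im := by
    have := congrArg Complex.im hsum
    simp only [Complex.add_im, Complex.ofReal_im] at this
    linarith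
  have hre := congrArg Complex.re hs
  have him2 := congrArg Complex.im hs
  norm_cast at hre him2
  simp only [pow_two, Complex.neg_re, Complex.mul_re, Complex.sub_re, Complex.sub_im, him] at hre
  simp only [pow_two, Complex.neg_im, Complex.mul_im, Complex.sub_re, Complex.sub_im, him] at him2
  have hx : z.re - w.re = 0 := by
    have h3 : (z.re - w.re) * z.im = 0 := by linarith
    rcases mul_eq_zero.1 h3 with h3 | h3
    · exact h3
    · rw [h3] at hre
      have : (z.re - w.re) * (z.re - w.re) ≤ 0 := by nlinarith
      nlinarith [mul_self_nonneg (z.re - w.re)]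
  exact Complex.ext (by simp; linarith) (by simp [him])

lemma logSq_im_eq_zero {C : Config d} (hC : C ∈ domainE d) {i j : Fin 4} (hij : i < j) :
    (logSq C i j).im = 0 := by
  have hs := (lightCone_mem_slitPlane (domainD_subset_regular hC.1) hij).1
  have h1 : C.1 i - C.1 j - Complex.I * ‖C.2 i - C.2 j‖ =
      (starRingEnd ℂ) (C.1 i - C.1 j + Complex.I * ‖C.2 i - C.2 j‖) := by
    apply Complex.ext <;> simp [hC.2]
  unfold logSq
  rw [h1, Complex.log_conj _ (Complex.slitPlane_arg_ne_pi hs)]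
  simp

lemma logU_im_eq_zero {C : Config d} (hC : C ∈ domainE d) : (logU C).im = 0 := by
  simp [logU, logSq_im_eq_zero hC (show (0 : Fin 4) < 1 by decide),
    logSq_im_eq_zero hC (show (2 : Fin 4) < 3 by decide),
    logSq_im_eq_zero hC (show (0 : Fin 4) < 2 by decide),
    logSq_im_eq_zero hC (show (1 : Fin 4) < 3 by decide)]

lemma logV_im_eq_zero {C : Config d} (hC : C ∈ domainE d) : (logV C).im = 0 := by
  simp [logV, logSq_im_eq_zero hC (show (0 : Fin 4) < 3 by decide),
    logSq_im_eq_zero hC (show (1 : Fin 4) < 2 by decide),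
    logSq_im_eq_zero hC (show (0 : Fin 4) < 2 by decide),
    logSq_im_eq_zero hC (show (1 : Fin 4) < 3 by decide)]

lemma domainE_nonempty : (domainE d).Nonempty := by
  refine ⟨(fun k => ((-(k : ℕ) : ℝ) : ℂ), fun _ => 0), fun i j hij => ?_, fun k => ?_⟩
  · simpa using hij
  · simp

/-! ### The product of the roots `√(1 - z)` and `√(1 - z̄)` -/

lemma exists_sqrt_re_pos {z : ℂ} (hz : z ∈ Complex.slitPlane) : ∃ a : ℂ, a ^ 2 = z ∧ 0 < a.re := by
  obtain ⟨a, ha⟩ := IsAlgClosed.exists_pow_nat_eq z (n := 2) two_pos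
  rcases lt_trichotomy a.re 0 with h | h | h
  · exact ⟨-a, by rw [neg_sq, ha], by simpa using h⟩
  · exfalso
    rw [Complex.mem_slitPlane_iff, ← ha] at hz
    simp [pow_two, h] at hz
    nlinarith [mul_self_nonneg a.im]
  · exact ⟨a, ha, h⟩

lemma one_sub_mem_slitPlane {z : ℂ} (hz : z ∉ onReal (Ici 1)) : 1 - z ∈ Complex.slitPlane := by
  rw [Complex.mem_slitPlane_iff]
  by_contra! hc
  exact hz ⟨by simpa using hc.2, by simpa using hc.1⟩

lemma eq_of_sq_eq_of_re_pos {a b : ℂ} (h : a ^ 2 = b ^ 2) (ha : 0 < a.re) (hb : 0 < b.re) :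
    a = b := by
  rcases sq_eq_sq_iff_eq_or_eq_neg.1 h with h | h
  · exact h
  · rw [h, Complex.neg_re] at ha; linarith

/-- `a` and `b` are the roots `√(1 - z)`, `√(1 - z̄)` of positive real part, and their product is
`σ` times the root of `v` that is positive at the Euclidean configurations. -/
def IsRootPair (σ : ℂ) (C : Config d) (a b : ℂ) : Prop :=
  0 < a.re ∧ 0 < b.re ∧ IsZPair C (1 - a ^ 2) (1 - b ^ 2) ∧ a * b = σ * Complex.exp (logV C / 2)

/-- Root pairs are locally bounded: `(a ± b)²` is a function of `u` and `v`. -/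
lemma IsRootPair.norm_sq_add_le {σ : ℂ} (hσ : ‖σ‖ = 1) {C : Config d} {a b : ℂ}
    (h : IsRootPair σ C a b) : ‖a‖ ^ 2 + ‖b‖ ^ 2 ≤
      ‖1 - crossU C + crossV C‖ + 2 * ‖Complex.exp (logV C / 2)‖ := by
  have h1 := parallelogram_law_with_norm ℝ a b
  have e1 : ‖a + b‖ * ‖a + b‖ = ‖1 - crossU C + crossV C + 2 * (σ * Complex.exp (logV C / 2))‖ := by
    rw [← norm_mul, ← h.2.2.2, h.2.2.1.1, h.2.2.1.2]; congr 1; ring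
  have e2 : ‖a - b‖ * ‖a - b‖ = ‖1 - crossU C + crossV C - 2 * (σ * Complex.exp (logV C / 2))‖ := by
    rw [← norm_mul, ← h.2.2.2, h.2.2.1.1, h.2.2.1.2]; congr 1; ring
  have e3 := norm_add_le (1 - crossU C + crossV C) (2 * (σ * Complex.exp (logV C / 2)))
  have e4 := norm_sub_le (1 - crossU C + crossV C) (2 * (σ * Complex.exp (logV C / 2)))
  rw [norm_mul, norm_mul, hσ] at e3 e4
  norm_num at e3 e4
  nlinarith

/-- The existence of a root pair is a closed condition off the configurations with `z ≥ 1`. -/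
lemma exists_isRootPair_of_tendsto {σ : ℂ} (hσ : ‖σ‖ = 1) {Cn : ℕ → Config d} {C : Config d}
    (hn : ∀ n, Cn n ∈ regular d) (hC : C ∈ regular d) (hlim : Tendsto Cn atTop (𝓝 C))
    (hz : ∀ z w, IsZPair C z w → z ∉ onReal (Ici 1)) (h : ∀ n, ∃ a b, IsRootPair σ (Cn n) a b) :
    ∃ a b, IsRootPair σ C a b := by
  choose a b hab using h
  have hlim' : Tendsto Cn atTop (𝓝[regular d] C) :=
    tendsto_nhdsWithin_iff.2 ⟨hlim, Eventually.of_forall hn⟩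
  have hu : Tendsto (fun n => crossU (Cn n)) atTop (𝓝 (crossU C)) :=
    (continuousOn_crossU C hC).tendsto.comp hlim'
  have hv : Tendsto (fun n => crossV (Cn n)) atTop (𝓝 (crossV C)) :=
    (continuousOn_crossV C hC).tendsto.comp hlim'
  have hp : Tendsto (fun n => Complex.exp (logV (Cn n) / 2)) atTop
      (𝓝 (Complex.exp (logV C / 2))) :=
    (((continuousOn_logV C hC).tendsto.comp hlim').div_const 2).cexp
  have hB : Tendsto (fun n => ‖1 - crossU (Cn n) + crossV (Cn n)‖ +
      2 * ‖Complex.exp (logV (Cn n) / 2)‖) atTop (𝓝 (‖1 - crossU C + crossV C‖ +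
      2 * ‖Complex.exp (logV C / 2)‖)) :=
    (((hu.const_sub 1).add hv).norm).add (hp.norm.const_mul 2)
  obtain ⟨B, hB⟩ := hB.bddAbove_range
  have hmem : ∀ n, (a n, b n) ∈ Metric.closedBall (0 : ℂ × ℂ) (B + 1) := by
    intro n
    have h1 := (hab n).norm_sq_add_le hσ
    have h2 := hB (mem_range_self n)
    rw [mem_closedBall_zero_iff, Prod.norm_def]
    refine max_le ?_ ?_ <;>
      nlinarith [norm_nonneg (a n), norm_nonneg (b n), sq_nonneg (‖a n‖ - 1 / 2),
        sq_nonneg (‖b n‖ - 1 / 2)]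
  obtain ⟨⟨a0, b0⟩, -, φ, hφ, hl⟩ := tendsto_subseq_of_bounded Metric.isBounded_closedBall hmem
  have ha : Tendsto (fun n => a (φ n)) atTop (𝓝 a0) := (continuous_fst.tendsto _).comp hl
  have hb : Tendsto (fun n => b (φ n)) atTop (𝓝 b0) := (continuous_snd.tendsto _).comp hl
  have hpair : IsZPair C (1 - a0 ^ 2) (1 - b0 ^ 2) := by
    constructor
    · refine tendsto_nhds_unique (hu.comp hφ.tendsto_atTop) ?_
      refine (((ha.pow 2).const_sub 1).mul ((hb.pow 2).const_sub 1)).congr fun n => ?_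
      exact ((hab (φ n)).2.2.1.1).symm
    · refine tendsto_nhds_unique (hv.comp hφ.tendsto_atTop) ?_
      refine ((((ha.pow 2).const_sub 1).const_sub 1).mul
        (((hb.pow 2).const_sub 1).const_sub 1)).congr fun n => ?_
      exact ((hab (φ n)).2.2.1.2).symm
  -- a root on the imaginary axis would belong to a value `z ≥ 1`
  have hpos : ∀ x : ℂ, 0 ≤ x.re → 1 - x ^ 2 ∉ onReal (Ici 1) → 0 < x.re := by
    intro x hx hx1
    refine hx.lt_of_ne fun h0 => hx1 ⟨?_, ?_⟩
    · simp [pow_two, ← h0]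
    · simp only [pow_two, Complex.sub_re, Complex.one_re, Complex.mul_re, ← h0, mem_Ici]
      nlinarith [mul_self_nonneg x.im]
  have ha0 : 0 ≤ a0.re :=
    ge_of_tendsto' ((Complex.continuous_re.tendsto _).comp ha) fun n => (hab (φ n)).1.le
  have hb0 : 0 ≤ b0.re :=
    ge_of_tendsto' ((Complex.continuous_re.tendsto _).comp hb) fun n => (hab (φ n)).2.1.le
  refine ⟨a0, b0, hpos _ ha0 (hz _ _ hpair), hpos _ hb0 (hz _ _ hpair.swap), hpair, ?_⟩
  refine tendsto_nhds_unique (ha.mul hb) ?_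
  refine ((hp.comp hφ.tendsto_atTop).const_mul σ).congr fun n => ?_
  exact ((hab (φ n)).2.2.2).symm

/-- `√(1 - z) √(1 - z̄)` is a square root of `v`, hence one of the two with `σ = 1` and `σ = -1`. -/
lemma exists_isRootPair_or {C : Config d} (hC : C ∈ regular d)
    (hz : ∀ z w, IsZPair C z w → z ∉ onReal (Ici 1)) :
    (∃ a b, IsRootPair 1 C a b) ∨ ∃ a b, IsRootPair (-1) C a b := by
  obtain ⟨z, w, h⟩ := exists_isZPair C
  obtain ⟨a, ha, ha0⟩ := exists_sqrt_re_pos (one_sub_mem_slitPlane (hz z w h))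
  obtain ⟨b, hb, hb0⟩ := exists_sqrt_re_pos (one_sub_mem_slitPlane (hz w z h.swap))
  have h1 : (a * b) ^ 2 = Complex.exp (logV C / 2) ^ 2 := by
    rw [← Complex.exp_nat_mul, mul_pow, ha, hb, ← h.2, ← exp_logV hC]
    congr 1; push_cast; ring
  have hp : IsZPair C (1 - a ^ 2) (1 - b ^ 2) := by rwa [ha, hb, sub_sub_cancel, sub_sub_cancel]
  rcases sq_eq_sq_iff_eq_or_eq_neg.1 h1 with h1 | h1
  · exact Or.inl ⟨a, b, ha0, hb0, hp, by rw [h1, one_mul]⟩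
  · exact Or.inr ⟨a, b, ha0, hb0, hp, by rw [h1, neg_one_mul]⟩

/-- The product of a root pair does not depend on the choice of the pair or of `σ`, so pairs with
`σ = 1` and `σ = -1` exclude each other. -/
lemma IsRootPair.mul_eq_mul {σ σ' : ℂ} {C : Config d} {a b a' b' : ℂ} (h : IsRootPair σ C a b)
    (h' : IsRootPair σ' C a' b') : a * b = a' * b' := by
  rcases h.2.2.1.eq_or_eq h'.2.2.1 with ⟨h1, h2⟩ | ⟨h1, h2⟩
  · rw [eq_of_sq_eq_of_re_pos (by linear_combination -h1) h'.1 h.1,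
      eq_of_sq_eq_of_re_pos (by linear_combination -h2) h'.2.1 h.2.1]
  · rw [eq_of_sq_eq_of_re_pos (by linear_combination -h1) h'.1 h.2.1,
      eq_of_sq_eq_of_re_pos (by linear_combination -h2) h'.2.1 h.1, mul_comm]

lemma exists_isRootPair_of_mem_domainE {C : Config d} (hC : C ∈ domainE d) :
    ∃ a b, IsRootPair 1 C a b := by
  obtain ⟨z, w, h⟩ := exists_isZPair C
  obtain ⟨a, ha, ha0⟩ :=
    exists_sqrt_re_pos (one_sub_mem_slitPlane (not_mem_onReal_Ici_of_mem_domainD hC.1 h))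
  have hw := h.eq_star hC
  have hp : IsZPair C (1 - a ^ 2) (1 - (star a) ^ 2) := by
    rw [← star_pow, ha, sub_sub_cancel, star_sub, star_one, sub_sub_cancel, ← hw]; exact h
  refine ⟨a, star a, ha0, by simpa using ha0, hp, ?_⟩
  rw [one_mul]
  have him := logV_im_eq_zero hC
  have hre : (logV C) = ((logV C).re : ℂ) := Complex.ext rfl (by simp [him])
  have h1 : a * star a = ((Complex.normSq a : ℝ) : ℂ) := Complex.mul_conj a
  have h2 : Complex.exp (logV C / 2) = ((Real.exp ((logV C).re / 2) : ℝ) : ℂ) := by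
    rw [hre]; push_cast; simp
  have h3 : (a * star a) ^ 2 = Complex.exp (logV C / 2) ^ 2 := by
    rw [← Complex.exp_nat_mul, mul_pow, ← star_pow, ha, star_sub, star_one, ← hw, ← h.2,
      ← exp_logV (domainD_subset_regular hC.1)]
    congr 1; push_cast; ring
  refine eq_of_sq_eq_of_re_pos h3 ?_ ?_
  · rw [h1, Complex.ofReal_re]
    exact Complex.normSq_pos.2 fun h0 => by simp [h0] at ha0
  · rw [h2, Complex.ofReal_re]
    exact Real.exp_pos _

lemma convex_orderedTimes : Convex ℝ orderedTimes := by
  intro x hx y hy a b ha hb hab i j hij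
  have h1 : (x j).re < (x i).re := hx hij
  have h2 : (y j).re < (y i).re := hy hij
  simp only [Pi.add_apply, Pi.smul_apply, Complex.add_re, Complex.real_smul, Complex.re_ofReal_mul]
  rcases ha.eq_or_lt with rfl | ha
  · have : b = 1 := by linarith
    rw [this]; linarith
  · nlinarith

lemma isPreconnected_domainD : IsPreconnected (domainD d) :=
  (convex_orderedTimes.linear_preimage (LinearMap.fst ℝ (Fin 4 → ℂ) (Fin 4 → Space d))).isPreconnected

/-- By connectedness of `𝒟` the sign of `√(1 - z) √(1 - z̄)` is the Euclidean one. -/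
lemma exists_isRootPair_of_mem_domainD {C : Config d} (hC : C ∈ domainD d) :
    ∃ a b, IsRootPair 1 C a b := by
  have hno : ∀ C ∈ domainD d, ∀ z w, IsZPair C z w → z ∉ onReal (Ici 1) := fun C hC z w h =>
    not_mem_onReal_Ici_of_mem_domainD hC h
  have hcl : ∀ σ : ℂ, ‖σ‖ = 1 → ∀ C ∈ domainD d,
      C ∈ closure {C | C ∈ domainD d ∧ ∃ a b, IsRootPair σ C a b} →
      ∃ a b, IsRootPair σ C a b := by
    intro σ hσ C hC hcl
    obtain ⟨Cn, hn, hlim⟩ := mem_closure_iff_seq_limit.1 hcl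
    exact exists_isRootPair_of_tendsto hσ (fun n => domainD_subset_regular (hn n).1)
      (domainD_subset_regular hC) hlim (hno C hC) fun n => (hn n).2
  by_contra hbad
  have hbad' := (exists_isRootPair_or (domainD_subset_regular hC) (hno C hC)).resolve_left hbad
  obtain ⟨E, hE⟩ := domainE_nonempty (d := d)
  obtain ⟨X, hX, hX1, hX2⟩ := isPreconnected_closed_iff.1 (isPreconnected_domainD (d := d))
    (closure {C | C ∈ domainD d ∧ ∃ a b, IsRootPair 1 C a b})
    (closure {C | C ∈ domainD d ∧ ∃ a b, IsRootPair (-1) C a b}) isClosed_closure isClosed_closure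
    (fun X hX => (exists_isRootPair_or (domainD_subset_regular hX) (hno X hX)).imp
      (fun h => subset_closure ⟨hX, h⟩) fun h => subset_closure ⟨hX, h⟩)
    ⟨E, hE.1, subset_closure ⟨hE.1, exists_isRootPair_of_mem_domainE hE⟩⟩
    ⟨C, hC, subset_closure ⟨hC, hbad'⟩⟩
  obtain ⟨a, b, h⟩ := hcl 1 (by simp) X hX hX1
  obtain ⟨a', b', h'⟩ := hcl (-1) (by simp) X hX hX2
  have h1 := h.mul_eq_mul h'
  rw [h.2.2.2, h'.2.2.2] at h1
  have h0 := Complex.exp_ne_zero (logV X / 2)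
  exact h0 (by linear_combination h1 / 2)

/-- The regular configurations with a root pair, that is, with well-defined `ρ, ρ̄` in the open unit
disc; the radial expansion converges there. -/
def radialDomain (d : ℕ) : Set (Config d) := {C | C ∈ regular d ∧ ∃ a b, IsRootPair 1 C a b}

lemma domainD_subset_radialDomain : domainD d ⊆ radialDomain d := fun _ hC =>
  ⟨domainD_subset_regular hC, exists_isRootPair_of_mem_domainD hC⟩

/-- The root pair at a Lorentzian configuration is a limit of root pairs on `𝒟`. -/
lemma mem_radialDomain_of_mem_lorentz {C : Config d} (hC : C ∈ lorentz d)
    (hz : ∀ z w, IsZPair C z w → z ∉ onReal (Ici 1)) : C ∈ radialDomain d := by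
  refine ⟨lorentz_subset_regular hC, ?_⟩
  obtain ⟨Cn, hn, hlim⟩ := mem_closure_iff_seq_limit.1 (frontier_subset_closure hC.1)
  exact exists_isRootPair_of_tendsto (by simp) (fun n => domainD_subset_regular (hn n))
    (lorentz_subset_regular hC) hlim hz fun n => exists_isRootPair_of_mem_domainD (hn n)

/-! ### Symmetric functions of the radial coordinates -/

/-- The product `√(1 - z) √(1 - z̄)`, as the root of `v` that is positive at the Euclidean
configurations. -/
noncomputable def prodRoot (C : Config d) : ℂ := Complex.exp (logV C / 2)

/-- The square of `√(1 - z) + √(1 - z̄)`: its expansion `2 - z - z̄ + 2 √(1 - z) √(1 - z̄)`, written in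
terms of `v = 1 - z - z̄ + u`. -/
noncomputable def sumRootSq (C : Config d) : ℂ := (1 + prodRoot C) ^ 2 - Complex.exp (logU C)

/-- The sum `√(1 - z) + √(1 - z̄)`: it has positive real part, so it is the principal root of its
square. -/
noncomputable def sumRoot (C : Config d) : ℂ := Complex.exp (Complex.log (sumRootSq C) / 2)

/-- The product `(1 + √(1 - z)) (1 + √(1 - z̄))`. -/
noncomputable def rhoDenom (C : Config d) : ℂ := 1 + sumRoot C + prodRoot C

/-- The sum `ρ + ρ̄`. -/
noncomputable def rhoSum (C : Config d) : ℂ := (2 - 2 * prodRoot C) / rhoDenom C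

/-- The product `ρ ρ̄`. -/
noncomputable def rhoProd (C : Config d) : ℂ := (1 - sumRoot C + prodRoot C) / rhoDenom C

/-- The logarithm of `ρ ρ̄` that is real at the Euclidean configurations. It comes from
`ρ = z / (1 + √(1 - z))²`. -/
noncomputable def logRho (C : Config d) : ℂ := logU C - 2 * Complex.log (rhoDenom C)

/-- The larger of `|ρ|` and `|ρ̄|`, in terms of `s = ρ + ρ̄` and `p = ρ ρ̄`: by the parallelogram law
`|s|² + |s² - 4 p|` is `2 (|ρ|² + |ρ̄|²)`. -/
noncomputable def maxRootNorm (s p : ℂ) : ℝ :=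
  √(((‖s‖ ^ 2 + ‖s ^ 2 - 4 * p‖) / 2 + √(((‖s‖ ^ 2 + ‖s ^ 2 - 4 * p‖) / 2) ^ 2 - 4 * ‖p‖ ^ 2)) / 2)

lemma continuous_maxRootNorm : Continuous fun q : ℂ × ℂ => maxRootNorm q.1 q.2 := by
  unfold maxRootNorm
  fun_prop

lemma maxRootNorm_add_mul (x y : ℂ) : maxRootNorm (x + y) (x * y) = max ‖x‖ ‖y‖ := by
  have h1 : (‖x + y‖ ^ 2 + ‖(x + y) ^ 2 - 4 * (x * y)‖) / 2 = ‖x‖ ^ 2 + ‖y‖ ^ 2 := by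
    have := parallelogram_law_with_norm ℝ x y
    rw [show (x + y) ^ 2 - 4 * (x * y) = (x - y) ^ 2 by ring, norm_pow]
    linarith
  unfold maxRootNorm
  rw [h1, norm_mul, show (‖x‖ ^ 2 + ‖y‖ ^ 2) ^ 2 - 4 * (‖x‖ * ‖y‖) ^ 2 =
    (‖x‖ ^ 2 - ‖y‖ ^ 2) ^ 2 by ring, Real.sqrt_sq_eq_abs]
  have hx := norm_nonneg x
  have hy := norm_nonneg y
  rcases le_total ‖x‖ ‖y‖ with h | h
  · rw [max_eq_right h, abs_of_nonpos (by nlinarith), show (‖x‖ ^ 2 + ‖y‖ ^ 2 +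
      -(‖x‖ ^ 2 - ‖y‖ ^ 2)) / 2 = ‖y‖ ^ 2 by ring, Real.sqrt_sq hy]
  · rw [max_eq_left h, abs_of_nonneg (by nlinarith), show (‖x‖ ^ 2 + ‖y‖ ^ 2 +
      (‖x‖ ^ 2 - ‖y‖ ^ 2)) / 2 = ‖x‖ ^ 2 by ring, Real.sqrt_sq hx]

/-- The power sum `x ^ n + y ^ n` as a polynomial in `s = x + y` and `p = x y`. -/
def powerSum : ℕ → ℂ → ℂ → ℂ
  | 0, _, _ => 2
  | 1, s, _ => s
  | n + 2, s, p => s * powerSum (n + 1) s p - p * powerSum n s p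

lemma powerSum_add_mul (n : ℕ) (x y : ℂ) : powerSum n (x + y) (x * y) = x ^ n + y ^ n := by
  induction n using Nat.twoStepInduction with
  | zero => simp [powerSum]; norm_num
  | one => simp [powerSum]
  | more n h1 h2 => rw [powerSum, h1, h2]; ring

lemma differentiable_powerSum (n : ℕ) : Differentiable ℂ fun q : ℂ × ℂ => powerSum n q.1 q.2 := by
  induction n using Nat.twoStepInduction with
  | zero => simp [powerSum]
  | one => simp [powerSum]
  | more n h1 h2 =>
    simp only [powerSum]
    exact (differentiable_fst.mul h2).sub (differentiable_snd.mul h1)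

/-- The radial coordinate `ρ` of `z = 1 - a ^ 2`. -/
noncomputable def rhoOf (a : ℂ) : ℂ := (1 - a) / (1 + a)

lemma one_add_ne_zero {a : ℂ} (ha : 0 < a.re) : 1 + a ≠ 0 := fun h => by
  have := congrArg Complex.re h
  simp at this
  linarith

lemma norm_rhoOf_lt_one {a : ℂ} (ha : 0 < a.re) : ‖rhoOf a‖ < 1 := by
  rw [rhoOf, norm_div, div_lt_one (norm_pos_iff.2 (one_add_ne_zero ha))]
  refine lt_of_pow_lt_pow_left₀ 2 (norm_nonneg _) ?_
  rw [Complex.sq_norm, Complex.sq_norm, Complex.normSq_apply, Complex.normSq_apply]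
  simp
  nlinarith

lemma one_add_rhoOf {a : ℂ} (ha : 0 < a.re) : 1 + rhoOf a = 2 / (1 + a) := by
  have := one_add_ne_zero ha
  unfold rhoOf
  field_simp
  ring

lemma radial_rhoOf {a : ℂ} (ha : 0 < a.re) : (1 - a ^ 2) * (1 + rhoOf a) ^ 2 = 4 * rhoOf a := by
  have := one_add_ne_zero ha
  rw [one_add_rhoOf ha, rhoOf]
  field_simp
  ring

lemma rhoOf_ne_zero {a : ℂ} (ha : 0 < a.re) (h : 1 - a ^ 2 ≠ 0) : rhoOf a ≠ 0 := fun h0 => by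
  have := radial_rhoOf ha
  rw [h0] at this
  simp at this
  exact h this

section RootPair
variable {C : Config d} {a b : ℂ}

lemma IsRootPair.prodRoot_eq (h : IsRootPair 1 C a b) : prodRoot C = a * b := by
  rw [h.2.2.2, one_mul, prodRoot]

lemma IsRootPair.sumRootSq_eq (hC : C ∈ regular d) (h : IsRootPair 1 C a b) :
    sumRootSq C = (a + b) ^ 2 := by
  rw [sumRootSq, h.prodRoot_eq, exp_logU hC, h.2.2.1.1]; ring

lemma IsRootPair.add_re_pos (h : IsRootPair 1 C a b) : 0 < (a + b).re := add_pos h.1 h.2.1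

lemma sq_mem_slitPlane {a : ℂ} (ha : 0 < a.re) : a ^ 2 ∈ Complex.slitPlane := by
  rw [Complex.mem_slitPlane_iff]
  by_contra! hc
  simp [pow_two] at hc
  have h2 : a.im = 0 := by
    have : a.re * a.im = 0 := by linarith [hc.2]
    exact (mul_eq_zero.1 this).resolve_left ha.ne'
  nlinarith [hc.1]

lemma IsRootPair.sumRootSq_mem (hC : C ∈ regular d) (h : IsRootPair 1 C a b) :
    sumRootSq C ∈ Complex.slitPlane := by
  rw [h.sumRootSq_eq hC]
  exact sq_mem_slitPlane h.add_re_pos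

lemma exp_log_sq_div_two {a : ℂ} (ha : 0 < a.re) :
    Complex.exp (Complex.log (a ^ 2) / 2) = a := by
  have h1 := Complex.sq_cpow_two_inv ha
  rwa [Complex.cpow_def_of_ne_zero (Complex.slitPlane_ne_zero (sq_mem_slitPlane ha)),
    ← div_eq_mul_inv] at h1

lemma IsRootPair.sumRoot_eq (hC : C ∈ regular d) (h : IsRootPair 1 C a b) :
    sumRoot C = a + b := by
  rw [sumRoot, h.sumRootSq_eq hC, exp_log_sq_div_two h.add_re_pos]

lemma IsRootPair.rhoDenom_eq (hC : C ∈ regular d) (h : IsRootPair 1 C a b) :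
    rhoDenom C = (1 + a) * (1 + b) := by
  rw [rhoDenom, h.sumRoot_eq hC, h.prodRoot_eq]; ring

lemma IsRootPair.rhoDenom_mem (hC : C ∈ regular d) (h : IsRootPair 1 C a b) :
    rhoDenom C ∈ Complex.slitPlane := by
  rw [h.rhoDenom_eq hC, Complex.mem_slitPlane_iff]
  by_contra! hc
  have ha := h.1
  have hb := h.2.1
  simp at hc
  have h1 : b.im * (1 + a.re) = - (a.im * (1 + b.re)) := by linarith [hc.2]
  have h2 : a.im * b.im ≤ 0 := by
    have : a.im * b.im * (1 + a.re) = - (a.im ^ 2 * (1 + b.re)) := by linear_combination a.im * h1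
    nlinarith [mul_nonneg (sq_nonneg a.im) (by linarith : 0 ≤ 1 + b.re)]
  nlinarith [mul_pos ha hb, hc.1]

lemma IsRootPair.rhoSum_eq (hC : C ∈ regular d) (h : IsRootPair 1 C a b) :
    rhoSum C = rhoOf a + rhoOf b := by
  have h1 := one_add_ne_zero h.1
  have h2 := one_add_ne_zero h.2.1
  rw [rhoSum, h.rhoDenom_eq hC, h.prodRoot_eq, rhoOf, rhoOf]
  field_simp
  ring

lemma IsRootPair.rhoProd_eq (hC : C ∈ regular d) (h : IsRootPair 1 C a b) :
    rhoProd C = rhoOf a * rhoOf b := by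
  have h1 := one_add_ne_zero h.1
  have h2 := one_add_ne_zero h.2.1
  rw [rhoProd, h.rhoDenom_eq hC, h.prodRoot_eq, h.sumRoot_eq hC, rhoOf, rhoOf]
  field_simp
  ring

lemma IsRootPair.exp_logRho (hC : C ∈ regular d) (h : IsRootPair 1 C a b) :
    Complex.exp (logRho C) = rhoOf a * rhoOf b := by
  have h1 := one_add_ne_zero h.1
  have h2 := one_add_ne_zero h.2.1
  have h3 : Complex.exp (2 * Complex.log (rhoDenom C)) = ((1 + a) * (1 + b)) ^ 2 := by
    rw [← h.rhoDenom_eq hC, show (2 : ℂ) = ((2 : ℕ) : ℂ) by norm_num, Complex.exp_nat_mul,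
      Complex.exp_log (Complex.slitPlane_ne_zero (h.rhoDenom_mem hC))]
  rw [logRho, Complex.exp_sub, exp_logU hC, h3, h.2.2.1.1, rhoOf, rhoOf]
  field_simp
  ring

lemma IsRootPair.maxRootNorm_eq (hC : C ∈ regular d) (h : IsRootPair 1 C a b) :
    maxRootNorm (rhoSum C) (rhoProd C) = max ‖rhoOf a‖ ‖rhoOf b‖ := by
  rw [h.rhoSum_eq hC, h.rhoProd_eq hC, maxRootNorm_add_mul]

end RootPair

/-! ### Continuity and analyticity of the symmetric functions -/

lemma continuousOn_prodRoot : ContinuousOn (prodRoot (d := d)) (radialDomain d) :=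
  ((continuousOn_logV.mono fun _ h => h.1).div_const 2).cexp

lemma continuousOn_sumRoot : ContinuousOn (sumRoot (d := d)) (radialDomain d) := by
  have h1 : ContinuousOn (sumRootSq (d := d)) (radialDomain d) :=
    ((continuousOn_const.add continuousOn_prodRoot).pow 2).sub
      (continuousOn_logU.mono fun _ h => h.1).cexp
  exact ((h1.clog fun C hC => hC.2.elim fun a ⟨b, h⟩ => h.sumRootSq_mem hC.1).div_const 2).cexp

lemma continuousOn_rhoDenom : ContinuousOn (rhoDenom (d := d)) (radialDomain d) :=
  (continuousOn_const.add continuousOn_sumRoot).add continuousOn_prodRoot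

lemma rhoDenom_mem_slitPlane {C : Config d} (hC : C ∈ radialDomain d) :
    rhoDenom C ∈ Complex.slitPlane :=
  hC.2.elim fun _ ⟨_, h⟩ => h.rhoDenom_mem hC.1

lemma sumRootSq_mem_slitPlane {C : Config d} (hC : C ∈ radialDomain d) :
    sumRootSq C ∈ Complex.slitPlane :=
  hC.2.elim fun _ ⟨_, h⟩ => h.sumRootSq_mem hC.1

lemma continuousOn_rhoSum : ContinuousOn (rhoSum (d := d)) (radialDomain d) :=
  (continuousOn_const.sub (continuousOn_const.mul continuousOn_prodRoot)).div
    continuousOn_rhoDenom fun _ hC => Complex.slitPlane_ne_zero (rhoDenom_mem_slitPlane hC)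

lemma continuousOn_rhoProd : ContinuousOn (rhoProd (d := d)) (radialDomain d) :=
  ((continuousOn_const.sub continuousOn_sumRoot).add continuousOn_prodRoot).div
    continuousOn_rhoDenom fun _ hC => Complex.slitPlane_ne_zero (rhoDenom_mem_slitPlane hC)

lemma continuousOn_logRho : ContinuousOn (logRho (d := d)) (radialDomain d) :=
  (continuousOn_logU.mono fun _ h => h.1).sub
    (continuousOn_const.mul (continuousOn_rhoDenom.clog fun _ hC => rhoDenom_mem_slitPlane hC))

lemma continuousOn_maxRootNorm :
    ContinuousOn (fun C : Config d => maxRootNorm (rhoSum C) (rhoProd C)) (radialDomain d) :=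
  continuous_maxRootNorm.comp_continuousOn (f := fun C : Config d => (rhoSum C, rhoProd C))
    (continuousOn_rhoSum.prodMk continuousOn_rhoProd)

lemma isOpen_orderedTimes : IsOpen orderedTimes := by
  have : orderedTimes = ⋂ i : Fin 4, ⋂ j : Fin 4, ⋂ _ : i < j,
      {τ : Fin 4 → ℂ | (τ j).re < (τ i).re} := by
    ext τ
    simp only [orderedTimes, StrictAnti, mem_ofPred_eq, mem_iInter]
  rw [this]
  refine isOpen_iInter_of_finite fun i => isOpen_iInter_of_finite fun j =>
    isOpen_iInter_of_finite fun _ => isOpen_lt ?_ ?_ <;> fun_prop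

section Analytic
variable (x : Fin 4 → Space d)

lemma differentiableAt_logSq {τ : Fin 4 → ℂ} (hτ : τ ∈ orderedTimes) {i j : Fin 4} (hij : i < j) :
    DifferentiableAt ℂ (fun τ => logSq (τ, x) i j) τ := by
  have h := lightCone_mem_slitPlane
    (domainD_subset_regular (show (τ, x) ∈ domainD d from hτ)) hij
  unfold logSq
  exact DifferentiableAt.fun_add
    (DifferentiableAt.clog (f := fun τ : Fin 4 → ℂ => τ i - τ j + Complex.I * ‖x i - x j‖)
      (by fun_prop) h.1)
    (DifferentiableAt.clog (f := fun τ : Fin 4 → ℂ => τ i - τ j - Complex.I * ‖x i - x j‖)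
      (by fun_prop) h.2)

lemma differentiableAt_logU {τ : Fin 4 → ℂ} (hτ : τ ∈ orderedTimes) :
    DifferentiableAt ℂ (fun τ => logU (τ, x)) τ :=
  (((differentiableAt_logSq x hτ (by decide)).add (differentiableAt_logSq x hτ (by decide))).sub
    (differentiableAt_logSq x hτ (by decide))).sub (differentiableAt_logSq x hτ (by decide))

lemma differentiableAt_logV {τ : Fin 4 → ℂ} (hτ : τ ∈ orderedTimes) :
    DifferentiableAt ℂ (fun τ => logV (τ, x)) τ :=
  (((differentiableAt_logSq x hτ (by decide)).add (differentiableAt_logSq x hτ (by decide))).sub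
    (differentiableAt_logSq x hτ (by decide))).sub (differentiableAt_logSq x hτ (by decide))

lemma differentiableAt_prodRoot {τ : Fin 4 → ℂ} (hτ : τ ∈ orderedTimes) :
    DifferentiableAt ℂ (fun τ => prodRoot (τ, x)) τ := by
  have h := differentiableAt_logV x hτ
  unfold prodRoot
  fun_prop

lemma differentiableAt_sumRoot {τ : Fin 4 → ℂ} (hτ : τ ∈ orderedTimes) :
    DifferentiableAt ℂ (fun τ => sumRoot (τ, x)) τ := by
  have h1 := differentiableAt_prodRoot x hτ
  have h2 := differentiableAt_logU x hτ
  have h3 : DifferentiableAt ℂ (fun τ => sumRootSq (τ, x)) τ := by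
    unfold sumRootSq
    fun_prop
  have h4 := h3.clog (sumRootSq_mem_slitPlane (domainD_subset_radialDomain hτ))
  unfold sumRoot
  fun_prop

lemma differentiableAt_rhoDenom {τ : Fin 4 → ℂ} (hτ : τ ∈ orderedTimes) :
    DifferentiableAt ℂ (fun τ => rhoDenom (τ, x)) τ := by
  have h1 := differentiableAt_prodRoot x hτ
  have h2 := differentiableAt_sumRoot x hτ
  unfold rhoDenom
  fun_prop

lemma rhoDenom_ne_zero {τ : Fin 4 → ℂ} (hτ : τ ∈ orderedTimes) : rhoDenom (τ, x) ≠ 0 :=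
  Complex.slitPlane_ne_zero
    (rhoDenom_mem_slitPlane (domainD_subset_radialDomain (show (τ, x) ∈ domainD d from hτ)))

lemma differentiableAt_rhoSum {τ : Fin 4 → ℂ} (hτ : τ ∈ orderedTimes) :
    DifferentiableAt ℂ (fun τ => rhoSum (τ, x)) τ := by
  have h1 := differentiableAt_prodRoot x hτ
  have h2 := differentiableAt_rhoDenom x hτ
  have h3 : DifferentiableAt ℂ (fun τ => 2 - 2 * prodRoot (τ, x)) τ := by fun_prop
  simp only [rhoSum, div_eq_mul_inv]
  exact h3.fun_mul (h2.fun_inv (rhoDenom_ne_zero x hτ))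

lemma differentiableAt_rhoProd {τ : Fin 4 → ℂ} (hτ : τ ∈ orderedTimes) :
    DifferentiableAt ℂ (fun τ => rhoProd (τ, x)) τ := by
  have h1 := differentiableAt_prodRoot x hτ
  have h2 := differentiableAt_rhoDenom x hτ
  have h3 := differentiableAt_sumRoot x hτ
  have h4 : DifferentiableAt ℂ (fun τ => 1 - sumRoot (τ, x) + prodRoot (τ, x)) τ := by fun_prop
  simp only [rhoProd, div_eq_mul_inv]
  exact h4.fun_mul (h2.fun_inv (rhoDenom_ne_zero x hτ))

lemma differentiableAt_logRho {τ : Fin 4 → ℂ} (hτ : τ ∈ orderedTimes) :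
    DifferentiableAt ℂ (fun τ => logRho (τ, x)) τ := by
  have h1 := differentiableAt_logU x hτ
  have h2 := (differentiableAt_rhoDenom x hτ).clog
    (rhoDenom_mem_slitPlane (domainD_subset_radialDomain hτ))
  unfold logRho
  fun_prop

end Analytic

/-! ### The radial series -/

/-- The mean of the terms of energy `E` and planar spins `m`, `-m` of the radial series, without
its coefficient, as a function of the configuration: `ρ^h ρ̄^h̄` with `h ≥ h̄` is
`(ρ ρ̄)^h̄ ρ^(h - h̄)`, and the mean over the exchange of `h` and `h̄` contains `ρ, ρ̄` only through
`log (ρ ρ̄)` and a power sum. -/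
noncomputable def symWave (p : ℝ × ℤ) (C : Config d) : ℂ :=
  Complex.exp (((p.1 - |(p.2 : ℝ)|) / 2 : ℝ) * logRho C) *
    (powerSum p.2.natAbs (rhoSum C) (rhoProd C) / 2)

/-- The continuation of the four-point function: the radial series in the symmetric functions of
`ρ, ρ̄`, which are single-valued on `𝒟`. -/
noncomputable def radialG (F : UnitaryCFT d) (C : Config d) : ℂ :=
  Complex.exp (-(F.Δ : ℂ) * (logSq C 0 1 + logSq C 2 3)) *
    ∑' p : ℝ × ℤ, (F.b p.1 p.2 : ℂ) * symWave p C

/-- The weights are non-negative, so the terms are largest at the larger of `|ρ|`, `|ρ̄|`. -/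
lemma norm_radialTerm_le {b : ℝ → ℤ → ℝ} (hb : ∀ E m, 0 ≤ b E m)
    (hw : ∀ (E : ℝ) (m : ℤ), b E m ≠ 0 → |(m : ℝ)| ≤ E) {χ χ' : ℂ} {l : ℝ}
    (h : l ≤ χ.im) (h' : l ≤ χ'.im) (p : ℝ × ℤ) :
    ‖radialTerm b χ χ' p‖ ≤ b p.1 p.2 * Real.exp (-l * p.1) := by
  rw [radialTerm, norm_mul, Complex.norm_real, Real.norm_of_nonneg (hb _ _), Complex.norm_exp]
  by_cases h0 : b p.1 p.2 = 0
  · simp [h0]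
  have hm := abs_le.1 (hw _ _ h0)
  refine mul_le_mul_of_nonneg_left (Real.exp_le_exp.2 ?_) (hb _ _)
  have e1 : (((p.1 + p.2) / 2 : ℂ) * χ).im = (p.1 + p.2) / 2 * χ.im := by
    rw [show ((p.1 + p.2) / 2 : ℂ) = (((p.1 + p.2) / 2 : ℝ) : ℂ) by push_cast; ring,
      Complex.im_ofReal_mul]
  have e2 : (((p.1 - p.2) / 2 : ℂ) * χ').im = (p.1 - p.2) / 2 * χ'.im := by
    rw [show ((p.1 - p.2) / 2 : ℂ) = (((p.1 - p.2) / 2 : ℝ) : ℂ) by push_cast; ring,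
      Complex.im_ofReal_mul]
  rw [Complex.I_mul_re, Complex.add_im, e1, e2]
  nlinarith [mul_le_mul_of_nonneg_left h (by linarith [hm.1] : 0 ≤ (p.1 + p.2) / 2),
    mul_le_mul_of_nonneg_left h' (by linarith [hm.2] : 0 ≤ (p.1 - p.2) / 2)]

/-- The radial expansion at `ρ = ρ̄ = exp (-l)`, where all its terms are non-negative. -/
lemma summable_exp_energy (F : UnitaryCFT d) {l : ℝ} (hl : 0 < l) :
    Summable fun p : ℝ × ℤ => F.b p.1 p.2 * Real.exp (-l * p.1) := by
  have h := (F.expansion (Complex.I * l) _ (by simpa using hl) rfl).summable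
  rw [← Complex.summable_ofReal]
  refine h.congr fun p => ?_
  rw [radialTerm]
  push_cast
  congr 2
  simp only [star_mul', Complex.star_def, Complex.conj_I, Complex.conj_ofReal]
  linear_combination (p.1 : ℂ) * l * Complex.I_sq

/-- The radial terms in terms of `ρ`, `ρ̄` and `log (ρ ρ̄)`. -/
lemma radialTerm_eq {b : ℝ → ℤ → ℝ} {χ χ' r r' M : ℂ} (hr : Complex.exp (Complex.I * χ) = r)
    (hr' : Complex.exp (Complex.I * χ') = r') (hM : Complex.I * (χ + χ') = M) (E : ℝ) (n : ℕ) :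
    radialTerm b χ χ' (E, (n : ℤ)) = b E n * (Complex.exp (((E - n) / 2 : ℝ) * M) * r ^ n) ∧
    radialTerm b χ χ' (E, -(n : ℤ)) =
      b E (-n) * (Complex.exp (((E - n) / 2 : ℝ) * M) * r' ^ n) := by
  rw [← hr, ← hr', ← hM, ← Complex.exp_nat_mul, ← Complex.exp_nat_mul, ← Complex.exp_add,
    ← Complex.exp_add]
  constructor
  · rw [radialTerm]; congr 2; push_cast; ring
  · rw [radialTerm]; congr 2; push_cast; ring

lemma radialTerm_symm {b : ℝ → ℤ → ℝ} (hs : ∀ E m, b E (-m) = b E m) {C : Config d}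
    (hC : C ∈ regular d) {a a' : ℂ} (h : IsRootPair 1 C a a') {χ χ' : ℂ}
    (hr : Complex.exp (Complex.I * χ) = rhoOf a) (hr' : Complex.exp (Complex.I * χ') = rhoOf a')
    (hM : Complex.I * (χ + χ') = logRho C) (E : ℝ) (m : ℤ) :
    (b E m : ℂ) * symWave (E, m) C =
      (radialTerm b χ χ' (E, m) + radialTerm b χ χ' (E, -m)) / 2 := by
  obtain ⟨n, rfl | rfl⟩ := m.eq_nat_or_neg
  · have := radialTerm_eq (b := b) hr hr' hM E n
    rw [this.1, this.2, symWave, h.rhoSum_eq hC, h.rhoProd_eq hC, hs]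
    simp only [Int.natAbs_natCast, powerSum_add_mul, Int.cast_natCast, Nat.abs_cast]
    ring
  · have := radialTerm_eq (b := b) hr hr' hM E n
    rw [neg_neg, this.1, this.2, symWave, h.rhoSum_eq hC, h.rhoProd_eq hC, hs]
    simp only [Int.natAbs_neg, Int.natAbs_natCast, powerSum_add_mul, Int.cast_natCast,
      Int.cast_neg, abs_neg, Nat.abs_cast]
    ring

lemma norm_symWave_le {p : ℝ × ℤ} (hp : |(p.2 : ℝ)| ≤ p.1) {C : Config d} (hC : C ∈ radialDomain d)
    {l : ℝ} (h : maxRootNorm (rhoSum C) (rhoProd C) ≤ Real.exp (-l)) :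
    ‖symWave p C‖ ≤ Real.exp (-l * p.1) := by
  obtain ⟨hC, a, a', hr⟩ := hC
  rw [hr.maxRootNorm_eq hC, max_le_iff] at h
  have hn : ‖rhoOf a * rhoOf a'‖ ≤ Real.exp (-l) * Real.exp (-l) := by
    rw [norm_mul]; exact mul_le_mul h.1 h.2 (norm_nonneg _) (Real.exp_pos _).le
  rw [← hr.exp_logRho hC, Complex.norm_exp, ← Real.exp_add, Real.exp_le_exp] at hn
  rw [symWave, norm_mul, Complex.norm_exp, Complex.re_ofReal_mul, hr.rhoSum_eq hC,
    hr.rhoProd_eq hC, powerSum_add_mul, norm_div]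
  have h1 : ‖rhoOf a ^ p.2.natAbs + rhoOf a' ^ p.2.natAbs‖ ≤ 2 * Real.exp (-l) ^ p.2.natAbs := by
    refine (norm_add_le _ _).trans ?_
    rw [norm_pow, norm_pow, two_mul]
    exact add_le_add (pow_le_pow_left₀ (norm_nonneg _) h.1 _)
      (pow_le_pow_left₀ (norm_nonneg _) h.2 _)
  have h2 : Real.exp (-l) ^ p.2.natAbs = Real.exp (-l * |(p.2 : ℝ)|) := by
    rw [← Real.exp_nat_mul, Nat.cast_natAbs, Int.cast_abs]; ring_nf
  calc _ ≤ Real.exp ((p.1 - |(p.2 : ℝ)|) / 2 * (-l + -l)) * Real.exp (-l * |(p.2 : ℝ)|) := by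
        refine mul_le_mul (Real.exp_le_exp.2 (mul_le_mul_of_nonneg_left hn (by linarith))) ?_
          (by positivity) (Real.exp_pos _).le
        rw [Complex.norm_ofNat, div_le_iff₀ two_pos, ← h2]
        linarith
    _ = Real.exp (-l * p.1) := by rw [← Real.exp_add]; congr 1; ring

lemma norm_coeff_mul_symWave_le (F : UnitaryCFT d) {C : Config d} (hC : C ∈ radialDomain d)
    {l : ℝ} (h : maxRootNorm (rhoSum C) (rhoProd C) ≤ Real.exp (-l)) (p : ℝ × ℤ) :
    ‖(F.b p.1 p.2 : ℂ) * symWave p C‖ ≤ F.b p.1 p.2 * Real.exp (-l * p.1) := by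
  rw [norm_mul, Complex.norm_real, Real.norm_of_nonneg (F.b_nonneg _ _)]
  by_cases h0 : F.b p.1 p.2 = 0
  · simp [h0]
  · exact mul_le_mul_of_nonneg_left (norm_symWave_le (F.b_weights _ _ h0) hC h) (F.b_nonneg _ _)

/-- The radial series at the values of `χ, χ̄` that belong to a root pair: it converges absolutely,
and symmetrization in the planar spin turns it into the series of `radialG`. -/
lemma summable_and_tsum_radialTerm (F : UnitaryCFT d) {C : Config d} (hC : C ∈ regular d)
    {a a' : ℂ} (h : IsRootPair 1 C a a') {χ χ' : ℂ}
    (hr : Complex.exp (Complex.I * χ) = rhoOf a) (hr' : Complex.exp (Complex.I * χ') = rhoOf a')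
    (hM : Complex.I * (χ + χ') = logRho C) :
    Summable (fun p => ‖radialTerm F.b χ χ' p‖) ∧
      ∑' p, radialTerm F.b χ χ' p = ∑' p : ℝ × ℤ, (F.b p.1 p.2 : ℂ) * symWave p C := by
  have him : ∀ {χ a : ℂ}, Complex.exp (Complex.I * χ) = rhoOf a → 0 < a.re → 0 < χ.im := by
    intro χ a hr ha
    have h1 := norm_rhoOf_lt_one ha
    rw [← hr, Complex.norm_exp, Real.exp_lt_one_iff, Complex.I_mul_re] at h1
    linarith
  have hsum : Summable (fun p => ‖radialTerm F.b χ χ' p‖) :=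
    Summable.of_nonneg_of_le (fun _ => norm_nonneg _)
      (norm_radialTerm_le F.b_nonneg F.b_weights (min_le_left _ _) (min_le_right _ _))
      (summable_exp_energy F (lt_min (him hr h.1) (him hr' h.2.1)))
  refine ⟨hsum, ?_⟩
  let e : ℝ × ℤ ≃ ℝ × ℤ := Equiv.prodCongr (Equiv.refl ℝ) (Equiv.neg ℤ)
  have hs := hsum.of_norm
  have hs' : Summable fun p => radialTerm F.b χ χ' (e p) := e.summable_iff.2 hs
  have h1 : ∀ p : ℝ × ℤ, (F.b p.1 p.2 : ℂ) * symWave p C =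
      (radialTerm F.b χ χ' p + radialTerm F.b χ χ' (e p)) / 2 := fun p =>
    radialTerm_symm F.b_symm hC h hr hr' hM p.1 p.2
  simp_rw [h1]
  rw [tsum_div_const, hs.tsum_add hs', e.tsum_eq (radialTerm F.b χ χ')]
  ring

/-! ### The continuation -/

lemma maxRootNorm_lt_one {C : Config d} (hC : C ∈ radialDomain d) :
    maxRootNorm (rhoSum C) (rhoProd C) < 1 := by
  obtain ⟨hC, a, a', hr⟩ := hC
  rw [hr.maxRootNorm_eq hC]
  exact max_lt (norm_rhoOf_lt_one hr.1) (norm_rhoOf_lt_one hr.2.1)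

lemma exists_maxRootNorm_lt {C : Config d} (hC : C ∈ radialDomain d) :
    ∃ l : ℝ, 0 < l ∧ maxRootNorm (rhoSum C) (rhoProd C) < Real.exp (-l) := by
  obtain ⟨y, h1, h2⟩ := exists_between (max_lt (maxRootNorm_lt_one hC) one_pos)
  have hy : 0 < y := (le_max_right _ _).trans_lt h1
  refine ⟨-Real.log y, neg_pos.2 (Real.log_neg hy h2), ?_⟩
  rw [neg_neg, Real.exp_log hy]
  exact (le_max_left _ _).trans_lt h1

lemma continuousOn_symWave (p : ℝ × ℤ) : ContinuousOn (symWave (d := d) p) (radialDomain d) := by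
  refine ((continuousOn_const.mul continuousOn_logRho).cexp).mul (ContinuousOn.div_const ?_ 2)
  exact (differentiable_powerSum p.2.natAbs).continuous.comp_continuousOn
    (f := fun C : Config d => (rhoSum C, rhoProd C)) (continuousOn_rhoSum.prodMk continuousOn_rhoProd)

lemma continuousOn_radialG (F : UnitaryCFT d) : ContinuousOn (radialG F) (radialDomain d) := by
  refine ContinuousOn.mul ?_ fun C hC => ?_
  · refine ContinuousOn.cexp (continuousOn_const.mul ?_)
    exact ((continuousOn_logSq (by decide)).add (continuousOn_logSq (by decide))).mono fun _ h => h.1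
  obtain ⟨l, hl, hlt⟩ := exists_maxRootNorm_lt hC
  have hnhds : radialDomain d ∩ {C | maxRootNorm (rhoSum C) (rhoProd C) < Real.exp (-l)} ∈
      𝓝[radialDomain d] C :=
    inter_mem self_mem_nhdsWithin ((continuousOn_maxRootNorm C hC).eventually_lt
      continuousWithinAt_const hlt)
  have hcont : ContinuousOn (fun C => ∑' p : ℝ × ℤ, (F.b p.1 p.2 : ℂ) * symWave p C)
      (radialDomain d ∩ {C | maxRootNorm (rhoSum C) (rhoProd C) < Real.exp (-l)}) :=
    continuousOn_tsum
      (fun p => continuousOn_const.mul ((continuousOn_symWave p).mono inter_subset_left))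
      (summable_exp_energy F hl) fun p C hC => norm_coeff_mul_symWave_le F hC.1 (le_of_lt hC.2) p
  exact (hcont C ⟨hC, hlt⟩).mono_of_mem_nhdsWithin hnhds

lemma differentiableAt_symWave (x : Fin 4 → Space d) (p : ℝ × ℤ) {τ : Fin 4 → ℂ}
    (hτ : τ ∈ orderedTimes) : DifferentiableAt ℂ (fun τ => symWave p (τ, x)) τ := by
  have h1 := differentiableAt_logRho x hτ
  have h2 : DifferentiableAt ℂ
      (fun τ => powerSum p.2.natAbs (rhoSum (τ, x)) (rhoProd (τ, x))) τ :=
    DifferentiableAt.comp τ (f := fun τ => (rhoSum (τ, x), rhoProd (τ, x)))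
      ((differentiable_powerSum p.2.natAbs) _)
      ((differentiableAt_rhoSum x hτ).prodMk (differentiableAt_rhoProd x hτ))
  unfold symWave
  fun_prop

/-- Analyticity of the sum: near each point the terms have a summable bound, hence by the Schwarz
lemma so have their derivatives. -/
lemma differentiableAt_tsum_symWave (F : UnitaryCFT d) (x : Fin 4 → Space d) {τ : Fin 4 → ℂ}
    (hτ : τ ∈ orderedTimes) :
    DifferentiableAt ℂ (fun τ => ∑' p : ℝ × ℤ, (F.b p.1 p.2 : ℂ) * symWave p (τ, x)) τ := by
  have hD : ∀ τ ∈ orderedTimes, ((τ, x) : Config d) ∈ radialDomain d := fun τ hτ =>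
    domainD_subset_radialDomain (show (τ, x) ∈ domainD d from hτ)
  obtain ⟨l, hl, hlt⟩ := exists_maxRootNorm_lt (hD τ hτ)
  have hc : ContinuousAt (fun τ => maxRootNorm (rhoSum (τ, x)) (rhoProd (τ, x))) τ :=
    continuous_maxRootNorm.continuousAt.comp (f := fun τ => (rhoSum (τ, x), rhoProd (τ, x)))
      ((differentiableAt_rhoSum x hτ).continuousAt.prodMk
        (differentiableAt_rhoProd x hτ).continuousAt)
  obtain ⟨δ, hδ, hball⟩ := Metric.eventually_nhds_iff_ball.1
    ((isOpen_orderedTimes.eventually_mem hτ).and (hc.eventually_lt continuousAt_const hlt))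
  set f : ℝ × ℤ → (Fin 4 → ℂ) → ℂ := fun p τ => (F.b p.1 p.2 : ℂ) * symWave p (τ, x) with hf
  have hdiff : ∀ p, ∀ σ ∈ Metric.ball τ δ, DifferentiableAt ℂ (f p) σ := fun p σ hσ =>
    (differentiableAt_symWave x p (hball σ hσ).1).const_mul _
  have hbound : ∀ p, ∀ σ ∈ Metric.ball τ δ, ‖f p σ‖ ≤ F.b p.1 p.2 * Real.exp (-l * p.1) :=
    fun p σ hσ => norm_coeff_mul_symWave_le F (hD σ (hball σ hσ).1) (hball σ hσ).2.le p
  have hmem : τ ∈ Metric.ball τ (δ / 2) := Metric.mem_ball_self (by positivity)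
  have hsub : ∀ σ ∈ Metric.ball τ (δ / 2), Metric.ball σ (δ / 2) ⊆ Metric.ball τ δ := by
    intro σ hσ
    refine Metric.ball_subset_ball' ?_
    rw [Metric.mem_ball] at hσ
    linarith
  have h := hasFDerivAt_tsum_of_isPreconnected (f := f) (f' := fun p σ => fderiv ℂ (f p) σ)
    (((summable_exp_energy F hl).mul_left 2).div_const (δ / 2)) Metric.isOpen_ball
    (convex_ball τ (δ / 2)).isPreconnected
    (fun p σ hσ => (hdiff p σ (hsub σ hσ (Metric.mem_ball_self (by positivity)))).hasFDerivAt)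
    (fun p σ hσ => Complex.norm_fderiv_le_div_of_mapsTo_ball
      (fun ω hω => (hdiff p ω (hsub σ hσ hω)).differentiableWithinAt)
      (fun ω hω => by
        rw [mem_closedBall_iff_norm]
        refine (norm_sub_le _ _).trans ?_
        linarith [hbound p ω (hsub σ hσ hω),
          hbound p σ (hsub σ hσ (Metric.mem_ball_self (by positivity)))])
      (by positivity)) hmem
    (Summable.of_norm_bounded (summable_exp_energy F hl)
      (fun p => hbound p τ (Metric.mem_ball_self hδ))) hmem
  exact h.differentiableAt

lemma eq_of_exp_eq_of_im_eq_zero {x y : ℂ} (h : Complex.exp x = Complex.exp y) (hx : x.im = 0)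
    (hy : y.im = 0) : x = y := by
  have hx' : x = (x.re : ℂ) := Complex.ext rfl (by simp [hx])
  have hy' : y = (y.re : ℂ) := Complex.ext rfl (by simp [hy])
  rw [hx', hy'] at h ⊢
  norm_cast at h ⊢
  exact Real.exp_injective h

lemma logRho_im_eq_zero {C : Config d} (hC : C ∈ domainE d) {a : ℂ}
    (h : IsRootPair 1 C a (star a)) : (logRho C).im = 0 := by
  have h1 : rhoDenom C = ((Complex.normSq (1 + a) : ℝ) : ℂ) := by
    rw [h.rhoDenom_eq (domainD_subset_regular hC.1), ← Complex.mul_conj]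
    simp
  rw [logRho, h1, ← Complex.ofReal_log (Complex.normSq_nonneg _)]
  simp [logU_im_eq_zero hC]

lemma IsRootPair.eq_star {C : Config d} (hC : C ∈ domainE d) {a b : ℂ} (h : IsRootPair 1 C a b) :
    b = star a := by
  have h1 := h.2.2.1.eq_star hC
  refine eq_of_sq_eq_of_re_pos ?_ h.2.1 (by simpa using h.1)
  rw [← star_pow]
  simp only [star_sub, star_one] at h1
  linear_combination -h1

lemma sqDist_re_rpow {C : Config d} (hC : C ∈ domainE d) {i j : Fin 4} (hij : i < j) (D : ℝ) :
    (((sqDist C i j).re ^ D : ℝ) : ℂ) = Complex.exp (D * logSq C i j) := by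
  have h1 : logSq C i j = ((logSq C i j).re : ℂ) :=
    Complex.ext rfl (by simp [logSq_im_eq_zero hC hij])
  rw [← exp_logSq (sqDist_ne_zero hC.1 hij.ne), h1]
  norm_cast
  rw [Real.exp_mul, ← Real.exp_one_rpow ((logSq C i j).re), Real.exp_one_rpow, ← Real.exp_mul,
    ← Real.exp_mul, mul_comm]

lemma rhoOf_star (a : ℂ) : rhoOf (star a) = star (rhoOf a) := by
  simp [rhoOf]

lemma radialG_eq_of_mem_domainE (F : UnitaryCFT d) {C : Config d} (hC : C ∈ domainE d) :
    radialG F C = (F.GE (fun k => (C.1 k).re) C.2 : ℂ) := by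
  have hreg := domainD_subset_regular hC.1
  obtain ⟨a, b, h⟩ := exists_isRootPair_of_mem_domainE hC
  obtain rfl := h.eq_star hC
  have hCE : euclid (fun k => (C.1 k).re) C.2 = C :=
    Prod.ext (funext fun k => Complex.ext (by simp [euclid]) (by simp [euclid, hC.2])) rfl
  have hdist : Distinct (fun k => (C.1 k).re) C.2 := by
    intro i j hij
    left
    intro h0
    exact hij ((show StrictAnti fun k => (C.1 k).re from hC.1).injective h0)
  have hcov := F.covariant _ _ hdist
  rw [hCE] at hcov
  have hr0 : rhoOf a ≠ 0 := rhoOf_ne_zero h.1 (h.2.2.1.ne_zero hreg)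
  have hr1 := norm_rhoOf_lt_one h.1
  set χ : ℂ := -Complex.I * Complex.log (rhoOf a) with hχ
  have hexp : Complex.exp (Complex.I * χ) = rhoOf a := by
    rw [hχ, ← mul_assoc, mul_neg, Complex.I_mul_I, neg_neg, one_mul, Complex.exp_log hr0]
  have him : 0 < χ.im := by
    rw [← hexp, Complex.norm_exp, Real.exp_lt_one_iff, Complex.I_mul_re] at hr1
    linarith
  have hexp' : Complex.exp (Complex.I * -star χ) = rhoOf (star a) := by
    rw [rhoOf_star, ← hexp]
    simp only [Complex.star_def]
    rw [← Complex.exp_conj]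
    congr 1
    simp
  have hM : Complex.I * (χ + -star χ) = logRho C := by
    refine eq_of_exp_eq_of_im_eq_zero ?_ ?_ (logRho_im_eq_zero hC h)
    · rw [mul_add, Complex.exp_add, hexp, hexp', h.exp_logRho hreg]
    · simp
  obtain ⟨-, htsum⟩ := summable_and_tsum_radialTerm F hreg h hexp hexp' hM
  have h1 := one_add_rhoOf h.1
  have hne : (1 + rhoOf a) ^ 2 ≠ 0 := by
    rw [h1]
    exact pow_ne_zero _ (div_ne_zero two_ne_zero (one_add_ne_zero h.1))
  have hg := (F.expansion χ (1 - a ^ 2) him (by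
    rw [hexp, eq_div_iff hne]; exact radial_rhoOf h.1)).tsum_eq
  have hu : (crossU C).re = ‖1 - a ^ 2‖ ^ 2 := by
    rw [h.2.2.1.1, ← star_pow, Complex.sq_norm, ← Complex.ofReal_re (Complex.normSq _),
      ← Complex.mul_conj]
    simp
  have hv : (crossV C).re = ‖1 - (1 - a ^ 2)‖ ^ 2 := by
    rw [h.2.2.1.2, ← star_pow, Complex.sq_norm, ← Complex.ofReal_re (Complex.normSq _),
      ← Complex.mul_conj]
    simp
  rw [radialG, ← htsum, hg, hcov, hu, hv]
  push_cast
  rw [sqDist_re_rpow hC (show (0 : Fin 4) < 1 by decide),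
    sqDist_re_rpow hC (show (2 : Fin 4) < 3 by decide), ← Complex.exp_add, ← mul_add, neg_mul,
    Complex.exp_neg, div_eq_mul_inv, mul_comm]

theorem isContinuation_radialG (F : UnitaryCFT d) : IsContinuation F (radialG F) where
  continuousOn := (continuousOn_radialG F).mono domainD_subset_radialDomain
  analytic x τ hτ := by
    have h1 := differentiableAt_logSq x hτ (show (0 : Fin 4) < 1 by decide)
    have h2 := differentiableAt_logSq x hτ (show (2 : Fin 4) < 3 by decide)
    have h3 := differentiableAt_tsum_symWave F x hτ
    refine DifferentiableAt.differentiableWithinAt ?_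
    unfold radialG
    fun_prop
  agrees C hC := radialG_eq_of_mem_domainE F hC

/-- Two continuations agree: on the complex line through `Re τ` in the direction `Im τ`, they are
analytic in a strip around the imaginary axis of the parameter and agree at its real points. -/
theorem IsContinuation.eqOn {F : UnitaryCFT d} {G G' : Config d → ℂ} (h : IsContinuation F G)
    (h' : IsContinuation F G') : EqOn G G' (domainD d) := by
  rintro ⟨τ, x⟩ hτ
  set line : ℂ → Fin 4 → ℂ := fun s k => ((τ k).re : ℂ) + s * ((τ k).im : ℂ) with hline
  set S : Set ℂ := line ⁻¹' orderedTimes with hS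
  have hcont : Continuous line := by fun_prop
  have hSo : IsOpen S := isOpen_orderedTimes.preimage hcont
  have hre : ∀ s k, (line s k).re = (τ k).re + s.re * (τ k).im := by
    intro s k; simp [hline]
  have hSc : IsPreconnected S := by
    refine Convex.isPreconnected ?_
    intro s hs s' hs' p q hp hq hpq
    have hl : line (p • s + q • s') = p • line s + q • line s' := by
      funext k
      have hpq' : (p : ℂ) + q = 1 := by exact_mod_cast hpq
      simp only [hline, Pi.add_apply, Pi.smul_apply, Complex.real_smul]
      linear_combination -((τ k).re : ℂ) * hpq'
    change line _ ∈ orderedTimes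
    rw [hl]
    exact convex_orderedTimes hs hs' hp hq hpq
  have hI : line Complex.I = τ := by
    funext k
    simp only [hline]
    rw [mul_comm, Complex.re_add_im]
  have h0 : (0 : ℂ) ∈ S := by
    intro i j hij
    simp only [hre]
    simpa using hτ hij
  have han : ∀ G : Config d → ℂ, IsContinuation F G →
      AnalyticOnNhd ℂ (fun s => G (line s, x)) S := by
    intro G hG
    refine DifferentiableOn.analyticOnNhd ?_ hSo
    exact DifferentiableOn.comp (g := fun τ => G (τ, x)) (hG.analytic x)
      (show Differentiable ℂ line by fun_prop).differentiableOn (mapsTo_preimage _ _)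
  have heq := (han G h).eqOn_of_preconnected_of_frequently_eq (han G' h') hSc h0 (by
    have hev : ∀ᶠ t : ℝ in 𝓝[≠] 0, G (line (t : ℂ), x) = G' (line (t : ℂ), x) := by
      have : ∀ᶠ t : ℝ in 𝓝 0, (t : ℂ) ∈ S :=
        Complex.continuous_ofReal.continuousAt.eventually_mem (hSo.mem_nhds (by simpa using h0))
      filter_upwards [this.filter_mono nhdsWithin_le_nhds] with t ht
      have hE : ((line (t : ℂ), x) : Config d) ∈ domainE d := ⟨ht, fun k => by simp [hline]⟩
      rw [h.agrees _ hE, h'.agrees _ hE]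
    have ht : Tendsto (fun t : ℝ => (t : ℂ)) (𝓝[≠] 0) (𝓝[≠] 0) := by
      refine tendsto_nhdsWithin_iff.2 ⟨?_, ?_⟩
      · exact (Complex.continuous_ofReal.tendsto' 0 0 (by simp)).mono_left nhdsWithin_le_nhds
      · filter_upwards [self_mem_nhdsWithin] with t ht
        simpa using ht
    exact ht.frequently hev.frequently)
  have := heq (show Complex.I ∈ S by rw [hS, mem_preimage, hI]; exact hτ)
  simpa only [hI] using this

/-! ### Continuous logarithms and square roots along a path -/

lemma isSimplyConnected_of_convex {s : Set ℝ} (hs : Convex ℝ s) (hne : s.Nonempty) :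
    IsSimplyConnected s := by
  have := hs.contractibleSpace hne
  exact SimplyConnectedSpace.ofContractible s

lemma exists_log_curve {f : unitInterval → ℂ} (hf : Continuous f) (h0 : ∀ s, f s ≠ 0) {c : ℂ}
    (hc : Complex.exp c = f 0) :
    ∃ φ : unitInterval → ℂ, Continuous φ ∧ (∀ s, Complex.exp (φ s) = f s) ∧ φ 0 = c := by
  have hsc : IsSimplyConnected (univ : Set ℝ) :=
    isSimplyConnected_of_convex convex_univ univ_nonempty
  obtain ⟨φ, hφ, hexp⟩ := Complex.exists_continuousOn_eqOn_exp_comp hsc isOpen_univ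
    (g := fun t => f (projIcc 0 1 zero_le_one t)) (hf.comp continuous_projIcc).continuousOn (by
      rintro ⟨t, -, ht⟩; exact h0 _ ht)
  have hφ' : Continuous fun s : unitInterval => φ (s : ℝ) :=
    (continuousOn_univ.1 hφ).comp continuous_subtype_val
  have hexp' : ∀ s : unitInterval, Complex.exp (φ (s : ℝ)) = f s := fun s => by
    have := hexp (mem_univ (s : ℝ))
    simpa using this
  refine ⟨fun s => φ (s : ℝ) + (c - φ ((0 : unitInterval) : ℝ)), hφ'.add_const _, fun s => ?_, ?_⟩
  · rw [Complex.exp_add, Complex.exp_sub, hc, hexp', hexp', div_self (h0 0), mul_one]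
  · simp

lemma log_curve_unique {φ ψ : unitInterval → ℂ} (hφ : Continuous φ) (hψ : Continuous ψ)
    (h : ∀ s, Complex.exp (φ s) = Complex.exp (ψ s)) (h0 : φ 0 = ψ 0) : φ = ψ :=
  Complex.isCoveringMap_exp.eq_of_comp_eq hφ hψ (funext fun s => Subtype.ext (h s)) 0 h0

/-- A curve that may vanish at its final point only has a continuous square root. -/
lemma exists_sqrt_curve {f : unitInterval → ℂ} (hf : Continuous f) (h0 : ∀ s, s < 1 → f s ≠ 0) :
    ∃ q : unitInterval → ℂ, Continuous q ∧ ∀ s, q s ^ 2 = f s := by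
  by_cases h1 : f 1 = 0
  · have hsc : IsSimplyConnected (Iio (1 : ℝ)) :=
      isSimplyConnected_of_convex (convex_Iio 1) ⟨0, by simp⟩
    obtain ⟨q, hq, hsq⟩ := Complex.exists_continuousOn_pow_eq hsc isOpen_Iio
      (g := fun t => f (projIcc 0 1 zero_le_one t)) (hf.comp continuous_projIcc).continuousOn (by
        rintro ⟨t, ht, h⟩
        refine h0 _ ?_ h
        rw [← Subtype.coe_lt_coe, coe_projIcc]
        simpa using ht) two_ne_zero
    have hsq' : ∀ s : unitInterval, q (s : ℝ) ^ 2 = f s := fun s => by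
      have := hsq (s : ℝ)
      simpa using this
    refine ⟨fun s => q (s : ℝ), continuous_iff_continuousAt.2 fun s => ?_, hsq'⟩
    rcases unitInterval.le_one' (t := s) |>.lt_or_eq with hs | rfl
    · exact (hq.continuousAt (isOpen_Iio.mem_nhds (show (s : ℝ) < 1 from hs))).comp
        continuous_subtype_val.continuousAt
    · have hq1 : q ((1 : unitInterval) : ℝ) = 0 := by
        have := hsq' 1
        rw [h1] at this
        exact pow_eq_zero_iff two_ne_zero |>.1 this
      -- continuity at the zero: the modulus of the root is `√‖f s‖`
      have hlim : Tendsto (fun s : unitInterval => √‖f s‖) (𝓝 1) (𝓝 0) := by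
        have := (Real.continuous_sqrt.comp hf.norm).tendsto 1
        simpa [h1, Function.comp_def] using this
      change Tendsto _ _ (𝓝 (q ((1 : unitInterval) : ℝ)))
      rw [hq1, tendsto_zero_iff_norm_tendsto_zero]
      refine hlim.congr fun s => ?_
      rw [← hsq', norm_pow, Real.sqrt_sq (norm_nonneg _)]
  · have hne : ∀ s, f s ≠ 0 := fun s => by
      rcases unitInterval.le_one' (t := s) |>.lt_or_eq with hs | rfl
      exacts [h0 s hs, h1]
    obtain ⟨φ, hφ, hexp, -⟩ := exists_log_curve hf hne (Complex.exp_log (hne 0))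
    refine ⟨fun s => Complex.exp (φ s / 2), by fun_prop, fun s => ?_⟩
    rw [← Complex.exp_nat_mul, ← hexp]
    congr 1; push_cast; ring

/-! ### The curves of `z` and `z̄` along an admissible path -/

section Path
variable {C : Config d} {γ : unitInterval → Config d}

lemma IsPathTo.mem_of_forall {S : Set (Config d)} (h : IsPathTo C γ) (hS : domainD d ⊆ S)
    (hC : C ∈ S) (s : unitInterval) : γ s ∈ S := by
  rcases unitInterval.le_one' (t := s) |>.lt_or_eq with hs | rfl
  · exact hS (h.inner s hs).1
  · rw [h.finish]; exact hC

lemma IsPathTo.exists_isZCurve (h : IsPathTo C γ) (hC : C ∈ regular d) :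
    ∃ z w, IsZCurve γ z w := by
  have hreg := h.mem_of_forall domainD_subset_regular hC
  have hu : Continuous fun s => crossU (γ s) := continuousOn_crossU.comp_continuous h.continuous hreg
  have hv : Continuous fun s => crossV (γ s) := continuousOn_crossV.comp_continuous h.continuous hreg
  obtain ⟨q, hq, hsq⟩ := exists_sqrt_curve
    (f := fun s => (1 + crossU (γ s) - crossV (γ s)) ^ 2 - 4 * crossU (γ s)) (by fun_prop)
    fun s hs h0 => (h.inner s hs).2 (by
      change _ - _ = (0 : ℂ)
      linear_combination -h0)
  set z : unitInterval → ℂ := fun s => (1 + crossU (γ s) - crossV (γ s) + q s) / 2 with hz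
  set w : unitInterval → ℂ := fun s => (1 + crossU (γ s) - crossV (γ s) - q s) / 2 with hw
  have hzc : Continuous z := by fun_prop
  have hwc : Continuous w := by fun_prop
  have hp : ∀ s, IsZPair (γ s) (z s) (w s) := fun s =>
    ⟨by simp only [hz, hw]; linear_combination hsq s / 4,
      by simp only [hz, hw]; linear_combination hsq s / 4⟩
  have hst := (hp 0).eq_star h.start.1
  have him : (w 0).im = -(z 0).im := by rw [hst]; simp
  rcases le_total 0 (z 0).im with h0 | h0
  · exact ⟨z, w, hzc, hwc, hp, h0, by linarith⟩
  · exact ⟨w, z, hwc, hzc, fun s => (hp s).swap, by linarith, h0⟩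

lemma IsZCurve.start_eq_star (h : IsPathTo C γ) {z w : unitInterval → ℂ} (hzw : IsZCurve γ z w) :
    w 0 = star (z 0) :=
  (hzw.pair 0).eq_star h.start.1

lemma IsZCurve.start_im_pos (h : IsPathTo C γ) {z w : unitInterval → ℂ} (hzw : IsZCurve γ z w) :
    0 < (z 0).im := by
  refine hzw.start_z.lt_of_ne fun h0 => h.start.2 ?_
  rw [(hzw.pair 0).mem_branchLocus, hzw.start_eq_star h]
  exact Complex.ext (by simp) (by simp [← h0])

lemma IsZCurve.pair_one (h : IsPathTo C γ) {z w : unitInterval → ℂ} (hzw : IsZCurve γ z w) :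
    IsZPair C (z 1) (w 1) := by
  have := hzw.pair 1
  rwa [h.finish] at this

/-! ### Convergence of the s-channel expansion -/

/-- The curve of `χ` along a curve of `z` off `[1, ∞)`: a continuous logarithm of `ρ`, which is
principal at the start. -/
lemma exists_rho_curve {z : unitInterval → ℂ} (hz : Continuous z)
    (h1 : ∀ s, 1 - z s ∈ Complex.slitPlane) (h0 : ∀ s, z s ≠ 0) :
    ∃ a χ : unitInterval → ℂ, (∀ s, a s ^ 2 = 1 - z s) ∧ (∀ s, 0 < (a s).re) ∧
      (∀ s, Complex.exp (Complex.I * χ s) = rhoOf (a s)) ∧ IsChiCurve z χ ∧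
      χ 0 = -Complex.I * Complex.log (rhoOf (a 0)) := by
  set a : unitInterval → ℂ := fun s => Complex.exp (Complex.log (1 - z s) / 2) with ha
  have hac : Continuous a := by
    have : Continuous fun s => Complex.log (1 - z s) := Continuous.clog (by fun_prop) h1
    fun_prop
  have hprop : ∀ s, a s ^ 2 = 1 - z s ∧ 0 < (a s).re := fun s => by
    obtain ⟨x, hx, hx0⟩ := exists_sqrt_re_pos (h1 s)
    have : a s = x := by rw [ha]; simp only; rw [← hx, exp_log_sq_div_two hx0]
    rw [this]
    exact ⟨hx, hx0⟩
  have hz' : ∀ s, z s = 1 - a s ^ 2 := fun s => by rw [(hprop s).1, sub_sub_cancel]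
  have hr0 : ∀ s, rhoOf (a s) ≠ 0 := fun s => rhoOf_ne_zero (hprop s).2 (by rw [← hz']; exact h0 s)
  have hrc : Continuous fun s => rhoOf (a s) :=
    (continuous_const.sub hac).div (continuous_const.add hac) fun s => one_add_ne_zero (hprop s).2
  obtain ⟨φ, hφ, hexp, hφ0⟩ := exists_log_curve hrc hr0 (Complex.exp_log (hr0 0))
  have hexp' : ∀ s, Complex.exp (Complex.I * (-Complex.I * φ s)) = rhoOf (a s) := fun s => by
    rw [← mul_assoc, mul_neg, Complex.I_mul_I, neg_neg, one_mul, hexp]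
  refine ⟨a, fun s => -Complex.I * φ s, fun s => (hprop s).1, fun s => (hprop s).2, hexp', ?_, ?_⟩
  · refine ⟨by fun_prop, fun s => ?_, fun s => ?_⟩
    · have h1 := norm_rhoOf_lt_one (hprop s).2
      rw [← hexp' s, Complex.norm_exp, Real.exp_lt_one_iff, Complex.I_mul_re] at h1
      linarith
    · rw [hexp', hz' s]; exact radial_rhoOf (hprop s).2
  · simp only [hφ0]

lemma rhoOf_im_pos {a : ℂ} (ha : 0 < a.re) (h : 0 < (1 - a ^ 2).im) : 0 < (rhoOf a).im := by
  have h1 : a.im < 0 := by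
    simp [pow_two] at h
    by_contra! hc
    nlinarith [mul_nonneg ha.le hc]
  have hn : 0 < Complex.normSq (1 + a) := Complex.normSq_pos.2 (one_add_ne_zero ha)
  have : (rhoOf a).im = -2 * a.im / Complex.normSq (1 + a) := by
    rw [rhoOf, Complex.div_im]
    simp
    ring
  rw [this]
  exact div_pos (by linarith) hn

lemma IsRootPair.of_isZPair {a b a' b' : ℂ} (h : IsRootPair 1 C a' b') (ha : 0 < a.re)
    (hb : 0 < b.re) (hz : IsZPair C (1 - a ^ 2) (1 - b ^ 2)) : IsRootPair 1 C a b := by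
  refine ⟨ha, hb, hz, ?_⟩
  rw [← h.2.2.2]
  rcases h.2.2.1.eq_or_eq hz with ⟨h1, h2⟩ | ⟨h1, h2⟩
  · rw [eq_of_sq_eq_of_re_pos (by linear_combination -h1) ha h.1,
      eq_of_sq_eq_of_re_pos (by linear_combination -h2) hb h.2.1]
  · rw [eq_of_sq_eq_of_re_pos (by linear_combination -h1) ha h.2.1,
      eq_of_sq_eq_of_re_pos (by linear_combination -h2) hb h.1, mul_comm]

/-- The Lorentzian four-point function is the value of the continuous extension of the radial
series. -/
lemma isWickLimit_radialG (F : UnitaryCFT d) {G : Config d → ℂ} (hG : IsContinuation F G)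
    (hL : C ∈ lorentz d) (hC : C ∈ radialDomain d) : IsWickLimit G C (radialG F C) := by
  have hmem : ∀ ε : Fin 4 → ℝ, StrictAnti ε →
      ((fun k => (ε k : ℂ) + C.1 k, C.2) : Config d) ∈ domainD d := by
    intro ε hε i j hij
    simpa [hL.2.1] using hε hij
  have hlim : Tendsto (fun ε : Fin 4 → ℝ => ((fun k => (ε k : ℂ) + C.1 k, C.2) : Config d))
      (𝓝[{ε | StrictAnti ε}] 0) (𝓝[radialDomain d] C) := by
    refine tendsto_nhdsWithin_iff.2 ⟨?_, ?_⟩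
    · have hc : Continuous fun ε : Fin 4 → ℝ => ((fun k => (ε k : ℂ) + C.1 k, C.2) : Config d) := by
        fun_prop
      refine (hc.tendsto' 0 C ?_).mono_left nhdsWithin_le_nhds
      exact Prod.ext (funext fun k => by simp) rfl
    · filter_upwards [self_mem_nhdsWithin] with ε hε
      exact domainD_subset_radialDomain (hmem ε hε)
  refine ((continuousOn_radialG F C hC).tendsto.comp hlim).congr' ?_
  filter_upwards [self_mem_nhdsWithin] with ε hε
  exact ((isContinuation_radialG F).eqOn hG (hmem ε hε))

/-- Along an admissible path `i (χ + χ̄)` is the single-valued `log (ρ ρ̄)`, and the radial series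
depends on `χ, χ̄` only through this logarithm and `ρ, ρ̄`; so its value does not depend on the path,
and is the value of `radialG`. -/
theorem sChannelConverges (F : UnitaryCFT d) {G : Config d → ℂ} (hG : IsContinuation F G)
    (hL : C ∈ lorentz d) (hz : ∀ z w, IsZPair C z w → z ∉ onReal (Ici 1))
    (hex : ∃ γ, IsPathTo C γ) : SChannelConverges F G C := by
  refine ⟨hex, fun γ hγ => ?_⟩
  have hrad := mem_radialDomain_of_mem_lorentz hL hz
  have hmem := hγ.mem_of_forall domainD_subset_radialDomain hrad
  obtain ⟨z, w, hzw⟩ := hγ.exists_isZCurve hrad.1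
  have hno : ∀ s z w, IsZPair (γ s) z w → z ∉ onReal (Ici 1) := by
    intro s
    exact hγ.mem_of_forall (S := {C | ∀ z w, IsZPair C z w → z ∉ onReal (Ici 1)})
      (fun C hC z w h => not_mem_onReal_Ici_of_mem_domainD hC h) hz s
  obtain ⟨a, χ, ha, ha0, hχ, hχc, hχ0⟩ := exists_rho_curve hzw.continuous_z
    (fun s => one_sub_mem_slitPlane (hno s _ _ (hzw.pair s))) fun s => (hzw.pair s).ne_zero (hmem s).1
  obtain ⟨b, χ', hb, hb0, hχ', hχc', hχ0'⟩ := exists_rho_curve hzw.continuous_w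
    (fun s => one_sub_mem_slitPlane (hno s _ _ (hzw.pair s).swap))
    fun s => (hzw.pair s).swap.ne_zero (hmem s).1
  have hroot : ∀ s, IsRootPair 1 (γ s) (a s) (b s) := fun s => by
    obtain ⟨a', b', h⟩ := (hmem s).2
    refine h.of_isZPair (ha0 s) (hb0 s) ?_
    rw [ha, hb, sub_sub_cancel, sub_sub_cancel]
    exact hzw.pair s
  have hb_star : b 0 = star (a 0) := (hroot 0).eq_star hγ.start.1
  have hrim : 0 < (rhoOf (a 0)).im := by
    refine rhoOf_im_pos (ha0 0) ?_
    rw [ha, sub_sub_cancel]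
    exact hzw.start_im_pos hγ
  have harg : (rhoOf (a 0)).arg ≠ Real.pi := fun h => by
    rw [Complex.arg_eq_pi_iff] at h
    exact hrim.ne' h.2
  have hlogstar : Complex.log (rhoOf (b 0)) = star (Complex.log (rhoOf (a 0))) := by
    rw [hb_star, rhoOf_star]
    exact Complex.log_conj _ harg
  -- both sides are logarithms of `ρ ρ̄`, and real at the start, where `ρ̄` is the conjugate of `ρ`
  have hM : (fun s => Complex.I * (χ s + χ' s)) = fun s => logRho (γ s) := by
    refine log_curve_unique (continuous_const.mul (hχc.continuous.add hχc'.continuous))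
      (continuousOn_logRho.comp_continuous hγ.continuous hmem) (fun s => ?_) ?_
    · rw [mul_add, Complex.exp_add, hχ, hχ', (hroot s).exp_logRho (hmem s).1]
    · refine eq_of_exp_eq_of_im_eq_zero ?_ ?_ (logRho_im_eq_zero hγ.start.1 (hb_star ▸ hroot 0))
      · rw [mul_add, Complex.exp_add, hχ, hχ', (hroot 0).exp_logRho (hmem 0).1]
      · simp only [hχ0, hχ0', hlogstar]
        simp
  have h1 := hroot 1
  rw [hγ.finish] at h1
  have hM1 : Complex.I * (χ 1 + χ' 1) = logRho C := by
    have := congrFun hM 1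
    simpa only [hγ.finish] using this
  obtain ⟨hsum, htsum⟩ := summable_and_tsum_radialTerm F hrad.1 h1 (hχ 1) (hχ' 1) hM1
  have hre : (χ 0).re = (rhoOf (a 0)).arg := by rw [hχ0]; simp [Complex.log_im]
  have hre' : (χ' 0).re = -(rhoOf (a 0)).arg := by rw [hχ0', hlogstar]; simp [Complex.log_im]
  have harg0 : 0 ≤ (rhoOf (a 0)).arg := Complex.arg_nonneg_iff.2 hrim.le
  have hargpi := Complex.arg_le_pi (rhoOf (a 0))
  refine ⟨z, w, χ, χ', fun s => logSq (γ s) 0 1 + logSq (γ s) 2 3, hzw, hχc, hre ▸ harg0,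
    hre ▸ hargpi, hχc', by linarith, by linarith, ?_, fun s => ?_, ?_, hsum, ?_⟩
  · exact ((continuousOn_logSq (by decide)).comp_continuous hγ.continuous fun s => (hmem s).1).add
      ((continuousOn_logSq (by decide)).comp_continuous hγ.continuous fun s => (hmem s).1)
  · rw [Complex.exp_add, exp_logSq ((hmem s).1.2 _ _ (by decide)),
      exp_logSq ((hmem s).1.2 _ _ (by decide))]
  · simp [logSq_im_eq_zero hγ.start.1 (show (0 : Fin 4) < 1 by decide),
      logSq_im_eq_zero hγ.start.1 (show (2 : Fin 4) < 3 by decide)]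
  · rw [htsum]
    simp only [hγ.finish]
    exact isWickLimit_radialG F hG hL hrad

end Path

/-! ### Signed crossings as a change of phase -/

/-- The number of turns of `exp φ` around the origin. -/
noncomputable def turns (φ : ℂ) : ℝ := φ.im / (2 * Real.pi)

lemma exp_eq_norm_mul_turns (φ : ℂ) (j : ℤ) :
    (Complex.exp φ).re = Real.exp φ.re * Real.cos (2 * Real.pi * (turns φ - j)) ∧
      (Complex.exp φ).im = Real.exp φ.re * Real.sin (2 * Real.pi * (turns φ - j)) := by
  have h : 2 * Real.pi * (turns φ - j) = φ.im - j * (2 * Real.pi) := by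
    unfold turns; field_simp
  rw [h, Real.cos_sub_int_mul_two_pi, Real.sin_sub_int_mul_two_pi, Complex.exp_re, Complex.exp_im]
  exact ⟨rfl, rfl⟩

lemma exp_im_pos_iff {φ : ℂ} {j : ℤ} (h : |turns φ - j| < 1 / 2) :
    (0 < (Complex.exp φ).im ↔ (j : ℝ) < turns φ) ∧
      ((Complex.exp φ).im < 0 ↔ turns φ < j) ∧
      (turns φ = j → (Complex.exp φ).im = 0 ∧ 0 < (Complex.exp φ).re) := by
  obtain ⟨h1, h2⟩ := abs_lt.1 h
  obtain ⟨hre, him⟩ := exp_eq_norm_mul_turns φ j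
  have he := Real.exp_pos φ.re
  have hpi := Real.pi_pos
  have hpos : (j : ℝ) < turns φ → 0 < (Complex.exp φ).im := fun hj => by
    rw [him]
    exact mul_pos he (Real.sin_pos_of_pos_of_lt_pi (by nlinarith) (by nlinarith))
  have hneg : turns φ < j → (Complex.exp φ).im < 0 := fun hj => by
    rw [him]
    exact mul_neg_of_pos_of_neg he (Real.sin_neg_of_neg_of_neg_pi_lt (by nlinarith) (by nlinarith))
  have hzero : turns φ = j → (Complex.exp φ).im = 0 ∧ 0 < (Complex.exp φ).re := fun hj => by
    rw [him, hre, hj]; simp [he]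
  refine ⟨⟨fun h => ?_, hpos⟩, ⟨fun h => ?_, hneg⟩, hzero⟩
  · rcases lt_trichotomy (turns φ) j with h' | h' | h'
    · linarith [hneg h']
    · linarith [(hzero h').1]
    · exact h'
  · rcases lt_trichotomy (turns φ) j with h' | h' | h'
    · exact h'
    · linarith [(hzero h').1]
    · linarith [hpos h']

/-- `exp φ` is on the positive real axis exactly after an integral number of turns. -/
lemma exp_pos_iff (φ : ℂ) :
    (Complex.exp φ).im = 0 ∧ 0 < (Complex.exp φ).re ↔ ∃ j : ℤ, turns φ = j := by
  constructor
  · rintro ⟨h1, h2⟩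
    obtain ⟨hre, him⟩ := exp_eq_norm_mul_turns φ 0
    rw [him, mul_eq_zero, or_iff_right (Real.exp_pos _).ne'] at h1
    rw [hre, mul_pos_iff_of_pos_left (Real.exp_pos _)] at h2
    have h3 : Real.cos (2 * Real.pi * (turns φ - (0 : ℤ))) = 1 := by
      have := Real.sin_sq_add_cos_sq (2 * Real.pi * (turns φ - (0 : ℤ)))
      rw [h1] at this
      nlinarith
    obtain ⟨n, hn⟩ := (Real.cos_eq_one_iff _).1 h3
    refine ⟨n, ?_⟩
    have hpi := Real.pi_pos
    have : 2 * Real.pi * ((n : ℝ) - turns φ) = 0 := by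
      push_cast at hn; linarith
    have := (mul_eq_zero.1 this).resolve_left (by positivity)
    linarith
  · rintro ⟨j, hj⟩
    exact (exp_im_pos_iff (j := j) (by rw [hj]; norm_num)).2.2 hj

lemma exp_re_pos_of_abs_lt {φ : ℂ} {j : ℤ} (h : |turns φ - j| < 1 / 4) :
    0 < (Complex.exp φ).re := by
  obtain ⟨h1, h2⟩ := abs_lt.1 h
  have hpi := Real.pi_pos
  rw [(exp_eq_norm_mul_turns φ j).1]
  exact mul_pos (Real.exp_pos _) (Real.cos_pos_of_mem_Ioo ⟨by nlinarith, by nlinarith⟩)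

lemma not_mem_slitPlane_of_turns {φ : ℂ} {j : ℤ} (h : turns φ + 1 / 2 = j) :
    Complex.exp φ ∉ Complex.slitPlane := by
  have h1 : turns φ - j = -(1 / 2) := by linarith
  obtain ⟨hre, him⟩ := exp_eq_norm_mul_turns φ j
  rw [h1, show 2 * Real.pi * (-(1 / 2)) = -Real.pi by ring] at hre him
  simp at hre him
  rw [Complex.mem_slitPlane_iff]
  rintro (h | h)
  · linarith [Real.exp_pos φ.re]
  · exact h him

lemma floor_eq_of_avoids {p : unitInterval → ℝ} (hp : Continuous p) {a b : unitInterval}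
    (hab : a ≤ b) (h : ∀ r ∈ Icc a b, ∀ j : ℤ, p r ≠ j) : ⌊p a⌋ = ⌊p b⌋ := by
  rcases lt_trichotomy ⌊p a⌋ ⌊p b⌋ with hlt | heq | hlt
  · obtain ⟨r, hr, hr'⟩ := intermediate_value_Icc hab hp.continuousOn
      (show ((⌊p b⌋ : ℤ) : ℝ) ∈ Icc (p a) (p b) from ⟨(Int.floor_lt.1 hlt).le, Int.floor_le _⟩)
    exact absurd hr' (h r hr _)
  · exact heq
  · obtain ⟨r, hr, hr'⟩ := intermediate_value_Icc' hab hp.continuousOn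
      (show ((⌊p a⌋ : ℤ) : ℝ) ∈ Icc (p b) (p a) from ⟨(Int.floor_lt.1 hlt).le, Int.floor_le _⟩)
    exact absurd hr' (h r hr _)

/-- A function `g` that turns crossings of the interval `I` into crossings of the positive real
axis, preserving the sides of the real axis if `σ = 1` and exchanging them if `σ = -1`. -/
structure IsCrossingChart (I : Set ℝ) (σ : ℤ) (g : ℂ → ℂ) : Prop where
  sign : σ = 1 ∨ σ = -1
  mem_iff : ∀ z, z ≠ 0 → z ≠ 1 → (z ∈ onReal I ↔ (g z).im = 0 ∧ 0 < (g z).re)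
  slit : ∀ z, z ≠ 0 → z ≠ 1 → z.re ∈ I → g z ∈ Complex.slitPlane
  strip : ∀ z, z ≠ 0 → z ≠ 1 → 0 < (g z).re → z.re ∈ I
  upper : ∀ z, z ≠ 0 → z ≠ 1 → (0 < z.im ↔ 0 < σ * (g z).im)
  lower : ∀ z, z ≠ 0 → z ≠ 1 → (z.im < 0 ↔ σ * (g z).im < 0)
  ne_zero : ∀ z, z ≠ 0 → z ≠ 1 → g z ≠ 0
  continuousOn : ContinuousOn g {z | z ≠ 0 ∧ z ≠ 1}
  star_comm : ∀ z, g (star z) = star (g z)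

lemma isCrossingChart_neg : IsCrossingChart (Iio 0) (-1) fun z => -z where
  sign := Or.inr rfl
  mem_iff z _ _ := by simp [onReal]
  slit z _ _ h := by
    rw [Complex.mem_slitPlane_iff]; left; simpa using h
  strip z _ _ h := by simpa using h
  upper z _ _ := by simp
  lower z _ _ := by simp
  ne_zero z h _ := neg_ne_zero.2 h
  continuousOn := continuous_neg.continuousOn
  star_comm z := by simp

lemma isCrossingChart_div : IsCrossingChart (Ioo 0 1) 1 fun z => z / (1 - z) := by
  have hre : ∀ z : ℂ, (z / (1 - z)).re =
      (z.re * (1 - z.re) - z.im ^ 2) / Complex.normSq (1 - z) := by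
    intro z; rw [Complex.div_re]; simp; ring
  have him : ∀ z : ℂ, (z / (1 - z)).im = z.im / Complex.normSq (1 - z) := by
    intro z; rw [Complex.div_im]; simp; ring
  have hn : ∀ z : ℂ, z ≠ 1 → 0 < Complex.normSq (1 - z) := fun z hz =>
    Complex.normSq_pos.2 (sub_ne_zero.2 hz.symm)
  refine ⟨Or.inl rfl, fun z _ h => ?_, fun z _ h hI => ?_, fun z _ h hI => ?_, fun z _ h => ?_,
    fun z _ h => ?_, fun z h0 h => div_ne_zero h0 (sub_ne_zero.2 h.symm), ?_, fun z => by simp⟩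
  · rw [hre, him, div_eq_zero_iff, or_iff_left (hn z h).ne', div_pos_iff_of_pos_right (hn z h)]
    refine and_congr_right fun h0 => ?_
    rw [h0, mem_Ioo]
    constructor
    · rintro ⟨h1, h2⟩; nlinarith
    · intro h1; constructor <;> nlinarith
  · rw [Complex.mem_slitPlane_iff, hre, him]
    by_cases h0 : z.im = 0
    · left
      rw [h0]
      exact div_pos (by nlinarith [hI.1, hI.2]) (hn z h)
    · exact Or.inr (div_ne_zero h0 (hn z h).ne')
  · rw [hre, div_pos_iff_of_pos_right (hn z h)] at hI
    constructor <;> nlinarith [sq_nonneg z.im]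
  · rw [him, Int.cast_one, one_mul, div_pos_iff_of_pos_right (hn z h)]
  · rw [him, Int.cast_one, one_mul, div_neg_iff]
    simp [hn z h, (hn z h).not_gt]
  · exact continuousOn_id.div (by fun_prop) fun z hz => sub_ne_zero.2 hz.2.symm

section Crossings
variable {I : Set ℝ} {σ : ℤ} {g : ℂ → ℂ} {f φ : unitInterval → ℂ}

/-- Along a single admissible piece the number of turns of the phase changes its floor by the
contribution of that piece. -/
lemma IsCrossingChart.piece_eq (hg : IsCrossingChart I σ g) (h01 : ∀ r, f r ≠ 0 ∧ f r ≠ 1)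
    (hφ : Continuous φ) (hexp : ∀ r, Complex.exp (φ r) = g (f r)) {a b : unitInterval}
    (hab : a ≤ b) (ha : f a ∉ onReal I) (hb : f b ∉ onReal I) {c : ℤ}
    (hc : ((∀ r ∈ Icc a b, f r ∉ onReal I) ∧ c = 0) ∨
      ((∀ r ∈ Icc a b, (f r).re ∈ I) ∧ c = sideChange (f a) (f b))) :
    c = -σ * (⌊turns (φ b)⌋ - ⌊turns (φ a)⌋) := by
  have hcont : Continuous fun r => turns (φ r) := (Complex.continuous_im.comp hφ).div_const _
  have hmem : ∀ r, f r ∈ onReal I ↔ ∃ j : ℤ, turns (φ r) = j := fun r => by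
    rw [hg.mem_iff _ (h01 r).1 (h01 r).2, ← hexp, exp_pos_iff]
  rcases hc with ⟨hc, rfl⟩ | ⟨hc, rfl⟩
  · rw [floor_eq_of_avoids hcont hab fun r hr j hj => hc r hr ((hmem r).2 ⟨j, hj⟩)]
    ring
  -- over the strip the phase stays within half a turn of a fixed integer `j`, and the side of the
  -- real axis tells whether it is above or below `j`
  · have hfl : ⌊turns (φ a) + 1 / 2⌋ = ⌊turns (φ b) + 1 / 2⌋ := by
      refine floor_eq_of_avoids (hcont.add_const _) hab fun r hr j hj => ?_
      refine not_mem_slitPlane_of_turns hj ?_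
      rw [hexp]
      exact hg.slit _ (h01 r).1 (h01 r).2 (hc r hr)
    set j : ℤ := ⌊turns (φ a) + 1 / 2⌋ with hj
    have hside : ∀ r, ⌊turns (φ r) + 1 / 2⌋ = j → r ∈ Icc a b → f r ∉ onReal I →
        (0 < (g (f r)).im ∧ ⌊turns (φ r)⌋ = j) ∨ ((g (f r)).im < 0 ∧ ⌊turns (φ r)⌋ = j - 1) := by
      intro r hr hrI hnot
      obtain ⟨h1, h2⟩ := Int.floor_eq_iff.1 hr
      have hne : turns (φ r) + 1 / 2 ≠ j := fun h => not_mem_slitPlane_of_turns h (by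
        rw [hexp]
        exact hg.slit _ (h01 r).1 (h01 r).2 (hc r hrI))
      have h1' := lt_of_le_of_ne h1 hne.symm
      have habs : |turns (φ r) - j| < 1 / 2 := abs_lt.2 ⟨by linarith, by linarith⟩
      obtain ⟨e1, e2, -⟩ := exp_im_pos_iff habs
      rw [hexp] at e1 e2
      rcases lt_trichotomy (turns (φ r)) j with h | h | h
      · refine Or.inr ⟨e2.2 h, Int.floor_eq_iff.2 ⟨?_, ?_⟩⟩ <;> push_cast <;> linarith
      · exact absurd ((hmem r).2 ⟨j, h⟩) hnot
      · exact Or.inl ⟨e1.2 h, Int.floor_eq_iff.2 ⟨h.le, by linarith⟩⟩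
    have ua := hg.upper _ (h01 a).1 (h01 a).2
    have ub := hg.upper _ (h01 b).1 (h01 b).2
    have la := hg.lower _ (h01 a).1 (h01 a).2
    have lb := hg.lower _ (h01 b).1 (h01 b).2
    unfold sideChange
    simp only [ua, ub, la, lb]
    rcases hside a rfl (left_mem_Icc.2 hab) ha with ⟨ia, fa⟩ | ⟨ia, fa⟩ <;>
    rcases hside b hfl.symm (right_mem_Icc.2 hab) hb with ⟨ib, fb⟩ | ⟨ib, fb⟩ <;>
    rw [fa, fb] <;>
    rcases hg.sign with rfl | rfl <;>
    simp [ia, ib, ia.not_gt, ib.not_gt]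

lemma IsCrossingChart.eq_of_hasSignedCrossings (hg : IsCrossingChart I σ g)
    (h01 : ∀ r, f r ≠ 0 ∧ f r ≠ 1) (hφ : Continuous φ) (hexp : ∀ r, Complex.exp (φ r) = g (f r))
    {n : ℤ} (h : HasSignedCrossings I f n) :
    n = -σ * (⌊turns (φ 1)⌋ - ⌊turns (φ 0)⌋) := by
  obtain ⟨m, s, c, hs, hs0, hs1, hoff, hc, rfl⟩ := h
  have h1 : ∀ k : Fin m, c k =
      -σ * (⌊turns (φ (s k.succ))⌋ - ⌊turns (φ (s k.castSucc))⌋) := fun k =>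
    hg.piece_eq h01 hφ hexp (hs k.castSucc_lt_succ.le) (hoff _) (hoff _) (hc k)
  rw [Finset.sum_congr rfl fun k _ => h1 k, ← Finset.mul_sum]
  congr 1
  have htel : ∀ (m : ℕ) (F : Fin (m + 1) → ℤ),
      ∑ k : Fin m, (F k.succ - F k.castSucc) = F (Fin.last m) - F 0 := by
    intro m
    induction m with
    | zero => intro F; simp
    | succ m ih =>
      intro F
      rw [Fin.sum_univ_castSucc]
      have := ih fun k => F k.castSucc
      simp only [Fin.succ_castSucc, Fin.castSucc_zero] at this ⊢
      rw [this, Fin.succ_last]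
      ring
  have := htel m fun k => ⌊turns (φ (s k))⌋
  rw [hs0, hs1] at this
  exact this

/-- Decompositions as in `HasSignedCrossings` of the initial segment of a curve ending at `b`. -/
def CrossingsUpTo (I : Set ℝ) (f : unitInterval → ℂ) (b : unitInterval) : Prop :=
  ∃ (m : ℕ) (s : Fin (m + 1) → unitInterval) (c : Fin m → ℤ),
    Monotone s ∧ s 0 = 0 ∧ s (Fin.last m) = b ∧ (∀ k, f (s k) ∉ onReal I) ∧
    (∀ k : Fin m,
      ((∀ r ∈ Icc (s k.castSucc) (s k.succ), f r ∉ onReal I) ∧ c k = 0) ∨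
      ((∀ r ∈ Icc (s k.castSucc) (s k.succ), (f r).re ∈ I) ∧
        c k = sideChange (f (s k.castSucc)) (f (s k.succ))))

lemma CrossingsUpTo.extend {b b' : unitInterval} (h : CrossingsUpTo I f b) (hb : b ≤ b')
    (hoff : f b' ∉ onReal I)
    (hpiece : (∀ r ∈ Icc b b', f r ∉ onReal I) ∨ ∀ r ∈ Icc b b', (f r).re ∈ I) :
    CrossingsUpTo I f b' := by
  obtain ⟨m, s, c, hs, hs0, hs1, hs2, hc⟩ := h
  obtain ⟨c0, hc0⟩ : ∃ c0 : ℤ, ((∀ r ∈ Icc b b', f r ∉ onReal I) ∧ c0 = 0) ∨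
      ((∀ r ∈ Icc b b', (f r).re ∈ I) ∧ c0 = sideChange (f b) (f b')) := by
    rcases hpiece with h | h
    exacts [⟨_, Or.inl ⟨h, rfl⟩⟩, ⟨_, Or.inr ⟨h, rfl⟩⟩]
  refine ⟨m + 1, Fin.snoc (α := fun _ => unitInterval) s b', Fin.snoc (α := fun _ => ℤ) c c0,
    ?_, ?_, ?_, ?_, ?_⟩
  · rw [Fin.monotone_iff_le_succ]
    intro k
    induction k using Fin.lastCases with
    | last => rw [Fin.snoc_castSucc, Fin.succ_last, Fin.snoc_last, hs1]; exact hb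
    | cast k =>
      rw [Fin.snoc_castSucc, Fin.succ_castSucc, Fin.snoc_castSucc]
      exact hs k.castSucc_lt_succ.le
  · rw [← Fin.castSucc_zero, Fin.snoc_castSucc, hs0]
  · rw [Fin.snoc_last]
  · intro k
    induction k using Fin.lastCases with
    | last => rw [Fin.snoc_last]; exact hoff
    | cast k => rw [Fin.snoc_castSucc]; exact hs2 k
  · intro k
    induction k using Fin.lastCases with
    | last =>
      rw [Fin.snoc_castSucc, Fin.succ_last, Fin.snoc_last, Fin.snoc_last, hs1]
      exact hc0
    | cast k =>
      rw [Fin.snoc_castSucc, Fin.succ_castSucc, Fin.snoc_castSucc, Fin.snoc_castSucc]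
      exact hc k

/-- A decomposition exists: on a fine subdivision the phase varies little, and cut points on `I` are
dropped, because around them the curve stays in the strip over `I`. -/
lemma IsCrossingChart.exists_hasSignedCrossings (hg : IsCrossingChart I σ g)
    (h01 : ∀ r, f r ≠ 0 ∧ f r ≠ 1) (hφ : Continuous φ) (hexp : ∀ r, Complex.exp (φ r) = g (f r))
    (h0 : f 0 ∉ onReal I) (h1 : f 1 ∉ onReal I) : ∃ n, HasSignedCrossings I f n := by
  have hcont : Continuous fun r => turns (φ r) := (Complex.continuous_im.comp hφ).div_const _
  have hmem : ∀ r, f r ∈ onReal I ↔ ∃ j : ℤ, turns (φ r) = j := fun r => by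
    rw [hg.mem_iff _ (h01 r).1 (h01 r).2, ← hexp, exp_pos_iff]
  have hstrip : ∀ r (j : ℤ), |turns (φ r) - j| < 1 / 8 → (f r).re ∈ I := fun r j h => by
    refine hg.strip _ (h01 r).1 (h01 r).2 ?_
    rw [← hexp]
    exact exp_re_pos_of_abs_lt (h.trans (by norm_num))
  obtain ⟨t, ht0, htm, ⟨N, hN⟩, ht⟩ := exists_monotone_Icc_subset_open_cover_unitInterval
    (c := fun x : unitInterval => {r | |turns (φ r) - turns (φ x)| < 1 / 16})
    (fun x => isOpen_lt (by fun_prop) continuous_const)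
    fun x _ => mem_iUnion.2 ⟨x, by simp⟩
  have hosc : ∀ n, ∀ r ∈ Icc (t n) (t (n + 1)), ∀ r' ∈ Icc (t n) (t (n + 1)),
      |turns (φ r) - turns (φ r')| < 1 / 8 := by
    intro n r hr r' hr'
    obtain ⟨x, hx⟩ := ht n
    have h1 : |turns (φ r) - turns (φ x)| < 1 / 16 := hx hr
    have h2 : |turns (φ r') - turns (φ x)| < 1 / 16 := hx hr'
    rw [abs_lt] at h1 h2
    exact abs_lt.2 ⟨by linarith [h1.1, h2.2], by linarith [h1.2, h2.1]⟩
  -- either `t n` is a cut point, or it is on `I` and the last cut point `b` is linked to it within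
  -- the strip
  have hclaim : ∀ n, (f (t n) ∉ onReal I ∧ CrossingsUpTo I f (t n)) ∨
      ∃ (b : unitInterval) (j : ℤ), b ≤ t n ∧ CrossingsUpTo I f b ∧ turns (φ (t n)) = j ∧
        ∀ r ∈ Icc b (t n), |turns (φ r) - j| < 1 / 8 := by
    intro n
    induction n with
    | zero =>
      left
      rw [ht0]
      exact ⟨h0, 0, fun _ => 0, Fin.elim0, fun _ _ _ => le_rfl, rfl, rfl, fun _ => h0,
        fun k => k.elim0⟩
    | succ n ih =>
      have hle := htm n.le_succ
      have hR : t (n + 1) ∈ Icc (t n) (t (n + 1)) := right_mem_Icc.2 hle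
      have hL : t n ∈ Icc (t n) (t (n + 1)) := left_mem_Icc.2 hle
      by_cases hgood : f (t (n + 1)) ∈ onReal I
      · right
        obtain ⟨j, hj⟩ := (hmem _).1 hgood
        rcases ih with ⟨-, hup⟩ | ⟨b, j', hb, hup, hj', hnear⟩
        · refine ⟨t n, j, hle, hup, hj, fun r hr => ?_⟩
          rw [← hj]
          exact hosc n r hr _ hR
        · have hjj : j' = j := by
            have h1 := hosc n _ hR _ hL
            rw [hj, hj'] at h1
            have h2 : |j - j'| < 1 := by
              have : ((|j - j'| : ℤ) : ℝ) < 1 := by push_cast; linarith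
              exact_mod_cast this
            have := Int.abs_lt_one_iff.1 h2
            omega
          subst hjj
          refine ⟨b, j', hb.trans hle, hup, hj, fun r hr => ?_⟩
          rcases le_total r (t n) with h | h
          · exact hnear r ⟨hr.1, h⟩
          · rw [← hj]; exact hosc n r ⟨h, hr.2⟩ _ hR
      · left
        refine ⟨hgood, ?_⟩
        rcases ih with ⟨-, hup⟩ | ⟨b, j', hb, hup, hj', hnear⟩
        · refine hup.extend hle hgood ?_
          by_cases hav : ∀ r ∈ Icc (t n) (t (n + 1)), f r ∉ onReal I
          · exact Or.inl hav
          · push Not at hav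
            obtain ⟨r0, hr0, hr0I⟩ := hav
            obtain ⟨j, hj⟩ := (hmem _).1 hr0I
            refine Or.inr fun r hr => hstrip r j ?_
            rw [← hj]
            exact hosc n r hr _ hr0
        · refine hup.extend (hb.trans hle) hgood (Or.inr fun r hr => hstrip r j' ?_)
          rcases le_total r (t n) with h | h
          · exact hnear r ⟨hr.1, h⟩
          · rw [← hj']; exact hosc n r ⟨h, hr.2⟩ _ hL
  rcases hclaim N with ⟨-, hup⟩ | ⟨b, j, -, -, hj, -⟩
  · rw [hN N le_rfl] at hup
    obtain ⟨m, s, c, h1, h2, h3, h4, h5⟩ := hup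
    exact ⟨_, m, s, c, h1, h2, h3, h4, h5, rfl⟩
  · rw [hN N le_rfl] at hj
    exact absurd ((hmem 1).2 ⟨j, hj⟩) h1

end Crossings

/-- If two non-integers add up to an integer, their integer parts add up to one
less. -/
lemma floor_add_floor {x y : ℝ} {j : ℤ} (h : x + y = j) (hx : ∀ k : ℤ, x ≠ k) :
    ⌊x⌋ + ⌊y⌋ = j - 1 := by
  have h1 := Int.floor_le x
  have h2 := Int.lt_floor_add_one x
  have h3 : ⌊y⌋ = j - 1 - ⌊x⌋ := by
    rw [Int.floor_eq_iff]
    push_cast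
    have := lt_of_le_of_ne h1 (hx _).symm
    constructor <;> linarith
  omega

/-- The signed crossings of `z` and `z̄` add up to the change of the phase of `g z · g z̄`, a
single-valued function of the configuration. -/
theorem IsCrossingChart.hasNumber {I : Set ℝ} {σ : ℤ} {g : ℂ → ℂ} (hg : IsCrossingChart I σ g)
    {L : Config d → ℂ} (hLc : ContinuousOn L (regular d))
    (hLexp : ∀ C ∈ regular d, ∀ z w, IsZPair C z w → g z * g w = Complex.exp (L C))
    (hLE : ∀ C ∈ domainE d, (L C).im = 0) {C : Config d} (hC : C ∈ regular d)
    (havoid : ZAvoids I C) (hex : ∃ γ, IsPathTo C γ) {j : ℤ} (hj : turns (L C) = j) :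
    HasNumber I C (-σ * j) := by
  refine ⟨hex, fun γ hγ M => ?_⟩
  have hreg := hγ.mem_of_forall domainD_subset_regular hC
  have key : ∀ z w, IsZCurve γ z w → ∃ φ ψ : unitInterval → ℂ,
      (∀ r, z r ≠ 0 ∧ z r ≠ 1) ∧ (∀ r, w r ≠ 0 ∧ w r ≠ 1) ∧ Continuous φ ∧ Continuous ψ ∧
      (∀ r, Complex.exp (φ r) = g (z r)) ∧ (∀ r, Complex.exp (ψ r) = g (w r)) ∧
      z 0 ∉ onReal I ∧ w 0 ∉ onReal I ∧ z 1 ∉ onReal I ∧ w 1 ∉ onReal I ∧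
      (⌊turns (φ 1)⌋ - ⌊turns (φ 0)⌋) + (⌊turns (ψ 1)⌋ - ⌊turns (ψ 0)⌋) = j := by
    intro z w hzw
    have hz01 : ∀ r, z r ≠ 0 ∧ z r ≠ 1 := fun r =>
      ⟨(hzw.pair r).ne_zero (hreg r), (hzw.pair r).ne_one (hreg r)⟩
    have hw01 : ∀ r, w r ≠ 0 ∧ w r ≠ 1 := fun r =>
      ⟨(hzw.pair r).swap.ne_zero (hreg r), (hzw.pair r).swap.ne_one (hreg r)⟩
    have hgz : ∀ r, g (z r) ≠ 0 := fun r => hg.ne_zero _ (hz01 r).1 (hz01 r).2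
    have hgw : ∀ r, g (w r) ≠ 0 := fun r => hg.ne_zero _ (hw01 r).1 (hw01 r).2
    obtain ⟨φ, hφ, hφe, hφ0⟩ := exists_log_curve (f := fun r => g (z r))
      (hg.continuousOn.comp_continuous hzw.continuous_z hz01) hgz (Complex.exp_log (hgz 0))
    obtain ⟨ψ, hψ, hψe, hψ0⟩ := exists_log_curve (f := fun r => g (w r))
      (hg.continuousOn.comp_continuous hzw.continuous_w hw01) hgw (Complex.exp_log (hgw 0))
    have him := hzw.start_im_pos hγ
    have hst := hzw.start_eq_star hγ
    have hz0 : z 0 ∉ onReal I := fun h => him.ne' h.1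
    have hw0 : w 0 ∉ onReal I := fun h => him.ne' (by
      have := h.1
      rw [hst] at this
      simpa using this)
    have hpair1 := hzw.pair_one hγ
    obtain ⟨hz1, hw1⟩ := havoid _ _ hpair1
    have hgim : (g (z 0)).im ≠ 0 := fun h => by
      have := (hg.upper _ (hz01 0).1 (hz01 0).2).1 him
      rw [h, mul_zero] at this
      exact lt_irrefl _ this
    have hlog : Complex.log (g (w 0)) = star (Complex.log (g (z 0))) := by
      rw [hst, hg.star_comm]
      exact Complex.log_conj _ fun h => hgim ((Complex.arg_eq_pi_iff.1 h).2)
    -- the phases add up to a real logarithm at the start, as `w 0` is the conjugate of `z 0`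
    have hsum : (fun r => φ r + ψ r) = fun r => L (γ r) := by
      refine log_curve_unique (hφ.add hψ) (hLc.comp_continuous hγ.continuous hreg) (fun r => ?_) ?_
      · rw [Complex.exp_add, hφe, hψe, hLexp _ (hreg r) _ _ (hzw.pair r)]
      · refine eq_of_exp_eq_of_im_eq_zero ?_ ?_ (hLE _ hγ.start.1)
        · rw [Complex.exp_add, hφe, hψe, hLexp _ (hreg 0) _ _ (hzw.pair 0)]
        · rw [hφ0, hψ0, hlog]; simp
    have hturn : ∀ r, turns (φ r) + turns (ψ r) = turns (L (γ r)) := fun r => by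
      rw [← congrFun hsum r]
      simp only [turns, Complex.add_im]
      ring
    have hnot : ∀ r, z r ∉ onReal I → ∀ k : ℤ, turns (φ r) ≠ k := fun r hr k hk => by
      rw [hg.mem_iff _ (hz01 r).1 (hz01 r).2, ← hφe, exp_pos_iff] at hr
      exact hr ⟨k, hk⟩
    have e0 := floor_add_floor (j := 0) (by
      rw [hturn 0, turns, hLE _ hγ.start.1]; simp) (hnot 0 hz0)
    have e1 := floor_add_floor (j := j) (by rw [hturn 1, hγ.finish, hj]) (hnot 1 hz1)
    exact ⟨φ, ψ, hz01, hw01, hφ, hψ, hφe, hψe, hz0, hw0, hz1, hw1, by omega⟩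
  constructor
  · rintro ⟨z, w, n, n', hzw, hn, hn', rfl⟩
    obtain ⟨φ, ψ, hz01, hw01, hφ, hψ, hφe, hψe, -, -, -, -, hsum⟩ := key z w hzw
    rw [hg.eq_of_hasSignedCrossings hz01 hφ hφe hn, hg.eq_of_hasSignedCrossings hw01 hψ hψe hn',
      ← mul_add, hsum]
  · rintro rfl
    obtain ⟨z, w, hzw⟩ := hγ.exists_isZCurve hC
    obtain ⟨φ, ψ, hz01, hw01, hφ, hψ, hφe, hψe, hz0, hw0, hz1, hw1, hsum⟩ := key z w hzw
    obtain ⟨n, hn⟩ := hg.exists_hasSignedCrossings hz01 hφ hφe hz0 hz1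
    obtain ⟨n', hn'⟩ := hg.exists_hasSignedCrossings hw01 hψ hψe hw0 hw1
    refine ⟨z, w, n, n', hzw, hn, hn', ?_⟩
    rw [hg.eq_of_hasSignedCrossings hz01 hφ hφe hn, hg.eq_of_hasSignedCrossings hw01 hψ hψe hn',
      ← mul_add, hsum]

/-! ### Existence of admissible paths -/

/-- The discriminant of the quadratic equation for `z, z̄`, cleared of denominators. -/
noncomputable def heron (C : Config d) : ℂ :=
  4 * (sqDist C 0 1 * sqDist C 2 3) * (sqDist C 0 2 * sqDist C 1 3) -
    (sqDist C 0 2 * sqDist C 1 3 + sqDist C 0 1 * sqDist C 2 3 - sqDist C 0 3 * sqDist C 1 2) ^ 2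

lemma mem_branchLocus_iff {C : Config d} (hC : C ∈ regular d) :
    C ∈ branchLocus d ↔ heron C = 0 := by
  have h1 := hC.2 0 2 (by decide)
  have h2 := hC.2 1 3 (by decide)
  have h3 : heron C = (4 * crossU C - (1 + crossU C - crossV C) ^ 2) *
      (sqDist C 0 2 * sqDist C 1 3) ^ 2 := by
    unfold heron crossU crossV
    field_simp
  rw [h3, mul_eq_zero, or_iff_left (pow_ne_zero 2 (mul_ne_zero h1 h2))]
  rfl

/-- The discriminant along the complex line `s ↦ τ + s β` of times, as a polynomial. -/
noncomputable def heronPoly (τ β : Fin 4 → ℂ) (x : Fin 4 → Space d) : Polynomial ℂ :=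
  let q : Fin 4 → Fin 4 → Polynomial ℂ := fun i j =>
    (Polynomial.C (τ i - τ j) + Polynomial.X * Polynomial.C (β i - β j)) ^ 2 +
      Polynomial.C ((‖x i - x j‖ ^ 2 : ℝ) : ℂ)
  Polynomial.C 4 * (q 0 1 * q 2 3) * (q 0 2 * q 1 3) -
    (q 0 2 * q 1 3 + q 0 1 * q 2 3 - q 0 3 * q 1 2) ^ 2

lemma eval_heronPoly (τ β : Fin 4 → ℂ) (x : Fin 4 → Space d) (s : ℂ) :
    (heronPoly τ β x).eval s = heron ((fun k => τ k + s * β k, x) : Config d) := by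
  have h : ∀ i j, sqDist ((fun k => τ k + s * β k, x) : Config d) i j =
      (τ i - τ j + s * (β i - β j)) ^ 2 + ((‖x i - x j‖ ^ 2 : ℝ) : ℂ) := by
    intro i j; unfold sqDist; ring
  simp only [heronPoly, heron, h, Polynomial.eval_sub, Polynomial.eval_mul, Polynomial.eval_add,
    Polynomial.eval_pow, Polynomial.eval_C, Polynomial.eval_X]

/-- Among the curves `A + i η B` with different `η`, each point with `B > 0` lies on at most one;
hence some curve with arbitrarily small `η` avoids the zeros of a given polynomial. -/
lemma exists_avoiding_curve {p : Polynomial ℂ} (hp : p ≠ 0) {A B : ℝ → ℝ}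
    (hA : InjOn A (Ioo 0 1)) (hB : ∀ r ∈ Ioo (0 : ℝ) 1, 0 < B r) {η₀ : ℝ} (hη₀ : 0 < η₀) :
    ∃ η ∈ Ioo 0 η₀, ∀ r ∈ Ioo (0 : ℝ) 1, p.eval ((A r : ℂ) + Complex.I * (η * B r : ℝ)) ≠ 0 := by
  have hfin : (⋃ ζ ∈ {ζ | p.IsRoot ζ},
      {η : ℝ | ∃ r ∈ Ioo (0 : ℝ) 1, (A r : ℂ) + Complex.I * (η * B r : ℝ) = ζ}).Finite := by
    refine (Polynomial.finite_setOfPred_isRoot hp).biUnion fun ζ _ => Set.Subsingleton.finite ?_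
    rintro η ⟨r, hr, h⟩ η' ⟨r', hr', h'⟩
    have h2 := h.trans h'.symm
    have hre := congrArg Complex.re h2
    have him := congrArg Complex.im h2
    simp only [Complex.add_re, Complex.ofReal_re, Complex.I_mul_re, Complex.ofReal_im, neg_zero,
      add_zero] at hre
    simp only [Complex.add_im, Complex.ofReal_re, Complex.I_mul_im, Complex.ofReal_im,
      zero_add] at him
    obtain rfl := hA hr hr' hre
    exact mul_right_cancel₀ (hB r hr).ne' him
  obtain ⟨η, hη, hη'⟩ := ((Ioo_infinite hη₀).sdiff hfin).nonempty
  refine ⟨η, hη, fun r hr h0 => hη' ?_⟩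
  exact mem_biUnion (show _ ∈ {ζ | p.IsRoot ζ} from h0) ⟨r, hr, rfl⟩

/-- Time differences `α`, `β` can be chosen so that three points of `ℝ × V` with spatial differences
`p`, `q`, not both zero, are not on a line; the Gram determinant is then positive. -/
lemma exists_gram_pos {V : Type*} [NormedAddCommGroup V] [InnerProductSpace ℝ V] {p q : V}
    (h : p ≠ 0 ∨ q ≠ 0) : ∃ α β : ℝ, 0 < α ∧ 0 < β ∧
      0 < 4 * (α ^ 2 + ‖p‖ ^ 2) * ((α + β) ^ 2 + ‖p + q‖ ^ 2) -
        ((α + β) ^ 2 + ‖p + q‖ ^ 2 + (α ^ 2 + ‖p‖ ^ 2) - (β ^ 2 + ‖q‖ ^ 2)) ^ 2 := by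
  obtain ⟨α, β, hα, hβ, hne⟩ : ∃ α β : ℝ, 0 < α ∧ 0 < β ∧ α • q - β • p ≠ 0 := by
    by_cases h1 : (1 : ℝ) • q - (1 : ℝ) • p = 0
    · refine ⟨1, 2, one_pos, two_pos, fun h2 => ?_⟩
      have hp : p = 0 := by
        have h3 : p = ((1 : ℝ) • q - (1 : ℝ) • p) - ((1 : ℝ) • q - (2 : ℝ) • p) := by module
        rw [h3, h1, h2, sub_zero]
      have hq : q = 0 := by simpa [hp] using h1
      exact h.elim (· hp) (· hq)
    · exact ⟨1, 1, one_pos, one_pos, h1⟩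
  refine ⟨α, β, hα, hβ, ?_⟩
  have e1 := norm_add_sq_real p q
  have e2 := norm_sub_sq_real (α • q) (β • p)
  rw [norm_smul, norm_smul, real_inner_smul_left, real_inner_smul_right, real_inner_comm,
    mul_pow, mul_pow, Real.norm_eq_abs, Real.norm_eq_abs, sq_abs, sq_abs] at e2
  have e3 : 0 < ‖α • q - β • p‖ ^ 2 := by positivity
  have e4 : (inner ℝ p q : ℝ) ^ 2 ≤ ‖p‖ ^ 2 * ‖q‖ ^ 2 := by
    rw [← mul_pow, ← sq_abs]
    exact pow_le_pow_left₀ (abs_nonneg _) (abs_real_inner_le_norm p q) 2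
  rw [e1]
  nlinarith

lemma heron_ofReal (e : Fin 4 → ℝ) (x : Fin 4 → Space d) (D : Fin 4 → Fin 4 → ℝ)
    (hD : ∀ i j, D i j = (e i - e j) ^ 2 + ‖x i - x j‖ ^ 2) :
    heron (euclid e x) = ((4 * (D 0 1 * D 2 3) * (D 0 2 * D 1 3) -
      (D 0 2 * D 1 3 + D 0 1 * D 2 3 - D 0 3 * D 1 2) ^ 2 : ℝ) : ℂ) := by
  have h : ∀ i j, sqDist (euclid e x) i j = (D i j : ℂ) := by
    intro i j; rw [hD]; simp [sqDist, euclid]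
  simp only [heron, h]
  push_cast
  ring

/-- If `𝐱_1, 𝐱_2, 𝐱_3` are not all equal, three of the points can be taken off a common line, and
then the fourth one, far away, is not on a circle with them. -/
lemma exists_times_aux {x : Fin 4 → Space d} (hx : x 0 - x 1 ≠ 0 ∨ x 1 - x 2 ≠ 0) :
    ∃ e : Fin 4 → ℝ, StrictAnti e ∧ heron (euclid e x) ≠ 0 := by
  obtain ⟨α, β, hα, hβ, hK⟩ := exists_gram_pos hx
  rw [sub_add_sub_cancel] at hK
  set a := α ^ 2 + ‖x 0 - x 1‖ ^ 2 with ha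
  set b := (α + β) ^ 2 + ‖x 0 - x 2‖ ^ 2 with hb
  set c := β ^ 2 + ‖x 1 - x 2‖ ^ 2 with hc
  -- `H δ = δ ^ 4 * heron` for the fourth time `-δ⁻¹`
  let H : ℝ → ℝ := fun δ =>
    4 * (a * (1 + δ ^ 2 * ‖x 2 - x 3‖ ^ 2)) * (b * ((δ * β + 1) ^ 2 + δ ^ 2 * ‖x 1 - x 3‖ ^ 2)) -
      (b * ((δ * β + 1) ^ 2 + δ ^ 2 * ‖x 1 - x 3‖ ^ 2) + a * (1 + δ ^ 2 * ‖x 2 - x 3‖ ^ 2) -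
        ((δ * (α + β) + 1) ^ 2 + δ ^ 2 * ‖x 0 - x 3‖ ^ 2) * c) ^ 2
  have hH : Continuous H := by fun_prop
  have hH0 : 0 < H 0 := by
    have : H 0 = 4 * a * b - (b + a - c) ^ 2 := by simp only [H]; ring
    rw [this]; exact hK
  have hev : ∀ᶠ δ in 𝓝[>] (0 : ℝ), 0 < H δ :=
    (hH.continuousAt.eventually (lt_mem_nhds hH0)).filter_mono nhdsWithin_le_nhds
  obtain ⟨δ, hδH, hδ⟩ := (hev.and self_mem_nhdsWithin).exists
  have hδ : 0 < δ := hδ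
  refine ⟨![α + β, β, 0, -δ⁻¹], ?_, ?_⟩
  · rw [Fin.strictAnti_iff_succ_lt]
    intro i
    have := inv_pos.2 hδ
    fin_cases i <;> simp <;> linarith
  · rw [heron_ofReal _ _ _ fun _ _ => rfl, Complex.ofReal_ne_zero]
    have hm : δ * δ⁻¹ = 1 := mul_inv_cancel₀ hδ.ne'
    have hne : δ ≠ 0 := hδ.ne'
    intro h0
    refine hδH.ne' ?_
    rw [show H δ = δ ^ 4 * 0 by
      rw [← h0]
      simp only [H, ha, hb, hc, Matrix.cons_val]
      field_simp
      ring, mul_zero]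

lemma heron_rev (e : Fin 4 → ℝ) (x : Fin 4 → Space d) :
    heron (euclid (fun k => -e k.rev) x) = heron (euclid e (fun k => x k.rev)) := by
  set D : Fin 4 → Fin 4 → ℝ := fun i j => (e i - e j) ^ 2 + ‖x i.rev - x j.rev‖ ^ 2 with hD
  have hsymm : ∀ i j, D i j = D j i := fun i j => by
    simp only [hD]
    rw [norm_sub_rev]
    ring
  rw [heron_ofReal _ _ (fun i j => D i.rev j.rev) fun i j => by
    simp only [hD, Fin.rev_rev]; ring, heron_ofReal e _ D fun i j => rfl]
  change ((4 * (D 3 2 * D 1 0) * (D 3 1 * D 2 0) -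
    (D 3 1 * D 2 0 + D 3 2 * D 1 0 - D 3 0 * D 2 1) ^ 2 : ℝ) : ℂ) = _
  rw [hsymm 3 2, hsymm 1 0, hsymm 3 1, hsymm 2 0, hsymm 3 0, hsymm 2 1]
  congr 1
  ring

lemma exists_times {x : Fin 4 → Space d} (hx : ∃ k, x k ≠ x 0) :
    ∃ e : Fin 4 → ℝ, StrictAnti e ∧ heron (euclid e x) ≠ 0 := by
  by_cases h : x 0 - x 1 ≠ 0 ∨ x 1 - x 2 ≠ 0
  · exact exists_times_aux h
  push Not at h
  have h01 := sub_eq_zero.1 h.1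
  have h12 := sub_eq_zero.1 h.2
  have h3 : x 3 ≠ x 0 := by
    obtain ⟨k, hk⟩ := hx
    fin_cases k
    · exact absurd rfl hk
    · exact absurd h01.symm hk
    · exact absurd (h01.trans h12).symm hk
    · exact hk
  obtain ⟨e, he, hne⟩ := exists_times_aux (x := fun k => x k.rev)
    (Or.inl (sub_ne_zero.2 (by
      change x 3 ≠ x 2
      rw [← h12, ← h01]; exact h3)))
  refine ⟨fun k => -e k.rev, fun i j hij => ?_, by rwa [heron_rev]⟩
  exact neg_lt_neg (he (Fin.rev_lt_rev.2 hij))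

lemma euclid_mem_domainE {e : Fin 4 → ℝ} (he : StrictAnti e) (x : Fin 4 → Space d) :
    euclid e x ∈ domainE d :=
  ⟨fun i j hij => by simpa [euclid] using he hij, fun k => by simp [euclid]⟩

/-- The times of the paths below stay ordered. -/
lemma exists_ordered_bound {e : Fin 4 → ℝ} (he : StrictAnti e) {τ : Fin 4 → ℂ}
    (hτ : ∀ k, (τ k).re = 0) : ∃ η₀ > 0, ∀ η ∈ Ioo 0 η₀, ∀ r ∈ Ico (0 : ℝ) 1, ∀ c : ℂ,
      c.re = 1 - r →
      (fun k => c * e k + (r + Complex.I * (η * (r * (1 - r)) : ℝ)) * τ k) ∈ orderedTimes := by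
  have hcont : Continuous fun η : ℝ => fun k => ((e k - η * (τ k).im : ℝ) : ℂ) := by fun_prop
  obtain ⟨η₀, hη₀, hball⟩ := Metric.eventually_nhds_iff_ball.1
    ((hcont.continuousAt (x := 0)).eventually (isOpen_orderedTimes.mem_nhds (by
      intro i j hij
      simpa using he hij)))
  refine ⟨η₀, hη₀, fun η hη r hr c hc i j hij => ?_⟩
  have h1 := hball (η * r) (by
    rw [Metric.mem_ball, dist_zero_right, Real.norm_eq_abs, abs_of_nonneg
      (mul_nonneg hη.1.le hr.1)]
    nlinarith [hη.1, hη.2, hr.1, hr.2])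
  have h2 : e j - η * r * (τ j).im < e i - η * r * (τ i).im := by simpa using h1 hij
  have h3 : ∀ k, (c * e k + (r + Complex.I * (η * (r * (1 - r)) : ℝ)) * τ k).re =
      (1 - r) * (e k - η * r * (τ k).im) := by
    intro k
    simp [hτ, hc]
    ring
  simp only [h3]
  exact mul_lt_mul_of_pos_left h2 (by linarith [hr.2])

/-- If the spatial vectors are not all equal, they can be kept fixed, while the times follow a
complex line from a Euclidean configuration. -/
lemma exists_isPathTo_of_ne {C : Config d} (hC : C ∈ lorentz d) (hx : ∃ k, C.2 k ≠ C.2 0) :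
    ∃ γ, IsPathTo C γ := by
  obtain ⟨e, he, hne⟩ := exists_times hx
  obtain ⟨η₀, hη₀, hord⟩ := exists_ordered_bound he hC.2.1
  have heval : ∀ s, (heronPoly (fun k => (e k : ℂ)) (fun k => C.1 k - e k) C.2).eval s =
      heron ((fun k => (1 - s) * e k + s * C.1 k, C.2) : Config d) := fun s => by
    rw [eval_heronPoly]
    congr 2
    funext k
    ring
  have hp0 : heronPoly (fun k => (e k : ℂ)) (fun k => C.1 k - e k) C.2 ≠ 0 := fun h0 => by
    have := heval 0
    rw [h0, Polynomial.eval_zero] at this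
    refine hne (this.trans ?_).symm
    congr 2
    funext k
    simp
  obtain ⟨η, hη, hav⟩ := exists_avoiding_curve hp0 (A := id) (B := fun r => r * (1 - r))
    (injOn_id _) (fun r hr => mul_pos hr.1 (sub_pos.2 hr.2)) hη₀
  set s : ℝ → ℂ := fun r => r + Complex.I * (η * (r * (1 - r)) : ℝ) with hs
  have hscont : Continuous s := by fun_prop
  set γ : unitInterval → Config d := fun r =>
    (fun k => (1 - s r) * e k + s r * C.1 k, C.2) with hγ
  have hmem : ∀ r : unitInterval, r < 1 → γ r ∈ domainD d := fun r hr =>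
    hord η hη r ⟨r.2.1, hr⟩ (1 - s r) (by simp [hs])
  have hfin : γ 1 = C := by
    refine Prod.ext (funext fun k => ?_) rfl
    simp [hγ, hs]
  have hst : γ 0 = euclid e C.2 := by
    refine Prod.ext (funext fun k => ?_) rfl
    simp [hγ, hs, euclid]
  have hherm : ∀ r : unitInterval, r < 1 → heron (γ r) ≠ 0 := fun r hr => by
    rcases r.2.1.eq_or_lt with h0 | h0
    · have : r = 0 := Subtype.ext h0.symm
      rw [this, hst]; exact hne
    · have := hav r ⟨h0, hr⟩
      rwa [heval] at this
  refine ⟨γ, ⟨?_, fun r => ?_, ?_, fun r hr => ?_, hfin⟩⟩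
  · have : Continuous fun r : unitInterval => s r := hscont.comp continuous_subtype_val
    fun_prop
  · rcases unitInterval.le_one' (t := r) |>.lt_or_eq with hr | rfl
    · exact subset_closure (hmem r hr)
    · rw [hfin]; exact frontier_subset_closure hC.1
  · refine ⟨hst ▸ euclid_mem_domainE he C.2, fun h => ?_⟩
    rw [mem_branchLocus_iff (domainD_subset_regular (hmem 0 (by simp)))] at h
    exact hherm 0 (by simp) h
  · refine ⟨hmem r hr, fun h => ?_⟩
    rw [mem_branchLocus_iff (domainD_subset_regular (hmem r hr))] at h
    exact hherm r hr h

lemma heron_smul {C C' : Config d} {c : ℂ} (h : ∀ i j, sqDist C i j = c * sqDist C' i j) :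
    heron C = c ^ 4 * heron C' := by
  simp only [heron, h]
  ring

/-- If the spatial vectors are all equal, the Euclidean configurations with these spatial vectors
are all on `Γ`. The path then contracts some other spatial vectors to a point; up to the scaling by
`1 - r` it runs in a family with fixed spatial vectors, with `r / (1 - r)` as parameter. -/
lemma exists_isPathTo_of_eq (hd : 2 ≤ d) {C : Config d} (hC : C ∈ lorentz d)
    (hx : ∀ k, C.2 k = C.2 0) : ∃ γ, IsPathTo C γ := by
  obtain ⟨v, hv⟩ : ∃ v : Space d, v ≠ 0 := by
    refine ⟨EuclideanSpace.single ⟨0, by omega⟩ 1, fun h => ?_⟩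
    have := congrArg norm h
    simp at this
  set y : Fin 4 → Space d := fun k => if k = 0 then 0 else v with hy
  obtain ⟨e, he, hne⟩ := exists_times (x := y) ⟨1, by simpa [hy] using hv⟩
  obtain ⟨η₀, hη₀, hord⟩ := exists_ordered_bound he hC.2.1
  have hp0 : heronPoly (fun k => (e k : ℂ)) C.1 y ≠ 0 := fun h0 => by
    have := eval_heronPoly (fun k => (e k : ℂ)) C.1 y 0
    rw [h0, Polynomial.eval_zero] at this
    refine hne (this.trans ?_).symm
    congr 2
    funext k
    simp
  obtain ⟨η, hη, hav⟩ := exists_avoiding_curve hp0 (A := fun r => r / (1 - r)) (B := fun r => r)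
    (by
      intro r hr r' hr' h
      have h1 : (1 : ℝ) - r ≠ 0 := (sub_pos.2 hr.2).ne'
      have h2 : (1 : ℝ) - r' ≠ 0 := (sub_pos.2 hr'.2).ne'
      simp only at h
      rw [div_eq_div_iff h1 h2] at h
      linarith) (fun r hr => hr.1) hη₀
  set γ : unitInterval → Config d := fun r =>
    (fun k => ((1 - (r : ℝ) : ℝ) : ℂ) * e k +
      ((r : ℝ) + Complex.I * (η * ((r : ℝ) * (1 - (r : ℝ))) : ℝ)) * C.1 k,
      fun k => C.2 k + (1 - (r : ℝ)) • y k) with hγ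
  have hmem : ∀ r : unitInterval, r < 1 → γ r ∈ domainD d := fun r hr =>
    hord η hη r ⟨r.2.1, hr⟩ ((1 - (r : ℝ) : ℝ) : ℂ) (by simp)
  have hfin : γ 1 = C := by
    refine Prod.ext (funext fun k => ?_) (funext fun k => ?_) <;> simp [hγ]
  have hnorm : ∀ (r : unitInterval) (i j : Fin 4),
      ‖(γ r).2 i - (γ r).2 j‖ ^ 2 = (1 - (r : ℝ)) ^ 2 * ‖y i - y j‖ ^ 2 := by
    intro r i j
    have : (γ r).2 i - (γ r).2 j = (1 - (r : ℝ)) • (y i - y j) := by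
      simp only [hγ]
      rw [hx i, hx j]; module
    rw [this, norm_smul, mul_pow, Real.norm_eq_abs, sq_abs]
  have hscale : ∀ r : unitInterval, r < 1 → ∀ i j, sqDist (γ r) i j =
      ((1 - (r : ℝ) : ℝ) : ℂ) ^ 2 * sqDist ((fun k => (e k : ℂ) + (((r : ℝ) / (1 - (r : ℝ)) : ℝ) +
        Complex.I * (η * (r : ℝ) : ℝ)) * C.1 k, y) : Config d) i j := by
    intro r hr i j
    have h1 : ((1 - (r : ℝ) : ℝ) : ℂ) ≠ 0 :=
      Complex.ofReal_ne_zero.2 (sub_pos.2 (show (r : ℝ) < 1 from hr)).ne'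
    unfold sqDist
    rw [hnorm]
    simp only [hγ]
    push_cast at h1 ⊢
    field_simp
  have hherm : ∀ r : unitInterval, r < 1 → heron (γ r) ≠ 0 := fun r hr => by
    rw [heron_smul (hscale r hr)]
    refine mul_ne_zero (pow_ne_zero _ (pow_ne_zero _
      (Complex.ofReal_ne_zero.2 (sub_pos.2 (show (r : ℝ) < 1 from hr)).ne'))) ?_
    rcases r.2.1.eq_or_lt with h0 | h0
    · have h0' : (r : ℝ) = 0 := h0.symm
      simp only [h0']
      convert hne using 2
      unfold euclid
      congr 1
      funext k
      simp
    · have := hav r ⟨h0, hr⟩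
      rwa [eval_heronPoly] at this
  refine ⟨γ, ⟨?_, fun r => ?_, ?_, fun r hr => ?_, hfin⟩⟩
  · fun_prop
  · rcases unitInterval.le_one' (t := r) |>.lt_or_eq with hr | rfl
    · exact subset_closure (hmem r hr)
    · rw [hfin]; exact frontier_subset_closure hC.1
  · refine ⟨⟨hmem 0 (by simp), fun k => by simp [hγ]⟩, fun h => ?_⟩
    rw [mem_branchLocus_iff (domainD_subset_regular (hmem 0 (by simp)))] at h
    exact hherm 0 (by simp) h
  · refine ⟨hmem r hr, fun h => ?_⟩
    rw [mem_branchLocus_iff (domainD_subset_regular (hmem r hr))] at h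
    exact hherm r hr h

theorem exists_isPathTo (hd : 2 ≤ d) {C : Config d} (hC : C ∈ lorentz d) : ∃ γ, IsPathTo C γ := by
  by_cases hx : ∀ k, C.2 k = C.2 0
  · exact exists_isPathTo_of_eq hd hC hx
  · exact exists_isPathTo_of_ne hC (by push Not at hx; exact hx)

/-! ### Phases of the cross-ratios at Lorentzian configurations -/

lemma log_I_mul_im_of_pos {a : ℝ} (ha : 0 < a) : (Complex.log (Complex.I * a)).im = Real.pi / 2 := by
  rw [Complex.log_im, Complex.arg_eq_pi_div_two_iff]
  simpa using ha

lemma log_I_mul_im_of_neg {a : ℝ} (ha : a < 0) :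
    (Complex.log (Complex.I * a)).im = -(Real.pi / 2) := by
  rw [Complex.log_im, Complex.arg_eq_neg_pi_div_two_iff]
  simpa using ha

lemma lorentz_sub_eq {C : Config d} (hC : C ∈ lorentz d) (i j : Fin 4) :
    C.1 i - C.1 j = Complex.I * ((C.1 i).im - (C.1 j).im : ℝ) := by
  apply Complex.ext <;> simp [hC.2.1]

lemma sqDist_eq_ofReal {C : Config d} (hC : C ∈ lorentz d) (i j : Fin 4) :
    sqDist C i j = ((‖C.2 i - C.2 j‖ ^ 2 - ((C.1 i).im - (C.1 j).im) ^ 2 : ℝ) : ℂ) := by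
  unfold sqDist
  rw [lorentz_sub_eq hC, mul_pow, Complex.I_sq]
  push_cast
  ring

open Classical in
/-- The phase of `x_{ij}²` at a Lorentzian configuration is determined by the causal relation of
the two points. -/
lemma logSq_im_of_mem_lorentz {C : Config d} (hC : C ∈ lorentz d) {i j : Fin 4} (hij : i ≠ j) :
    (logSq C i j).im =
      if Precedes C j i then Real.pi else if Precedes C i j then -Real.pi else 0 := by
  have hne := hC.2.2 i j hij
  rw [sqDist_eq_ofReal hC, Complex.ofReal_ne_zero] at hne
  have hlog : logSq C i j =
      Complex.log (Complex.I * (((C.1 i).im - (C.1 j).im + ‖C.2 i - C.2 j‖ : ℝ) : ℂ)) +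
      Complex.log (Complex.I * (((C.1 i).im - (C.1 j).im - ‖C.2 i - C.2 j‖ : ℝ) : ℂ)) := by
    unfold logSq
    rw [lorentz_sub_eq hC]
    congr 2 <;> · push_cast; ring
  rw [hlog, Complex.add_im]
  unfold Precedes
  rw [norm_sub_rev (C.2 j)]
  have hr := norm_nonneg (C.2 i - C.2 j)
  generalize ‖C.2 i - C.2 j‖ = r at hne hr ⊢
  generalize ht : (C.1 i).im - (C.1 j).im = t at hne ⊢
  have ht' : (C.1 j).im - (C.1 i).im = -t := by rw [← ht]; ring
  rw [ht']
  split_ifs with h1 h2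
  · rw [log_I_mul_im_of_pos (by linarith), log_I_mul_im_of_pos (by linarith)]
    ring
  · rw [log_I_mul_im_of_neg (by linarith), log_I_mul_im_of_neg (by linarith)]
    ring
  · have h3 : t ≠ r := fun h => hne (by rw [h]; ring)
    have h4 : -t ≠ r := fun h => hne (by rw [← h]; ring)
    have h5 := lt_of_le_of_ne (not_lt.1 h1) h3
    have h6 := lt_of_le_of_ne (not_lt.1 h2) h4
    rw [log_I_mul_im_of_pos (by linarith), log_I_mul_im_of_neg (by linarith)]
    ring

lemma logSq_im_congr {α : Fin 4 → Fin 4 → Prop} {C C' : Config d} (hC : C ∈ lorentzOrd d α)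
    (hC' : C' ∈ lorentzOrd d α) {i j : Fin 4} (hij : i ≠ j) :
    (logSq C i j).im = (logSq C' i j).im := by
  classical
  rw [logSq_im_of_mem_lorentz hC.1 hij, logSq_im_of_mem_lorentz hC'.1 hij]
  simp only [hC.2, hC'.2]

lemma logU_im_congr {α : Fin 4 → Fin 4 → Prop} {C C' : Config d} (hC : C ∈ lorentzOrd d α)
    (hC' : C' ∈ lorentzOrd d α) : (logU C).im = (logU C').im := by
  simp only [logU, Complex.add_im, Complex.sub_im]
  rw [logSq_im_congr hC hC' (i := 0) (j := 1) (by decide),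
    logSq_im_congr hC hC' (i := 2) (j := 3) (by decide),
    logSq_im_congr hC hC' (i := 0) (j := 2) (by decide),
    logSq_im_congr hC hC' (i := 1) (j := 3) (by decide)]

lemma logV_im_congr {α : Fin 4 → Fin 4 → Prop} {C C' : Config d} (hC : C ∈ lorentzOrd d α)
    (hC' : C' ∈ lorentzOrd d α) : (logV C).im = (logV C').im := by
  simp only [logV, Complex.add_im, Complex.sub_im]
  rw [logSq_im_congr hC hC' (i := 0) (j := 3) (by decide),
    logSq_im_congr hC hC' (i := 1) (j := 2) (by decide),
    logSq_im_congr hC hC' (i := 0) (j := 2) (by decide),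
    logSq_im_congr hC hC' (i := 1) (j := 3) (by decide)]

lemma crossU_re_pos_congr {α : Fin 4 → Fin 4 → Prop} {C C' : Config d} (hC : C ∈ lorentzOrd d α)
    (hC' : C' ∈ lorentzOrd d α) : 0 < (crossU C).re ↔ 0 < (crossU C').re := by
  rw [← exp_logU (lorentz_subset_regular hC.1), ← exp_logU (lorentz_subset_regular hC'.1),
    Complex.exp_re, Complex.exp_re, logU_im_congr hC hC', mul_pos_iff_of_pos_left (Real.exp_pos _),
    mul_pos_iff_of_pos_left (Real.exp_pos _)]

lemma crossV_re_pos_congr {α : Fin 4 → Fin 4 → Prop} {C C' : Config d} (hC : C ∈ lorentzOrd d α)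
    (hC' : C' ∈ lorentzOrd d α) : 0 < (crossV C).re ↔ 0 < (crossV C').re := by
  rw [← exp_logV (lorentz_subset_regular hC.1), ← exp_logV (lorentz_subset_regular hC'.1),
    Complex.exp_re, Complex.exp_re, logV_im_congr hC hC', mul_pos_iff_of_pos_left (Real.exp_pos _),
    mul_pos_iff_of_pos_left (Real.exp_pos _)]

lemma crossU_eq_re {C : Config d} (hC : C ∈ lorentz d) : crossU C = ((crossU C).re : ℂ) := by
  unfold crossU
  simp only [sqDist_eq_ofReal hC, ← Complex.ofReal_mul, ← Complex.ofReal_div, Complex.ofReal_re]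

lemma crossV_eq_re {C : Config d} (hC : C ∈ lorentz d) : crossV C = ((crossV C).re : ℂ) := by
  unfold crossV
  simp only [sqDist_eq_ofReal hC, ← Complex.ofReal_mul, ← Complex.ofReal_div, Complex.ofReal_re]

/-! ### The classes of Lorentzian configurations -/

/-- At a Lorentzian configuration `z, z̄` are real or complex conjugates of each other. -/
lemma exists_real_or_star_pair {C : Config d} (hC : C ∈ lorentz d) :
    (∃ x y : ℝ, IsZPair C x y ∧ x ≠ 0 ∧ y ≠ 0 ∧ x ≠ 1 ∧ y ≠ 1) ∨
      ∃ z w : ℂ, IsZPair C z w ∧ w = star z ∧ z.im ≠ 0 := by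
  obtain ⟨z, w, h⟩ := exists_isZPair C
  have hr := lorentz_subset_regular hC
  have hu := congrArg Complex.im (crossU_eq_re hC)
  have hv := congrArg Complex.im (crossV_eq_re hC)
  rw [h.1] at hu
  rw [h.2] at hv
  simp at hu hv
  have hs : w.im = -z.im := by linarith
  rw [hs] at hu
  by_cases hz : z.im = 0
  · have e1 : z = (z.re : ℂ) := Complex.ext rfl (by simp [hz])
    have e2 : w = (w.re : ℂ) := Complex.ext rfl (by simp [hs, hz])
    refine Or.inl ⟨z.re, w.re, by rwa [← e1, ← e2], ?_⟩
    have n1 : z ≠ 0 ∧ w ≠ 0 ∧ z ≠ 1 ∧ w ≠ 1 :=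
      ⟨h.ne_zero hr, h.swap.ne_zero hr, h.ne_one hr, h.swap.ne_one hr⟩
    rw [e1, e2] at n1
    exact_mod_cast n1
  · refine Or.inr ⟨z, w, h, Complex.ext ?_ (by simpa using hs), hz⟩
    have : z.im * (w.re - z.re) = 0 := by linarith
    simpa [sub_eq_zero] using (mul_eq_zero.1 this).resolve_left hz

lemma IsZPair.re_cross {C : Config d} {x y : ℝ} (h : IsZPair C x y) :
    (crossU C).re = x * y ∧ (crossV C).re = (1 - x) * (1 - y) := by
  rw [h.1, h.2]
  exact ⟨by simp, by simp⟩

lemma IsZPair.re_cross_star {C : Config d} {z w : ℂ} (h : IsZPair C z w) (hw : w = star z)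
    (hz : z.im ≠ 0) : 0 < (crossU C).re ∧ 0 < (crossV C).re := by
  rw [h.1, h.2, hw]
  have : 0 < z.im ^ 2 := by positivity
  constructor
  · simp; nlinarith [sq_nonneg z.re]
  · simp; nlinarith [sq_nonneg (1 - z.re)]

lemma mem_class_of_mem_lorentz {C : Config d} (hC : C ∈ lorentz d) :
    (¬ 0 < (crossU C).re → 0 < (crossV C).re → C ∈ classS d) ∧
    (0 < (crossU C).re → ¬ 0 < (crossV C).re → C ∈ classT d) ∧
    (¬ 0 < (crossU C).re → ¬ 0 < (crossV C).re → C ∈ classU d) ∧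
    (0 < (crossU C).re → 0 < (crossV C).re → C ∈ classE d) := by
  rcases exists_real_or_star_pair hC with ⟨x, y, h, hx0, hy0, hx1, hy1⟩ | ⟨z, w, h, hw, hz⟩
  · rw [h.re_cross.1, h.re_cross.2]
    have hx1' : 1 - x ≠ 0 := sub_ne_zero.2 hx1.symm
    have hy1' : 1 - y ≠ 0 := sub_ne_zero.2 hy1.symm
    rw [mul_pos_iff, mul_pos_iff]
    refine ⟨fun hu hv => ⟨hC, x, y, h, ?_⟩, fun hu hv => ⟨hC, x, y, h, ?_⟩,
      fun hu hv => ⟨hC, x, y, h, ?_⟩, fun hu hv => ?_⟩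
    · grind
    · grind
    · grind
    · have : (x < 0 ∧ y < 0) ∨ (0 < x ∧ x < 1 ∧ 0 < y ∧ y < 1) ∨ (1 < x ∧ 1 < y) := by grind
      rcases this with hc | hc | hc
      · exact Or.inl (Or.inl (Or.inl ⟨hC, x, y, h, hc⟩))
      · exact Or.inl (Or.inl (Or.inr ⟨hC, x, y, h, hc⟩))
      · exact Or.inl (Or.inr ⟨hC, x, y, h, hc⟩)
  · obtain ⟨hu, hv⟩ := h.re_cross_star hw hz
    exact ⟨fun h => absurd hu h, fun _ h => absurd hv h, fun h => absurd hu h,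
      fun _ _ => Or.inr ⟨hC, z, w, h, hw, hz⟩⟩

lemma lorentzOrd_subset_class (α : Fin 4 → Fin 4 → Prop) :
    lorentzOrd d α ⊆ classS d ∨ lorentzOrd d α ⊆ classT d ∨
      lorentzOrd d α ⊆ classU d ∨ lorentzOrd d α ⊆ classE d := by
  rcases (lorentzOrd d α).eq_empty_or_nonempty with h | ⟨C, hC⟩
  · exact Or.inl (h ▸ empty_subset _)
  by_cases hu : 0 < (crossU C).re <;> by_cases hv : 0 < (crossV C).re
  · exact Or.inr (Or.inr (Or.inr fun C' hC' => (mem_class_of_mem_lorentz hC'.1).2.2.2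
      ((crossU_re_pos_congr hC hC').1 hu) ((crossV_re_pos_congr hC hC').1 hv)))
  · exact Or.inr (Or.inl fun C' hC' => (mem_class_of_mem_lorentz hC'.1).2.1
      ((crossU_re_pos_congr hC hC').1 hu) (mt (crossV_re_pos_congr hC hC').2 hv))
  · exact Or.inl fun C' hC' => (mem_class_of_mem_lorentz hC'.1).1
      (mt (crossU_re_pos_congr hC hC').2 hu) ((crossV_re_pos_congr hC hC').1 hv)
  · exact Or.inr (Or.inr (Or.inl fun C' hC' => (mem_class_of_mem_lorentz hC'.1).2.2.1
      (mt (crossU_re_pos_congr hC hC').2 hu) (mt (crossV_re_pos_congr hC hC').2 hv)))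

lemma zAvoids_iff {C : Config d} {z w : ℂ} (h : IsZPair C z w) (I : Set ℝ) :
    ZAvoids I C ↔ z ∉ onReal I ∧ w ∉ onReal I := by
  refine ⟨fun hI => hI z w h, fun hI z' w' h' => ?_⟩
  rcases h.eq_or_eq h' with ⟨rfl, rfl⟩ | ⟨rfl, rfl⟩
  · exact hI
  · exact hI.symm

lemma zAvoids_iff_of_real {C : Config d} {x y : ℝ} (h : IsZPair C x y) (I : Set ℝ) :
    ZAvoids I C ↔ x ∉ I ∧ y ∉ I := by
  simp [zAvoids_iff h, onReal]

lemma zAvoids_of_mem_classS {C : Config d} (h : C ∈ classS d) :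
    ZAvoids (Ioi 1) C ∧ ¬ ZAvoids (Iio 0) C ∧ ¬ ZAvoids (Ioo 0 1) C := by
  obtain ⟨-, x, y, h, hxy⟩ := h
  simp only [zAvoids_iff_of_real h, mem_Ioi, mem_Iio, mem_Ioo]
  grind

lemma zAvoids_of_mem_classT {C : Config d} (h : C ∈ classT d) :
    ¬ ZAvoids (Ioi 1) C ∧ ZAvoids (Iio 0) C ∧ ¬ ZAvoids (Ioo 0 1) C := by
  obtain ⟨-, x, y, h, hxy⟩ := h
  simp only [zAvoids_iff_of_real h, mem_Ioi, mem_Iio, mem_Ioo]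
  grind

lemma zAvoids_of_mem_classU {C : Config d} (h : C ∈ classU d) :
    ¬ ZAvoids (Ioi 1) C ∧ ¬ ZAvoids (Iio 0) C ∧ ZAvoids (Ioo 0 1) C := by
  obtain ⟨-, x, y, h, hxy⟩ := h
  simp only [zAvoids_iff_of_real h, mem_Ioi, mem_Iio, mem_Ioo]
  grind

lemma zAvoids_of_mem_classEst {C : Config d} (h : C ∈ classEst d) :
    ZAvoids (Ioi 1) C ∧ ZAvoids (Iio 0) C ∧ ¬ ZAvoids (Ioo 0 1) C := by
  obtain ⟨-, x, y, h, hxy⟩ := h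
  simp only [zAvoids_iff_of_real h, mem_Ioi, mem_Iio, mem_Ioo]
  grind

lemma zAvoids_of_mem_classEsu {C : Config d} (h : C ∈ classEsu d) :
    ZAvoids (Ioi 1) C ∧ ¬ ZAvoids (Iio 0) C ∧ ZAvoids (Ioo 0 1) C := by
  obtain ⟨-, x, y, h, hxy⟩ := h
  simp only [zAvoids_iff_of_real h, mem_Ioi, mem_Iio, mem_Ioo]
  grind

lemma zAvoids_of_mem_classEtu {C : Config d} (h : C ∈ classEtu d) :
    ¬ ZAvoids (Ioi 1) C ∧ ZAvoids (Iio 0) C ∧ ZAvoids (Ioo 0 1) C := by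
  obtain ⟨-, x, y, h, hxy⟩ := h
  simp only [zAvoids_iff_of_real h, mem_Ioi, mem_Iio, mem_Ioo]
  grind

lemma zAvoids_of_mem_classEstu {C : Config d} (h : C ∈ classEstu d) (I : Set ℝ) :
    ZAvoids I C := by
  obtain ⟨-, z, w, h, hw, hz⟩ := h
  rw [zAvoids_iff h, hw]
  exact ⟨fun h => hz h.1, fun h => hz (by simpa using h.1)⟩

/-! ### Crossing numbers and criteria on a causal ordering -/

lemma crossU_re_pos_of_zAvoids {C : Config d} (hC : C ∈ lorentz d) (h : ZAvoids (Iio 0) C) :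
    0 < (crossU C).re := by
  rcases exists_real_or_star_pair hC with ⟨x, y, hp, hx0, hy0, hx1, hy1⟩ | ⟨z, w, hp, hw, hz⟩
  · rw [zAvoids_iff_of_real hp, mem_Iio, mem_Iio, not_lt, not_lt] at h
    rw [hp.re_cross.1]
    exact mul_pos (h.1.lt_of_ne' hx0) (h.2.lt_of_ne' hy0)
  · exact (hp.re_cross_star hw hz).1

lemma cross_div_re_pos_of_zAvoids {C : Config d} (hC : C ∈ lorentz d) (h : ZAvoids (Ioo 0 1) C) :
    0 < (crossU C).re / (crossV C).re := by
  rcases exists_real_or_star_pair hC with ⟨x, y, hp, hx0, hy0, hx1, hy1⟩ | ⟨z, w, hp, hw, hz⟩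
  · rw [zAvoids_iff_of_real hp, mem_Ioo, mem_Ioo] at h
    rw [hp.re_cross.1, hp.re_cross.2, mul_div_mul_comm]
    have key : ∀ s : ℝ, s ≠ 0 → s ≠ 1 → ¬ (0 < s ∧ s < 1) → s / (1 - s) < 0 := by
      intro s h0 h1 hs
      rcases lt_or_gt_of_ne h0 with h' | h'
      · exact div_neg_of_neg_of_pos h' (by linarith)
      · have : 1 < s := lt_of_le_of_ne (not_lt.1 fun h2 => hs ⟨h', h2⟩) h1.symm
        exact div_neg_of_pos_of_neg h' (by linarith)
    exact mul_pos_of_neg_of_neg (key x hx0 hx1 h.1) (key y hy0 hy1 h.2)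
  · exact div_pos (hp.re_cross_star hw hz).1 (hp.re_cross_star hw hz).2

lemma exists_turns_logU {C : Config d} (hC : C ∈ lorentz d) (h : ZAvoids (Iio 0) C) :
    ∃ j : ℤ, turns (logU C) = j := by
  rw [← exp_pos_iff, exp_logU (lorentz_subset_regular hC)]
  refine ⟨?_, crossU_re_pos_of_zAvoids hC h⟩
  rw [crossU_eq_re hC, Complex.ofReal_im]

lemma exists_turns_logU_sub_logV {C : Config d} (hC : C ∈ lorentz d) (h : ZAvoids (Ioo 0 1) C) :
    ∃ j : ℤ, turns (logU C - logV C) = j := by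
  rw [← exp_pos_iff, Complex.exp_sub, exp_logU (lorentz_subset_regular hC),
    exp_logV (lorentz_subset_regular hC), crossU_eq_re hC, crossV_eq_re hC, ← Complex.ofReal_div]
  exact ⟨Complex.ofReal_im _, by simpa using cross_div_re_pos_of_zAvoids hC h⟩

/-- `N_t` is the number of turns of `log u`, a function of the causal ordering. -/
theorem exists_forall_hasNt (hd : 2 ≤ d) (α : Fin 4 → Fin 4 → Prop) :
    ∃ N : ℤ, ∀ C ∈ lorentzOrd d α, ZAvoids (Iio 0) C → HasNt C N := by
  by_cases hex : ∃ C ∈ lorentzOrd d α, ZAvoids (Iio 0) C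
  · obtain ⟨C₀, hC₀, h₀⟩ := hex
    obtain ⟨j, hj⟩ := exists_turns_logU hC₀.1 h₀
    refine ⟨-(-1) * j, fun C hC h => isCrossingChart_neg.hasNumber continuousOn_logU ?_ ?_
      (lorentz_subset_regular hC.1) h (exists_isPathTo hd hC.1) ?_⟩
    · intro C hC z w hp
      rw [exp_logU hC, hp.1]
      ring
    · exact fun C hC => logU_im_eq_zero hC
    · rw [← hj, turns, turns, logU_im_congr hC hC₀]
  · exact ⟨0, fun C hC h => absurd ⟨C, hC, h⟩ hex⟩

/-- `-N_u` is the number of turns of `log u - log v`, a function of the causal ordering. -/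
theorem exists_forall_hasNu (hd : 2 ≤ d) (α : Fin 4 → Fin 4 → Prop) :
    ∃ N : ℤ, ∀ C ∈ lorentzOrd d α, ZAvoids (Ioo 0 1) C → HasNu C N := by
  by_cases hex : ∃ C ∈ lorentzOrd d α, ZAvoids (Ioo 0 1) C
  · obtain ⟨C₀, hC₀, h₀⟩ := hex
    obtain ⟨j, hj⟩ := exists_turns_logU_sub_logV hC₀.1 h₀
    refine ⟨-1 * j, fun C hC h => isCrossingChart_div.hasNumber (L := fun C => logU C - logV C)
      (continuousOn_logU.sub continuousOn_logV) ?_ ?_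
      (lorentz_subset_regular hC.1) h (exists_isPathTo hd hC.1) ?_⟩
    · intro C hC z w hp
      rw [Complex.exp_sub, exp_logU hC, exp_logV hC, hp.1, hp.2, div_mul_div_comm]
    · intro C hC
      rw [Complex.sub_im, logU_im_eq_zero hC, logV_im_eq_zero hC, sub_zero]
    · rw [← hj, turns, turns, Complex.sub_im, Complex.sub_im, logU_im_congr hC hC₀,
        logV_im_congr hC hC₀]
  · exact ⟨0, fun C hC h => absurd ⟨C, hC, h⟩ hex⟩

lemma HasNumber.unique {I : Set ℝ} {C : Config d} {M N : ℤ} (hM : HasNumber I C M)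
    (hN : HasNumber I C N) : M = N := by
  obtain ⟨γ, hγ⟩ := hM.1
  exact (hN.2 γ hγ M).1 ((hM.2 γ hγ M).2 rfl)

lemma and_hasNumber_zero_congr {I : Set ℝ} {C C' : Config d} {N : ℤ}
    (h : ZAvoids I C → HasNumber I C N) (h' : ZAvoids I C' → HasNumber I C' N)
    (hI : ZAvoids I C ↔ ZAvoids I C') :
    ZAvoids I C ∧ HasNumber I C 0 ↔ ZAvoids I C' ∧ HasNumber I C' 0 := by
  have key : ∀ {C : Config d}, (ZAvoids I C → HasNumber I C N) →
      (ZAvoids I C ∧ HasNumber I C 0 ↔ ZAvoids I C ∧ N = 0) := fun h =>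
    and_congr_right fun ha => ⟨fun h0 => (h ha).unique h0, fun h0 => h0 ▸ h ha⟩
  rw [key h, key h', hI]

lemma sChannelConverges_of_sCriterion (hd : 2 ≤ d) {F : UnitaryCFT d} {G : Config d → ℂ}
    (hG : IsContinuation F G) {C : Config d} (hC : C ∈ lorentz d) (h : SCriterion C) :
    SChannelConverges F G C := by
  refine sChannelConverges F hG hC (fun z w hp hz => ?_) (exists_isPathTo hd hC)
  refine (h z w hp).1 ⟨hz.1, lt_of_le_of_ne (mem_Ici.1 hz.2) fun h1 => ?_⟩
  exact hp.ne_one (lorentz_subset_regular hC) (Complex.ext h1.symm hz.1)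

/-- Whether `z, z̄` avoid the intervals of the three criteria is the same at all configurations of
a class. -/
lemma zAvoids_congr_of_mem_class {K : Set (Config d)}
    (hK : K ∈ ({classS d, classT d, classU d, classEst d, classEsu d, classEtu d, classEstu d} :
      Set (Set (Config d)))) {C C' : Config d} (hC : C ∈ K) (hC' : C' ∈ K) :
    (ZAvoids (Ioi 1) C ↔ ZAvoids (Ioi 1) C') ∧ (ZAvoids (Iio 0) C ↔ ZAvoids (Iio 0) C') ∧
      (ZAvoids (Ioo 0 1) C ↔ ZAvoids (Ioo 0 1) C') := by
  rcases hK with rfl | rfl | rfl | rfl | rfl | rfl | rfl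
  · obtain ⟨⟨a, b, c⟩, a', b', c'⟩ :=
      And.intro (zAvoids_of_mem_classS hC) (zAvoids_of_mem_classS hC')
    exact ⟨iff_of_true a a', iff_of_false b b', iff_of_false c c'⟩
  · obtain ⟨⟨a, b, c⟩, a', b', c'⟩ :=
      And.intro (zAvoids_of_mem_classT hC) (zAvoids_of_mem_classT hC')
    exact ⟨iff_of_false a a', iff_of_true b b', iff_of_false c c'⟩
  · obtain ⟨⟨a, b, c⟩, a', b', c'⟩ :=
      And.intro (zAvoids_of_mem_classU hC) (zAvoids_of_mem_classU hC')
    exact ⟨iff_of_false a a', iff_of_false b b', iff_of_true c c'⟩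
  · obtain ⟨⟨a, b, c⟩, a', b', c'⟩ :=
      And.intro (zAvoids_of_mem_classEst hC) (zAvoids_of_mem_classEst hC')
    exact ⟨iff_of_true a a', iff_of_true b b', iff_of_false c c'⟩
  · obtain ⟨⟨a, b, c⟩, a', b', c'⟩ :=
      And.intro (zAvoids_of_mem_classEsu hC) (zAvoids_of_mem_classEsu hC')
    exact ⟨iff_of_true a a', iff_of_false b b', iff_of_true c c'⟩
  · obtain ⟨⟨a, b, c⟩, a', b', c'⟩ :=
      And.intro (zAvoids_of_mem_classEtu hC) (zAvoids_of_mem_classEtu hC')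
    exact ⟨iff_of_false a a', iff_of_true b b', iff_of_true c c'⟩
  · have h := fun I => iff_of_true (zAvoids_of_mem_classEstu hC I) (zAvoids_of_mem_classEstu hC' I)
    exact ⟨h _, h _, h _⟩

end LorentzOPE

theorem theorem4p3 (d : ℕ) (hd : 3 ≤ d) (F : UnitaryCFT d) :
    (∃ G : Config d → ℂ, IsContinuation F G) ∧
    ∀ G : Config d → ℂ, IsContinuation F G → ∀ α : Fin 4 → Fin 4 → Prop,
      (lorentzOrd d α ⊆ classS d ∨ lorentzOrd d α ⊆ classT d ∨
        lorentzOrd d α ⊆ classU d ∨ lorentzOrd d α ⊆ classE d) ∧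
      (lorentzOrd d α ⊆ classS d → ∀ C ∈ lorentzOrd d α,
        SChannelConverges F G C ∧ SCriterion C ∧ ¬ TCriterion C ∧ ¬ UCriterion C) ∧
      (lorentzOrd d α ⊆ classT d → ∃ N : ℤ, ∀ C ∈ lorentzOrd d α, HasNt C N) ∧
      (lorentzOrd d α ⊆ classU d → ∃ N : ℤ, ∀ C ∈ lorentzOrd d α, HasNu C N) ∧
      (lorentzOrd d α ⊆ classE d →
        (∃ Nt : ℤ, ∀ C ∈ lorentzOrd d α ∩ classEst d,
          SChannelConverges F G C ∧ SCriterion C ∧ HasNt C Nt) ∧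
        (∃ Nu : ℤ, ∀ C ∈ lorentzOrd d α ∩ classEsu d,
          SChannelConverges F G C ∧ SCriterion C ∧ HasNu C Nu) ∧
        (∃ Nt Nu : ℤ, ∀ C ∈ lorentzOrd d α ∩ classEtu d,
          ¬ SCriterion C ∧ HasNt C Nt ∧ HasNu C Nu) ∧
        (∃ Nt Nu : ℤ, ∀ C ∈ lorentzOrd d α ∩ classEstu d,
          SChannelConverges F G C ∧ SCriterion C ∧ HasNt C Nt ∧ HasNu C Nu)) ∧
      (∀ K ∈ ({classS d, classT d, classU d, classEst d, classEsu d, classEtu d, classEstu d} :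
          Set (Set (Config d))),
        ∀ C ∈ lorentzOrd d α ∩ K, ∀ C' ∈ lorentzOrd d α ∩ K,
          (SCriterion C ↔ SCriterion C') ∧ (TCriterion C ↔ TCriterion C') ∧
            (UCriterion C ↔ UCriterion C')) := by
  have hd' : 2 ≤ d := by omega
  refine ⟨⟨radialG F, isContinuation_radialG F⟩, fun G hG α => ?_⟩
  obtain ⟨Nt, hNt⟩ := exists_forall_hasNt hd' α
  obtain ⟨Nu, hNu⟩ := exists_forall_hasNu hd' α
  have hs : ∀ C ∈ lorentzOrd d α, SCriterion C → SChannelConverges F G C :=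
    fun C hC h => sChannelConverges_of_sCriterion hd' hG hC.1 h
  refine ⟨lorentzOrd_subset_class α, fun hα C hC => ?_, fun hα => ⟨Nt, fun C hC => ?_⟩,
    fun hα => ⟨Nu, fun C hC => ?_⟩, fun _ => ⟨⟨Nt, fun C hC => ?_⟩, ⟨Nu, fun C hC => ?_⟩,
    ⟨Nt, Nu, fun C hC => ?_⟩, ⟨Nt, Nu, fun C hC => ?_⟩⟩, fun K hK C hC C' hC' => ?_⟩
  · obtain ⟨h1, h2, h3⟩ := zAvoids_of_mem_classS (hα hC)
    exact ⟨hs C hC h1, h1, fun h => h2 h.1, fun h => h3 h.1⟩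
  · exact hNt C hC (zAvoids_of_mem_classT (hα hC)).2.1
  · exact hNu C hC (zAvoids_of_mem_classU (hα hC)).2.2
  · obtain ⟨h1, h2, -⟩ := zAvoids_of_mem_classEst hC.2
    exact ⟨hs C hC.1 h1, h1, hNt C hC.1 h2⟩
  · obtain ⟨h1, -, h3⟩ := zAvoids_of_mem_classEsu hC.2
    exact ⟨hs C hC.1 h1, h1, hNu C hC.1 h3⟩
  · obtain ⟨h1, h2, h3⟩ := zAvoids_of_mem_classEtu hC.2
    exact ⟨h1, hNt C hC.1 h2, hNu C hC.1 h3⟩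
  · have h := zAvoids_of_mem_classEstu hC.2
    exact ⟨hs C hC.1 (h _), h _, hNt C hC.1 (h _), hNu C hC.1 (h _)⟩
  · obtain ⟨h1, h2, h3⟩ := zAvoids_congr_of_mem_class hK hC.2 hC'.2
    exact ⟨h1, and_hasNumber_zero_congr (hNt C hC.1) (hNt C' hC'.1) h2,
      and_hasNumber_zero_congr (hNu C hC.1) (hNu C' hC'.1) h3⟩
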